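/- Let $p\ge 0$ and $n\ge 0$ be integers, and let $G_n$ be one of the complex groups $\mathrm{GL}_n(\mathbb C)$, $\mathrm O_n(\mathbb C)$, $\mathrm{Sp}_n(\mathbb C)$ ($n$ even in the last case). Put $m=0,1,-1$ in the three cases, $n'=n/(1+|m|)$, and assume $(1+|m|)\,p\le n$. For $G_n=\mathrm O_n,\mathrm{Sp}_n$ let $\beta$ be the matrix of the bilinear form on $\mathbb C^n$ preserved by $G_n$; it is unitary and $\beta^{\mathrm t}=m\beta$. *Spaces.* $V=\mathrm{Hom}(\mathbb C^n,\mathbb C^p)\oplus\mathrm{Hom}(\mathbb C^p,\mathbb C^n)$, and $V_{\mathbb R}=\{L\oplus L^\dagger\}\subset V$ carries the Euclidean volume $\mathrm{dvol}$ of the norm square $\mathrm{Tr}(LL^\dagger)$. For $\mathrm{GL}_n$ let $U_p=\mathbb C^p$, $W=\mathrm{End}(\mathbb C^p)$, $Q(L\oplus\tilde L)=L\tilde L$. For $\mathrm O_n,\mathrm{Sp}_n$ let $U_p=\mathbb C^p\oplus(\mathbb C^p)^*$ with the bilinear form $b(v\oplus\varphi,v'\oplus\varphi')=\varphi'(v)+m\,\varphi(v')$,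 let $W=\{w\in\mathrm{End}(U_p): b(wx,y)=b(x,wy)\}$ and $$Q(L\oplus\tilde L)=\begin{pmatrix}L\tilde L & L\beta^{-1}L^{\mathrm t}\\ \tilde L^{\mathrm t}\beta\tilde L&\tilde L^{\mathrm t}L^{\mathrm t}\end{pmatrix}\in W .$$ *Groups.* $K_n=\mathrm U_n,\ \mathrm O_n(\mathbb R),\ \mathrm{USp}_n$ is the unitary subgroup of $G_n$, and $K_{n,p}=\mathrm U_{n-p},\ \mathrm O_{n-2p}(\mathbb R),\ \mathrm{USp}_{n-2p}$, respectively; $\mathrm{vol}$ is their Riemannian volume for the invariant metric given on the Lie algebra by $A\mapsto-(1+|m|)^{-1}\mathrm{Tr}\,A^2$. Let $G_p$ be $\mathrm{GL}_p(\mathbb C)$ for $\mathrm{GL}_n$; in the other two cases let $G_p$ consist of all $g\in\mathrm{GL}(U_p)$ commuting with the anti-linear map $u\oplus\varphi\mapsto c^{-1}\varphi\oplus m\,c\,u$, where $c\,v=\langle v,\cdot\rangle$ (so $G_p\cong\mathrm{GL}_{2p}(\mathbb R)$, $\mathrm{GL}_p(\mathbb H)$). *Domain.* $D_p$ is the set of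 positive (definite) Hermitian operators in $W$. Let $d=\dim_{\mathbb R}D_p=p\,(p(1+|m|)+m)$ and $\mathrm{Tr}'=(1+|m|)^{-1}\mathrm{Tr}_{U_p}$, and let $d\mu_{D_p}(x)=\mathrm{Det}(x)^{-d/\dim U_p}\,dx$ (exponent $0$ if $p=0$), where $dx$ is the Euclidean volume density of the norm square $\mathrm{Tr}'H^2$ on the Hermitian operators in $W$; thus at $x=\mathrm{Id}$ the measure $d\mu_{D_p}$ agrees with this Euclidean density. Then the following hold. 1. $d\mu_{D_p}$ is invariant under $x\mapsto gxg^\dagger$ for all $g\in G_p$. 2. Let $f$ be a holomorphic function on $V$ with $f(L\oplus\tilde L)=f(Lh\oplus h^{-1}\tilde L)$ for all $h\in G_n$, such that $L\mapsto f(L\oplus L^\dagger)$ is a Schwartz function, and let $F$ be a holomorphic function on $W$ with $F\circ Q=f$. Then both integrals below converge absolutely and $$\int_{V_{\mathbb R}} f\,\mathrm{dvol}=2^{-p(n+m)}\,\frac{\mathrm{vol}(K_n)}{\mathrm{vol}(K_{n,p})}\int_{D_p}F(x)\,\mathrm{Det}^{n'}(x)\,d\mu_{D_p}(x).$$ 3.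 $$\int_{D_p}e^{-\mathrm{Tr}'x}\,\mathrm{Det}^{n'}(x)\,d\mu_{D_p}(x)=(2\pi)^{pn}\,2^{pm}\,\frac{\mathrm{vol}(K_{n,p})}{\mathrm{vol}(K_n)}.$$ -/

import Mathlib

open MeasureTheory Matrix
open scoped ComplexOrder SchwartzMap

/-- Spaces of complex matrices carry the product (that is, the Borel) sigma-algebra. -/
noncomputable instance matrixMeasurableSpace {ι κ : Type*} : MeasurableSpace (Matrix ι κ ℂ) :=
  inferInstanceAs (MeasurableSpace (ι → κ → ℂ))

namespace BosonSector

noncomputable section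

/-- The matrix with the coordinates `v`. It identifies the Euclidean space `EuclideanSpace ℂ (ι × κ)`
with the space of complex matrices with norm square `Tr (A Aᴴ) = ∑ |A i j|²`. -/
def toMatrix {ι κ : Type*} [Fintype ι] [Fintype κ] (v : EuclideanSpace ℂ (ι × κ)) :
    Matrix ι κ ℂ :=
  Matrix.of fun i j => v (i, j)

/-- The `d`-dimensional Riemannian volume measure, for `d`-dimensional submanifolds of a space of
complex matrices, of the metric induced by the rescaled Euclidean structure
`A ↦ s⁻¹ Tr (A Aᴴ)`. (`μHE[d]` is the Hausdorff measure normalized to agree with Lebesgue measure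
on `d`-dimensional Euclidean space; rescaling lengths by `s^(-1/2)` rescales it by `s^(-d/2)`.) -/
def traceVolume {ι κ : Type*} [Fintype ι] [Fintype κ] (s d : ℕ) : Measure (Matrix ι κ ℂ) :=
  ENNReal.ofReal ((s : ℝ) ^ (-(d : ℝ) / 2)) •
    (μHE[d] : Measure (EuclideanSpace ℂ (ι × κ))).map toMatrix

/-- The canonical volume of the Euclidean space `Hom(ℂⁿ, ℂᵖ)` with norm square `Tr (L Lᴴ)`. -/
def dvol (p n : ℕ) : Measure (Matrix (Fin p) (Fin n) ℂ) :=
  traceVolume 1 (2 * p * n)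

/-! ### Groups -/

/-- The volume of `U(n)` for the invariant metric given at the identity by `A ↦ -Tr A²`. On
anti-Hermitian matrices this form is `Tr (A Aᴴ)`, so the metric is the one induced by the
embedding in the space of matrices, because multiplication by a unitary is an isometry there. -/
def volU (n : ℕ) : ℝ :=
  (traceVolume 1 (n ^ 2)).real (unitaryGroup (Fin n) ℂ : Set (Matrix (Fin n) (Fin n) ℂ))

/-- `β` is the matrix of a non-degenerate bilinear form on `ℂⁿ`, symmetric for `m = 1` and
alternating for `m = -1`, which is compatible with the Hermitian structure (`β` is unitary). -/
def IsForm (m : ℤ) {n : ℕ} (β : Matrix (Fin n) (Fin n) ℂ) : Prop :=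
  β ∈ unitaryGroup (Fin n) ℂ ∧ βᵀ = m • β

/-- The complex group of all invertible matrices that preserve the bilinear form `β`:
`O_n(ℂ)` if `β` is symmetric, `Sp_n(ℂ)` if `β` is alternating. -/
def formGroup {n : ℕ} (β : Matrix (Fin n) (Fin n) ℂ) : Set (GL (Fin n) ℂ) :=
  {g | (g : Matrix (Fin n) (Fin n) ℂ)ᵀ * β * (g : Matrix (Fin n) (Fin n) ℂ) = β}

/-- The compact group of all unitary matrices that preserve the bilinear form `β`:
`O_n(ℝ)` if `β` is symmetric, `USp_n` if `β` is alternating. -/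
def compactFormGroup {n : ℕ} (β : Matrix (Fin n) (Fin n) ℂ) : Set (Matrix (Fin n) (Fin n) ℂ) :=
  {k | k ∈ unitaryGroup (Fin n) ℂ ∧ kᵀ * β * k = β}

/-- The volume of `O_n(ℝ)` (`m = 1`) or `USp_n` (`m = -1`), a group of dimension `n (n - m) / 2`,
for the invariant metric given at the identity by `A ↦ -(1/2) Tr A²`. -/
def volK (m : ℤ) {n : ℕ} (β : Matrix (Fin n) (Fin n) ℂ) : ℝ :=
  (traceVolume 2 ((n : ℤ) * (n - m) / 2).toNat).real (compactFormGroup β)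

/-! ### The space `W`, the group `G_p`, and the quadratic map -/

/-- The Gram matrix of the canonical symmetric (`m = 1`) or alternating (`m = -1`) bilinear form
`(v ⊕ φ, v' ⊕ φ') ↦ φ'(v) + m φ(v')` of `U_p = ℂᵖ ⊕ (ℂᵖ)*`, in the standard basis. -/
def canonicalForm (m : ℤ) (p : ℕ) : Matrix (Fin p ⊕ Fin p) (Fin p ⊕ Fin p) ℂ :=
  fromBlocks 0 1 (m • 1) 0

/-- `Sym_b(U_p)`: the endomorphisms `M` of `U_p` with `b(M x, y) = b(x, M y)`. -/
def symSpace (m : ℤ) (p : ℕ) : Submodule ℂ (Matrix (Fin p ⊕ Fin p) (Fin p ⊕ Fin p) ℂ) where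
  carrier := {M | Mᵀ * canonicalForm m p = canonicalForm m p * M}
  add_mem' := by
    intro a b ha hb
    simp only [Set.mem_ofPred_eq] at ha hb ⊢
    rw [transpose_add, add_mul, mul_add, ha, hb]
  zero_mem' := by simp
  smul_mem' := by
    intro c a ha
    simp only [Set.mem_ofPred_eq] at ha ⊢
    rw [transpose_smul, smul_mul_assoc, mul_smul_comm, ha]

/-- The group `G_p` of all invertible `g` that commute with the anti-linear operator
`C (u ⊕ φ) = c⁻¹ φ ⊕ m (c u)` of `U_p`, where `c : ℂᵖ → (ℂᵖ)*`, `c v = ⟨v, ·⟩`. In coordinates `C`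
is complex conjugation followed by the canonical Gram matrix. This group is isomorphic to
`GL_{2p}(ℝ)` for `m = 1` and to `GL_p(ℍ)` for `m = -1`. -/
def realGroup (m : ℤ) (p : ℕ) : Set (GL (Fin p ⊕ Fin p) ℂ) :=
  {g | (g : Matrix (Fin p ⊕ Fin p) (Fin p ⊕ Fin p) ℂ) * canonicalForm m p =
    canonicalForm m p * (g : Matrix (Fin p ⊕ Fin p) (Fin p ⊕ Fin p) ℂ).map (starRingEnd ℂ)}

/-- The quadratic map `Q` in the case of a bilinear form `β`. -/
def quadMap {p n : ℕ} (β : Matrix (Fin n) (Fin n) ℂ)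
    (v : Matrix (Fin p) (Fin n) ℂ × Matrix (Fin n) (Fin p) ℂ) :
    Matrix (Fin p ⊕ Fin p) (Fin p ⊕ Fin p) ℂ :=
  fromBlocks (v.1 * v.2) (v.1 * β⁻¹ * v.1ᵀ) (v.2ᵀ * β * v.2) (v.2ᵀ * v.1ᵀ)

/-! ### The domain `D_p` and its invariant measure -/

/-- The positive Hermitian operators in `W`. -/
def posDomain {κ : Type*} [Fintype κ] (W : Submodule ℂ (Matrix κ κ ℂ)) : Set (Matrix κ κ ℂ) :=
  {x | x ∈ W ∧ x.PosDef}

/-- The real power `Det(x)^a` of the determinant of a positive Hermitian matrix. -/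
def detPow {κ : Type*} [Fintype κ] [DecidableEq κ] (a : ℝ) (x : Matrix κ κ ℂ) : ℝ :=
  x.det.re ^ a

/-- The measure `Det(x)^(-d/N) dvol(x)` on the `d`-dimensional manifold of positive Hermitian
operators in `W ⊆ Mat_N(ℂ)`, where `dvol` is the Euclidean volume density of the norm square
`s⁻¹ Tr (H²)` on the Hermitian operators in `W`. At the identity it agrees with `dvol`. -/
def invMeasure {κ : Type*} [Fintype κ] [DecidableEq κ] (s d : ℕ)
    (W : Submodule ℂ (Matrix κ κ ℂ)) : Measure (Matrix κ κ ℂ) :=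
  ((traceVolume s d).restrict (posDomain W)).withDensity
    fun x => ENNReal.ofReal (detPow (-((d : ℝ) / Fintype.card κ)) x)

/-- The measure `dμ_{D_p}` for `G_n = GL_n`: here `W = End(ℂᵖ)` and `dim D_p = p²`. -/
def muU (p : ℕ) : Measure (Matrix (Fin p) (Fin p) ℂ) :=
  invMeasure 1 (p ^ 2) ⊤

/-- The measure `dμ_{D_p}` for `G_n = O_n` (`m = 1`) and `G_n = Sp_n` (`m = -1`): here
`W = Sym_b(U_p)` and `dim D_p = p (2 p + m)`. -/
def muK (m : ℤ) (p : ℕ) : Measure (Matrix (Fin p ⊕ Fin p) (Fin p ⊕ Fin p) ℂ) :=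
  invMeasure 2 ((p : ℤ) * (2 * p + m)).toNat (symSpace m p)

/-- The restriction `L ↦ f(L, Lᴴ)` of `f` to the real subspace `V_ℝ`, in the coordinate `L`. -/
def realRestriction {p n : ℕ} (f : Matrix (Fin p) (Fin n) ℂ × Matrix (Fin n) (Fin p) ℂ → ℂ)
    (L : Matrix (Fin p) (Fin n) ℂ) : ℂ :=
  f (L, Lᴴ)

/-- `φ` is a Schwartz function of the matrix entries. -/
def IsSchwartz {p n : ℕ} (φ : Matrix (Fin p) (Fin n) ℂ → ℂ) : Prop :=
  ∃ ψ : 𝓢(Fin p → Fin n → ℂ, ℂ), ∀ L, ψ (fun i j => L i j) = φ L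

end

end BosonSector

/-! On `V_ℝ` the map `Q` is a Gram map. For `GL_n` one has `Q(L, Lᴴ) = L Lᴴ`. For a form `β`,
stacking `L` on `conj(L) β` gives a matrix `X` with `X Xᴴ = Q(L, Lᴴ)` (`formLin_mul_star`), and
these `X` are exactly the matrices that intertwine the anti-unitary operators given by `conj(β)` on
`ℂⁿ` and by the canonical form on `U_p` (`map_formLin`). All three cases thus become one question:
what is the image of Lebesgue measure on a space of intertwiners under `X ↦ X Xᴴ`? For `m = 0` the
intertwining condition is void, and `scale m = 1 + |m|` makes the dimension and Jacobian formulas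
uniform.

Up to a constant the answer follows from symmetry. The invertible intertwiners `g` act on the
positive cone by `x ↦ g x gᴴ`, and transitively, because positive elements have square roots
commuting with the real structure (`exists_sqrt_mem`). The Jacobians of the linear actions are
powers of `|det g|`, because a multiplicative function on matrices is determined by its values on
scalars (`character_eq_of_scalar`). So both the image measure and Lebesgue measure on the cone
become invariant after multiplication by a power of `Det`. Two nonzero σ-finite invariant measures
are proportional (`IsInvariant.eq_smul`): the double integral of `φ(x) ψ(g x gᴴ)` over the cone and
the group is evaluated in two orders. This gives the invariance of `dμ_{D_p}` and the integration
formula with an unknown factor `k` (`exists_gramVol_eq`).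

The factor is found in two stages. For square matrices, a neighbourhood of the unitary group
consists of the products `(1 + h) k` with `h` small Hermitian and `k` unitary. Near `k = 1` this
product is almost isometric to the orthogonal sum of `h` and the anti-Hermitian part of `k`, while
`(1 + h)²` stretches the Hermitian directions by almost 2. Hence `vol(K) = k 2^{dim herm}`
(`unitaryVol_eq`). Integrating `exp(-Tr x)` rewrites this as an identity between `vol(K)` and a
value of the Gamma integral of the cone (`unitaryVol_mul_gammaInt`).

For rectangular matrices the same Gaussian integral expresses `k` by another Gamma value. Splitting
the larger space as `a ⊕ c`, Schur complements factor its Gamma integral into those of `a` and `c`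
(`gammaInt_fromBlocks`). Eliminating the Gamma values leaves the ratio of the volumes of the unitary
groups of the whole space and of the complement `c`, with explicit powers of 2 (`gramVol_eq`).

What remains is the normalization of the metrics (`gramVol_eq_invMeasure`, `integral_formula`). The
third assertion is the integration formula for a Gaussian, whose integral over `V_ℝ` is `π^{pn}`. -/

namespace BosonSector

noncomputable section

set_option linter.unusedSectionVars false

/-! ### Euclidean volume on linear subspaces -/

section SubVol

open Module

variable {E F V : Type*}
  [NormedAddCommGroup E] [InnerProductSpace ℝ E] [FiniteDimensional ℝ E]
  [MeasurableSpace E] [BorelSpace E]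
  [NormedAddCommGroup F] [InnerProductSpace ℝ F] [FiniteDimensional ℝ F]
  [MeasurableSpace F] [BorelSpace F]
  [NormedAddCommGroup V] [InnerProductSpace ℝ V] [FiniteDimensional ℝ V]
  [MeasurableSpace V] [BorelSpace V]

/-- The Euclidean volume of a linear subspace, as a measure on the ambient space. -/
def subVol (S : Submodule ℝ E) : Measure E :=
  (μHE[finrank ℝ S] : Measure E).restrict (S : Set E)

/-- Hausdorff measure is intrinsic, so an isometric embedding carries Lebesgue measure to the
Hausdorff measure on its image. This is the bridge between the Hausdorff normalization in the
definitions and ordinary Haar measure. -/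
lemma map_volume_linearIsometry (f : V →ₗᵢ[ℝ] E) :
    (volume : Measure V).map f = subVol (LinearMap.range f.toLinearMap) := by
  rw [← InnerProductSpace.euclideanHausdorffMeasure_eq_volume,
    f.isometry.map_euclideanHausdorffMeasure, subVol,
    LinearMap.finrank_range_of_inj f.injective]
  rfl

lemma measurableSet_submodule (S : Submodule ℝ E) : MeasurableSet (S : Set E) :=
  S.closed_of_finiteDimensional.measurableSet

lemma subVol_eq_map (S : Submodule ℝ E) :
    subVol S = (volume : Measure S).map ((↑) : S → E) := by
  have h := map_volume_linearIsometry S.subtypeₗᵢ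
  have hr : LinearMap.range S.subtypeₗᵢ.toLinearMap = S := Submodule.range_subtype S
  rw [hr] at h
  exact h.symm

lemma measurableEmbedding_coe (S : Submodule ℝ E) : MeasurableEmbedding ((↑) : S → E) :=
  MeasurableEmbedding.subtype_coe (measurableSet_submodule S)

instance sigmaFinite_subVol (S : Submodule ℝ E) : SigmaFinite (subVol S) := by
  rw [subVol_eq_map]
  exact (measurableEmbedding_coe S).sigmaFinite_map

lemma subVol_compl (S : Submodule ℝ E) : subVol S (S : Set E)ᶜ = 0 := by
  rw [subVol, Measure.restrict_apply (measurableSet_submodule S).compl]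
  simp

lemma ae_mem_subVol (S : Submodule ℝ E) : ∀ᵐ x ∂subVol S, x ∈ S :=
  subVol_compl S

lemma subVol_of_le (S : Submodule ℝ E) {t : Set E} (h : t ⊆ S) :
    subVol S t = μHE[finrank ℝ S] t := by
  rw [subVol, Measure.restrict_eq_self _ h]

lemma map_add_subVol (S : Submodule ℝ E) {x : E} (hx : x ∈ S) :
    (subVol S).map (fun y => x + y) = subVol S := by
  rw [subVol_eq_map, Measure.map_map (by fun_prop) (by fun_prop)]
  have : (fun y => x + y) ∘ ((↑) : S → E) = (↑) ∘ fun y : S => (⟨x, hx⟩ : S) + y := rfl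
  rw [this, ← Measure.map_map (by fun_prop) (by fun_prop), map_add_left_eq_self]

lemma map_linear_subVol (S : Submodule ℝ E) (T : E →ₗ[ℝ] E) (hT : ∀ x ∈ S, T x ∈ S)
    (hd : LinearMap.det (T.restrict hT) ≠ 0) :
    (subVol S).map T = ENNReal.ofReal |(LinearMap.det (T.restrict hT))⁻¹| • subVol S := by
  have hTm : Measurable T := (LinearMap.continuous_of_finiteDimensional T).measurable
  have hTm' : Measurable (T.restrict hT) :=
    (LinearMap.continuous_of_finiteDimensional _).measurable
  rw [subVol_eq_map, Measure.map_map hTm (by fun_prop)]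
  have : T ∘ ((↑) : S → E) = (↑) ∘ (T.restrict hT) := rfl
  rw [this, ← Measure.map_map (by fun_prop) hTm',
    Measure.map_linearMap_addHaar_eq_smul_addHaar _ hd, Measure.map_smul]

lemma map_smul_subVol (S : Submodule ℝ E) {c : ℝ} (hc : c ≠ 0) :
    (subVol S).map (fun x => c • x) = ENNReal.ofReal |(c ^ finrank ℝ S)⁻¹| • subVol S := by
  rw [subVol_eq_map, Measure.map_map (by fun_prop) (by fun_prop)]
  have : (fun x => c • x) ∘ ((↑) : S → E) = (↑) ∘ (fun x : S => c • x) := rfl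
  rw [this, ← Measure.map_map (by fun_prop) (by fun_prop), Measure.map_addHaar_smul _ hc,
    Measure.map_smul]

lemma map_isometry_subVol (S : Submodule ℝ E) (T : E →ₗ[ℝ] F) (hT : ∀ x ∈ S, ‖T x‖ = ‖x‖) :
    (subVol S).map T = subVol (S.map T) := by
  have hTm : Measurable T := (LinearMap.continuous_of_finiteDimensional T).measurable
  let f : S →ₗᵢ[ℝ] F := ⟨T ∘ₗ S.subtype, fun x => hT x x.2⟩
  have h := map_volume_linearIsometry f
  have hr : LinearMap.range f.toLinearMap = S.map T := by
    show LinearMap.range (T ∘ₗ S.subtype) = _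
    rw [LinearMap.range_comp, Submodule.range_subtype]
  rw [hr] at h
  rw [← h, subVol_eq_map, Measure.map_map hTm (by fun_prop)]
  rfl

lemma map_similarity_subVol (S : Submodule ℝ E) (T : E →ₗ[ℝ] F) {c : ℝ} (hc : 0 < c)
    (hT : ∀ x ∈ S, ‖T x‖ = c * ‖x‖) :
    (subVol S).map T = ENNReal.ofReal (c ^ finrank ℝ S)⁻¹ • subVol (S.map T) := by
  have hTm : Measurable T := (LinearMap.continuous_of_finiteDimensional T).measurable
  have h1 := map_isometry_subVol S (c⁻¹ • T) (fun x hx => by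
    rw [LinearMap.smul_apply, norm_smul, hT x hx, norm_inv, Real.norm_of_nonneg hc.le]
    field_simp)
  have h2 : S.map (c⁻¹ • T) = S.map T := Submodule.map_smul _ _ _ (inv_ne_zero hc.ne')
  have h3 := map_smul_subVol S hc.ne'
  rw [abs_of_nonneg (by positivity)] at h3
  have h4 : (T : E → F) = (c⁻¹ • T) ∘ (fun x => c • x) := by
    ext x
    simp [smul_smul, hc.ne']
  have h5 : Measurable (c⁻¹ • T) := (LinearMap.continuous_of_finiteDimensional _).measurable
  rw [h4, ← Measure.map_map h5 (by fun_prop), h3, Measure.map_smul, h1, h2]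

/-- The Pythagorean hypothesis makes addition a linear isometry from the `L²` product, whose volume
is the product measure. -/
lemma map_add_prod_subVol (S₁ S₂ : Submodule ℝ E)
    (h : ∀ x ∈ S₁, ∀ y ∈ S₂, ‖x + y‖ ^ 2 = ‖x‖ ^ 2 + ‖y‖ ^ 2) :
    ((subVol S₁).prod (subVol S₂)).map (fun p => p.1 + p.2) = subVol (S₁ ⊔ S₂) := by
  let f : WithLp 2 (S₁ × S₂) →ₗᵢ[ℝ] E :=
    { toFun := fun p => (p.fst : E) + (p.snd : E)
      map_add' := fun p q => by
        simp only [WithLp.add_fst, WithLp.add_snd, Submodule.coe_add]; abel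
      map_smul' := fun r p => by simp
      norm_map' := fun p => by
        have h1 := h p.fst p.fst.2 p.snd p.snd.2
        rw [WithLp.prod_norm_eq_of_L2, ← Real.sqrt_sq (norm_nonneg _)]
        congr 1 }
  have hf := map_volume_linearIsometry f
  have hr : LinearMap.range f.toLinearMap = S₁ ⊔ S₂ := by
    ext x
    simp only [LinearMap.mem_range, Submodule.mem_sup]
    constructor
    · rintro ⟨p, rfl⟩
      exact ⟨p.fst, p.fst.2, p.snd, p.snd.2, rfl⟩
    · rintro ⟨y, hy, z, hz, rfl⟩
      exact ⟨WithLp.toLp 2 (⟨y, hy⟩, ⟨z, hz⟩), rfl⟩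
  rw [hr] at hf
  rw [← hf, subVol_eq_map, subVol_eq_map, Measure.map_prod_map _ _ (by fun_prop) (by fun_prop),
    Measure.map_map (by fun_prop) (by fun_prop)]
  have h2 := (WithLp.volume_preserving_ofLp S₁ S₂)
  rw [← Measure.volume_eq_prod, ← h2.map_eq, Measure.map_map (by fun_prop) h2.measurable]
  rfl

lemma lintegral_gaussian_subVol (S : Submodule ℝ E) :
    ∫⁻ x, ENNReal.ofReal (Real.exp (-‖x‖ ^ 2)) ∂subVol S =
      ENNReal.ofReal (Real.pi ^ ((finrank ℝ S : ℝ) / 2)) := by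
  rw [subVol_eq_map, lintegral_map (by fun_prop) (by fun_prop)]
  have h := GaussianFourier.integral_rexp_neg_mul_sq_norm (V := S) one_pos
  rw [div_one] at h
  have hi : Integrable (fun v : S => Real.exp (-1 * ‖v‖ ^ 2)) := by
    by_contra hc
    rw [integral_undef hc] at h
    have : (0 : ℝ) < Real.pi ^ ((finrank ℝ S : ℝ) / 2) := by positivity
    linarith
  rw [← h, ofReal_integral_eq_lintegral_ofReal hi (Filter.Eventually.of_forall fun _ =>
    (Real.exp_pos _).le)]
  simp

lemma subVol_pos (S : Submodule ℝ E) {U : Set E} (hU : IsOpen U) (h : (U ∩ S).Nonempty) :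
    0 < subVol S U := by
  rw [subVol_eq_map, Measure.map_apply (by fun_prop) hU.measurableSet]
  obtain ⟨x, hx, hxS⟩ := h
  exact (hU.preimage continuous_subtype_val).measure_pos _ ⟨⟨x, hxS⟩, hx⟩

lemma subVol_lt_top (S : Submodule ℝ E) {U : Set E} (hU : Bornology.IsBounded U) :
    subVol S U < ⊤ := by
  obtain ⟨r, hr⟩ := hU.subset_closedBall 0
  refine (measure_mono hr).trans_lt ?_
  rw [subVol_eq_map, Measure.map_apply (by fun_prop) Metric.isClosed_closedBall.measurableSet]
  refine (measure_mono (?_ : _ ⊆ Metric.closedBall (0 : S) r)).trans_lt measure_closedBall_lt_top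
  intro x hx
  rw [Set.mem_preimage, mem_closedBall_zero_iff] at hx
  rwa [mem_closedBall_zero_iff]

/-- Comparison of Hausdorff measures of two images of an index set. -/
lemma euclideanHausdorffMeasure_range_le {ι X Y : Type*} [MetricSpace X] [MeasurableSpace X]
    [BorelSpace X] [MetricSpace Y] [MeasurableSpace Y] [BorelSpace Y] (d : ℕ) (f : ι → X)
    (g : ι → Y) (C : ℝ) (hC : 0 ≤ C) (h : ∀ i j, dist (f i) (f j) ≤ C * dist (g i) (g j)) :
    μHE[d] (Set.range f) ≤ ENNReal.ofReal (C ^ d) * μHE[d] (Set.range g) := by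
  rcases isEmpty_or_nonempty ι with hι | hι
  · rw [Set.range_eq_empty f, measure_empty]
    exact bot_le
  -- The distance bound forces `f` to factor through `g`, so the choice of preimage is immaterial;
  -- `k` is the induced map between the images and is `C`-Lipschitz there.
  let k : Y → X := fun y => f (Function.invFun g y)
  have hk : ∀ i, k (g i) = f i := by
    intro i
    have h1 : g (Function.invFun g (g i)) = g i := Function.invFun_eq ⟨i, rfl⟩
    have h2 := h (Function.invFun g (g i)) i
    rw [h1, dist_self, mul_zero] at h2
    exact dist_le_zero.1 h2
  have hL : LipschitzOnWith (Real.toNNReal C) k (Set.range g) := by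
    refine LipschitzOnWith.of_dist_le_mul ?_
    rintro _ ⟨i, rfl⟩ _ ⟨j, rfl⟩
    rw [hk, hk, Real.coe_toNNReal _ hC]
    exact h i j
  have himg : k '' Set.range g = Set.range f := by
    rw [← Set.range_comp]
    congr 1
    ext i
    exact hk i
  have := hL.hausdorffMeasure_image_le (d := d) (by positivity)
  rw [himg] at this
  simp only [Measure.euclideanHausdorffMeasure_def, Measure.smul_apply, ENNReal.smul_def,
    smul_eq_mul]
  rw [mul_left_comm]
  gcongr
  rw [ENNReal.rpow_natCast] at this
  rw [ENNReal.ofReal_pow hC]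
  exact this

end SubVol

end

end BosonSector

namespace BosonSector

noncomputable section

set_option linter.unusedSectionVars false

/-! ### Real forms and determinants -/

section RealForm

open Module Complex

variable {E : Type*} [AddCommGroup E] [Module ℂ E] [Module ℝ E] [IsScalarTower ℝ ℂ E]

/-- `S` is a real form of the complex subspace `W`: `W = S ⊕ i S`. -/
structure IsRealForm (S : Submodule ℝ E) (W : Submodule ℂ E) : Prop where
  le : ∀ x ∈ S, x ∈ W
  indep : ∀ x ∈ S, ∀ y ∈ S, x + I • y = 0 → x = 0 ∧ y = 0
  span : ∀ w ∈ W, ∃ x ∈ S, ∃ y ∈ S, w = x + I • y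

lemma complex_smul_eq (c : ℂ) (x : E) : c • x = c.re • x + I • (c.im • x) := by
  conv_lhs => rw [← re_add_im c, add_smul, mul_comm, mul_smul]
  congr 1
  · rw [← algebraMap_smul ℂ c.re x]; rfl
  · rw [← algebraMap_smul ℂ c.im x]; rfl

/-- A real basis of a real form is a complex basis of the complex space. -/
def IsRealForm.basis {S : Submodule ℝ E} {W : Submodule ℂ E} (h : IsRealForm S W)
    {ι : Type*} [Fintype ι] (b : Basis ι ℝ S) : Basis ι ℂ W := by
  refine Basis.mk (v := fun i => (⟨b i, h.le _ (b i).2⟩ : W)) ?_ ?_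
  · rw [Fintype.linearIndependent_iff]
    intro c hc
    have h1 : ((∑ i, (c i).re • b i : S) : E) + I • ((∑ i, (c i).im • b i : S) : E) = 0 := by
      have h2 := congrArg Subtype.val hc
      simp only [Submodule.coe_sum, Submodule.coe_smul, Submodule.coe_zero] at h2 ⊢
      rw [Finset.smul_sum, ← Finset.sum_add_distrib, ← h2]
      exact Finset.sum_congr rfl fun i _ => (complex_smul_eq _ _).symm
    obtain ⟨h2, h3⟩ := h.indep _ (Subtype.property _) _ (Subtype.property _) h1
    have h4 := Fintype.linearIndependent_iff.1 b.linearIndependent _ (Subtype.ext h2)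
    have h5 := Fintype.linearIndependent_iff.1 b.linearIndependent _ (Subtype.ext h3)
    intro i
    exact Complex.ext (h4 i) (h5 i)
  · rintro ⟨w, hw⟩ -
    obtain ⟨x, hx, y, hy, rfl⟩ := h.span w hw
    have key : ∀ (z : E) (hz : z ∈ S), (⟨z, h.le z hz⟩ : W) ∈
        Submodule.span ℂ (Set.range fun i => (⟨b i, h.le _ (b i).2⟩ : W)) := by
      intro z hz
      have h1 : (⟨z, h.le z hz⟩ : W) =
          ∑ i, ((b.repr ⟨z, hz⟩ i : ℝ) : ℂ) • (⟨b i, h.le _ (b i).2⟩ : W) := by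
        apply Subtype.ext
        have h2 := congrArg Subtype.val (b.sum_repr ⟨z, hz⟩)
        simp only [Submodule.coe_sum, Submodule.coe_smul] at h2 ⊢
        refine h2.symm.trans (Finset.sum_congr rfl fun i _ => ?_)
        rw [complex_smul_eq]
        simp
      rw [h1]
      exact Submodule.sum_mem _ fun i _ =>
        Submodule.smul_mem _ _ (Submodule.subset_span ⟨i, rfl⟩)
    exact Submodule.add_mem _ (key x hx) (Submodule.smul_mem _ I (key y hy))

lemma IsRealForm.coe_basis {S : Submodule ℝ E} {W : Submodule ℂ E} (h : IsRealForm S W)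
    {ι : Type*} [Fintype ι] (b : Basis ι ℝ S) (i : ι) : (h.basis b i : E) = b i := by
  simp [IsRealForm.basis]

lemma IsRealForm.finrank_eq {S : Submodule ℝ E} {W : Submodule ℂ E} (h : IsRealForm S W)
    [FiniteDimensional ℝ S] : finrank ℝ S = finrank ℂ W := by
  have b := finBasis ℝ S
  rw [finrank_eq_card_basis b, finrank_eq_card_basis (h.basis b)]

/-- A real basis of `S` is a complex basis of `W`, and the two maps have the same matrix in it. Real
Jacobians can thus be computed on the complexification. -/
lemma IsRealForm.det_eq {S : Submodule ℝ E} {W : Submodule ℂ E} (h : IsRealForm S W)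
    [FiniteDimensional ℝ S] (T : E →ₗ[ℂ] E) (hW : ∀ x ∈ W, T x ∈ W)
    (T' : S →ₗ[ℝ] S) (hS : ∀ x : S, (T' x : E) = T x) :
    LinearMap.det (T.restrict hW) = ((LinearMap.det T' : ℝ) : ℂ) := by
  have b := finBasis ℝ S
  rw [← LinearMap.det_toMatrix b, ← LinearMap.det_toMatrix (h.basis b)]
  rw [show ((Matrix.det (LinearMap.toMatrix b b T') : ℝ) : ℂ) =
    algebraMap ℝ ℂ (Matrix.det (LinearMap.toMatrix b b T')) from rfl, RingHom.map_det]
  congr 1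
  ext i j
  rw [LinearMap.toMatrix_apply, RingHom.mapMatrix_apply, Matrix.map_apply,
    LinearMap.toMatrix_apply]
  have h1 : (T.restrict hW) (h.basis b j) =
      ∑ k, ((b.repr (T' (b j)) k : ℝ) : ℂ) • h.basis b k := by
    apply Subtype.ext
    have h2 := congrArg Subtype.val (b.sum_repr (T' (b j)))
    simp only [Submodule.coe_sum, Submodule.coe_smul, LinearMap.coe_restrict_apply,
      h.coe_basis] at h2 ⊢
    rw [← hS]
    refine h2.symm.trans (Finset.sum_congr rfl fun k _ => ?_)
    rw [complex_smul_eq]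
    simp
  rw [h1, (h.basis b).repr_sum_self]
  rfl

end RealForm

/-! ### Multiplicative functions of matrices -/

section Character

variable {a : Type*} [Fintype a] [DecidableEq a]

/-- Invertible matrices are products of transvections and diagonal matrices. Permuting diagonal
entries is a conjugation, so `f` treats all entries alike and its value on one entry is the `card
a`-th root of its value on a scalar; transvections must go to 1. Every Jacobian below is obtained by
testing scalars only. -/
lemma character_eq_of_scalar (f : Matrix a a ℂ →* ℝ) (hf : ∀ M, 0 ≤ f M) (e : ℝ)
    (hs : ∀ t : ℂ, t ≠ 0 → f (t • (1 : Matrix a a ℂ)) = ‖t‖ ^ (e * Fintype.card a))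
    (g : Matrix a a ℂ) (hg : g.det ≠ 0) : f g = ‖g.det‖ ^ e := by
  have hperm : ∀ (σ : Equiv.Perm a) (v : a → ℂ),
      f (diagonal (v ∘ σ)) = f (diagonal v) := by
    intro σ v
    have h1 : σ.permMatrix ℂ * diagonal v * (σ⁻¹).permMatrix ℂ = diagonal (v ∘ σ) := by
      rw [← submatrix_diagonal_equiv, Equiv.Perm.permMatrix, Equiv.Perm.permMatrix,
        PEquiv.toMatrix_toPEquiv_mul, PEquiv.mul_toMatrix_toPEquiv]
      rfl
    have h2 : f (σ.permMatrix ℂ) * f ((σ⁻¹).permMatrix ℂ) = 1 := by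
      rw [← map_mul, ← Matrix.permMatrix_mul]
      simp
    rw [← h1, map_mul, map_mul, mul_right_comm, h2, one_mul]
  have hprod : ∀ v : a → ℂ, f (diagonal v) = ∏ i, f (diagonal (Pi.mulSingle i (v i))) := by
    intro v
    have := map_prod (f.comp (diagonalRingHom a ℂ : (a → ℂ) →* Matrix a a ℂ))
      (fun i => Pi.mulSingle i (v i)) Finset.univ
    rw [Finset.univ_prod_mulSingle] at this
    exact this
  have hsing : ∀ (i j : a) (t : ℂ),
      f (diagonal (Pi.mulSingle i t)) = f (diagonal (Pi.mulSingle j t)) := by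
    intro i j t
    rw [← hperm (Equiv.swap i j)]
    congr 2
    ext k
    simp only [Function.comp, Pi.mulSingle_apply]
    congr 1
    rw [Equiv.swap_apply_eq_iff, Equiv.swap_apply_left]
  have hone : ∀ (i : a) (t : ℂ), t ≠ 0 → f (diagonal (Pi.mulSingle i t)) = ‖t‖ ^ e := by
    intro i t ht
    have h1 := hprod (fun _ => t)
    rw [← smul_one_eq_diagonal, hs t ht,
      Finset.prod_congr rfl (fun j _ => hsing j i t), Finset.prod_const, Finset.card_univ,
      Real.rpow_mul (norm_nonneg _), Real.rpow_natCast] at h1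
    have hne : Fintype.card a ≠ 0 := (Fintype.card_pos_iff.2 ⟨i⟩).ne'
    exact ((pow_left_inj₀ (Real.rpow_nonneg (norm_nonneg _) _) (hf _) hne).1 h1).symm
  refine diagonal_transvection_induction_of_det_ne_zero (fun M => f M = ‖M.det‖ ^ e) g hg ?_ ?_ ?_
  · intro D hD
    rw [hprod, det_diagonal, norm_prod, ← Real.finsetProd_rpow _ _ fun i _ => norm_nonneg _]
    refine Finset.prod_congr rfl fun i _ => hone i _ ?_
    rw [det_diagonal] at hD
    exact Finset.prod_ne_zero_iff.1 hD i (Finset.mem_univ i)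
  · intro t
    rw [t.det, norm_one, Real.one_rpow]
    have h0 : f t.toMatrix ≠ 0 := by
      intro h0
      have := congrArg f t.mul_inv
      rw [map_mul, h0, zero_mul, map_one] at this
      exact zero_ne_one this
    obtain ⟨i, j, hij, c⟩ := t
    -- Conjugation by the diagonal matrix doubles `c`, so a transvection is conjugate to its own
    -- square. Its value under `f` is then a nonzero idempotent, that is, 1.
    have h1 : diagonal (Pi.mulSingle i (2 : ℂ)) * transvection i j c *
        diagonal (Pi.mulSingle i (2⁻¹ : ℂ)) = transvection i j c * transvection i j c := by
      rw [transvection_mul_transvection_same _ _ hij]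
      ext k l
      rw [mul_diagonal, diagonal_mul]
      simp only [transvection, Matrix.add_apply, Matrix.single_apply, Matrix.one_apply,
        Pi.mulSingle_apply]
      by_cases hk : k = i
      · subst hk
        by_cases hl : l = k
        · subst hl
          simp [hij.symm]
        · by_cases hjl : j = l <;> simp [hl, Ne.symm hl, hjl]
          ring
      · by_cases hl : l = i
        · simp [hk, Ne.symm hk, hl]
        · simp [hk, Ne.symm hk, hl]
    have h2 : f (diagonal (Pi.mulSingle i (2 : ℂ))) * f (diagonal (Pi.mulSingle i (2⁻¹ : ℂ))) =
        1 := by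
      rw [← map_mul, diagonal_mul_diagonal, ← map_one f]
      congr 1
      rw [← diagonal_one]
      congr 1
      ext k
      by_cases hk : k = i <;> simp [hk]
    have h3 := congrArg f h1
    rw [map_mul, map_mul, mul_right_comm, h2, one_mul, map_mul] at h3
    have h4 : f (transvection i j c) ≠ 0 := h0
    exact (mul_right_cancel₀ h4 (by rw [one_mul]; exact h3)).symm
  · intro A B _ _ hA hB
    rw [map_mul, hA, hB, det_mul, norm_mul, Real.mul_rpow (norm_nonneg _) (norm_nonneg _)]

end Character

end

end BosonSector

namespace BosonSector

noncomputable section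

set_option linter.unusedSectionVars false

open scoped Matrix.Norms.Frobenius
open Module

/-! ### Matrices as a Euclidean space -/

section MatrixSpace

variable {a b : Type*} [Fintype a] [Fintype b]

instance borelSpace_matrix : @BorelSpace (Matrix a b ℂ) instTopologicalSpaceMatrix _ :=
  inferInstanceAs (BorelSpace (a → b → ℂ))

instance borelSpace_matrix_frobenius : @BorelSpace (Matrix a b ℂ)
    (PseudoMetricSpace.toUniformSpace.toTopologicalSpace) _ :=
  inferInstanceAs (BorelSpace (a → b → ℂ))

instance secondCountable_matrix :
    @SecondCountableTopology (Matrix a b ℂ) instTopologicalSpaceMatrix :=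
  inferInstanceAs (SecondCountableTopology (a → b → ℂ))

/-- Complex matrices with the Frobenius norm are isometric to a Euclidean space. -/
def toMatrixIso : EuclideanSpace ℂ (a × b) ≃ₗᵢ[ℝ] Matrix a b ℂ where
  toFun := toMatrix
  invFun X := WithLp.toLp 2 fun i => X i.1 i.2
  left_inv _ := rfl
  right_inv _ := rfl
  map_add' _ _ := rfl
  map_smul' _ _ := rfl
  norm_map' v := by
    show ‖toMatrix v‖ = _
    rw [frobenius_norm_def, EuclideanSpace.norm_eq, Real.sqrt_eq_rpow, Fintype.sum_prod_type]
    simp [toMatrix]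

lemma traceVolume_eq (s d : ℕ) : (traceVolume s d : Measure (Matrix a b ℂ)) =
    ENNReal.ofReal ((s : ℝ) ^ (-(d : ℝ) / 2)) • μHE[d] := by
  have := ((toMatrixIso (a := a) (b := b)).toIsometryEquiv.measurePreserving_euclideanHausdorffMeasure
    d).map_eq
  rw [traceVolume, ← this]
  rfl

lemma norm_sq_eq_trace (X : Matrix a b ℂ) : ‖X‖ ^ 2 = (X * Xᴴ).trace.re := by
  rw [frobenius_norm_def, ← Real.sqrt_eq_rpow, Real.sq_sqrt (by positivity)]
  simp only [trace, diag, mul_apply, conjTranspose_apply, Complex.re_sum]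
  refine Finset.sum_congr rfl fun i _ => Finset.sum_congr rfl fun j _ => ?_
  rw [Complex.star_def, Complex.mul_conj, Complex.ofReal_re, Complex.normSq_eq_norm_sq,
    Real.rpow_two]

/-- The real inner product `Re Tr (X Yᴴ)` of the Frobenius norm. -/
scoped instance innerProductSpaceMatrix : InnerProductSpace ℝ (Matrix a b ℂ) where
  inner X Y := (X * Yᴴ).trace.re
  norm_sq_eq_re_inner X := norm_sq_eq_trace X
  conj_inner_symm X Y := by
    show (Y * Xᴴ).trace.re = (X * Yᴴ).trace.re
    rw [← Complex.conj_re, ← Complex.star_def, ← trace_conjTranspose]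
    simp
  add_left X Y Z := by
    show ((X + Y) * Zᴴ).trace.re = (X * Zᴴ).trace.re + (Y * Zᴴ).trace.re
    rw [Matrix.add_mul, trace_add, Complex.add_re]
  smul_left X Y r := by
    show ((r • X) * Yᴴ).trace.re = r * (X * Yᴴ).trace.re
    rw [Matrix.smul_mul, trace_smul, Complex.real_smul, Complex.re_ofReal_mul]

end MatrixSpace

/-! ### Real structures, intertwiners and their dimensions -/

section Structure

variable {a b c : Type*} [Fintype a] [Fintype b] [Fintype c] [DecidableEq a] [DecidableEq b]
  [DecidableEq c]

/-- `τ` is the matrix of an anti-unitary operator of square `m`; without condition on the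
square if `m = 0`. -/
structure IsRealStructure (m : ℤ) (τ : Matrix a a ℂ) : Prop where
  mul_star : τ * τᴴ = 1
  star_mul : τᴴ * τ = 1
  transpose : m ≠ 0 → τᵀ = m • τ

/-- The matrices that intertwine the real structures `τa` and `τb`; all matrices if `m = 0`. -/
def intertwiners (m : ℤ) (τa : Matrix a a ℂ) (τb : Matrix b b ℂ) :
    Submodule ℝ (Matrix a b ℂ) where
  carrier := {X | m ≠ 0 → X * τb = τa * Xᴴᵀ}
  add_mem' := by
    intro X Y hX hY hm
    simp [Matrix.add_mul, Matrix.mul_add, hX hm, hY hm]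
  zero_mem' := by simp
  smul_mem' := by
    intro r X hX hm
    simp [hX hm]

/-- The Hermitian matrices that commute with the real structure. -/
def hermPart (m : ℤ) (τ : Matrix a a ℂ) : Submodule ℝ (Matrix a a ℂ) where
  carrier := {X | X ∈ intertwiners m τ τ ∧ Xᴴ = X}
  add_mem' := by
    rintro X Y ⟨hX, hX'⟩ ⟨hY, hY'⟩
    exact ⟨add_mem hX hY, by rw [conjTranspose_add, hX', hY']⟩
  zero_mem' := ⟨zero_mem _, by simp⟩
  smul_mem' := by
    rintro r X ⟨hX, hX'⟩
    exact ⟨Submodule.smul_mem _ r hX, by simp [hX']⟩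

/-- The anti-Hermitian matrices that commute with the real structure. -/
def skewPart (m : ℤ) (τ : Matrix a a ℂ) : Submodule ℝ (Matrix a a ℂ) where
  carrier := {X | X ∈ intertwiners m τ τ ∧ Xᴴ = -X}
  add_mem' := by
    rintro X Y ⟨hX, hX'⟩ ⟨hY, hY'⟩
    exact ⟨add_mem hX hY, by rw [conjTranspose_add, hX', hY', neg_add]⟩
  zero_mem' := ⟨zero_mem _, by simp⟩
  smul_mem' := by
    rintro r X ⟨hX, hX'⟩
    exact ⟨Submodule.smul_mem _ r hX, by simp [hX']⟩

/-- The complex space whose Hermitian elements form `hermPart`. -/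
def symPart (m : ℤ) (τ : Matrix a a ℂ) : Submodule ℂ (Matrix a a ℂ) where
  carrier := {X | m ≠ 0 → X * τ = τ * Xᵀ}
  add_mem' := by
    intro X Y hX hY hm
    simp [Matrix.add_mul, Matrix.mul_add, hX hm, hY hm]
  zero_mem' := by simp
  smul_mem' := by
    intro r X hX hm
    simp [hX hm]

lemma conj_conj (X : Matrix a b ℂ) : Xᴴᵀᴴᵀ = X := by ext; simp

variable {m : ℤ} {τa : Matrix a a ℂ} {τb : Matrix b b ℂ} {τc : Matrix c c ℂ}

lemma IsRealStructure.conj_eq (ha : IsRealStructure m τa) (hm : m ≠ 0) : τaᴴᵀ = m • τaᴴ := by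
  have h := congrArg conjTranspose (ha.transpose hm)
  rw [conjTranspose_smul] at h
  rw [show τaᴴᵀ = τaᵀᴴ from rfl, h]
  simp

lemma intertwiners_mul {X : Matrix a b ℂ} {Y : Matrix b c ℂ} (hX : X ∈ intertwiners m τa τb)
    (hY : Y ∈ intertwiners m τb τc) : X * Y ∈ intertwiners m τa τc := by
  intro hm
  rw [Matrix.mul_assoc, hY hm, ← Matrix.mul_assoc, hX hm]
  simp [Matrix.mul_assoc]

lemma intertwiners_star (ha : IsRealStructure m τa) (hb : IsRealStructure m τb)
    {X : Matrix a b ℂ} (hX : X ∈ intertwiners m τa τb) : Xᴴ ∈ intertwiners m τb τa := by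
  intro hm
  have h := congrArg conjTranspose (hX hm)
  have h2 : Xᴴᵀᴴ = Xᵀ := by ext; simp
  rw [conjTranspose_mul, conjTranspose_mul, h2] at h
  calc Xᴴ * τa = τb * (τbᴴ * Xᴴ) * τa := by rw [← Matrix.mul_assoc, hb.mul_star, Matrix.one_mul]
    _ = τb * Xᴴᴴᵀ := by
      rw [h, Matrix.mul_assoc, Matrix.mul_assoc, ha.star_mul, Matrix.mul_one,
        conjTranspose_conjTranspose]

lemma one_mem_intertwiners : (1 : Matrix a a ℂ) ∈ intertwiners m τa τa := by
  intro _; simp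

lemma intertwiners_inv {g : Matrix a a ℂ} (hg : g ∈ intertwiners m τa τa) (hd : g.det ≠ 0) :
    g⁻¹ ∈ intertwiners m τa τa := by
  intro hm
  have hu : IsUnit g.det := hd.isUnit
  have hu' : IsUnit gᴴᵀ.det := by
    rw [det_transpose, det_conjTranspose]; exact hu.star
  rw [conjTranspose_nonsing_inv, transpose_nonsing_inv]
  calc g⁻¹ * τa = g⁻¹ * (τa * gᴴᵀ) * (gᴴᵀ)⁻¹ := by
        rw [Matrix.mul_assoc, Matrix.mul_assoc, mul_nonsing_inv _ hu', Matrix.mul_one]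
    _ = τa * (gᴴᵀ)⁻¹ := by
        rw [← hg hm, ← Matrix.mul_assoc, nonsing_inv_mul _ hu, Matrix.one_mul]

lemma mul_star_mem_hermPart (ha : IsRealStructure m τa) (hb : IsRealStructure m τb)
    {X : Matrix a b ℂ} (hX : X ∈ intertwiners m τa τb) : X * Xᴴ ∈ hermPart m τa :=
  ⟨intertwiners_mul hX (intertwiners_star ha hb hX), by simp⟩

lemma conj_mem_hermPart (ha : IsRealStructure m τa) {g x : Matrix a a ℂ}
    (hg : g ∈ intertwiners m τa τa) (hx : x ∈ hermPart m τa) : g * x * gᴴ ∈ hermPart m τa :=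
  ⟨intertwiners_mul (intertwiners_mul hg hx.1) (intertwiners_star ha ha hg), by
    simp [hx.2, Matrix.mul_assoc]⟩

lemma intertwiners_zero : intertwiners 0 τa τb = ⊤ := by
  ext X; simp [intertwiners]

/-- The intertwiners are the fixed points of the anti-linear map `w ↦ τa conj(w) τbᴴ`, an involution
because `m² = 1`. -/
lemma isRealForm_intertwiners (ha : IsRealStructure m τa) (hb : IsRealStructure m τb)
    (hm : m = 1 ∨ m = -1) : IsRealForm (intertwiners m τa τb) ⊤ := by
  have hm0 : m ≠ 0 := by rcases hm with h | h <;> simp [h]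
  have hmm : m * m = 1 := by rcases hm with h | h <;> simp [h]
  refine ⟨fun _ _ => Submodule.mem_top, ?_, ?_⟩
  · intro x hx y hy hxy
    have h1 : x = -(Complex.I • y) := eq_neg_of_add_eq_zero_left hxy
    have h2 := hx hm0
    have h3 := hy hm0
    rw [h1] at h2
    have h4 : (2 * Complex.I) • (y * τb) = 0 := by
      simp only [Matrix.neg_mul, Matrix.smul_mul, conjTranspose_neg, conjTranspose_smul,
        transpose_neg, transpose_smul, Matrix.mul_neg, Matrix.mul_smul, ← h3] at h2
      simp only [Complex.star_def, Complex.conj_I, neg_smul, neg_neg] at h2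
      rw [mul_smul, two_smul]
      nth_rewrite 1 [← h2]
      simp
    have h5 : y * τb = 0 := (smul_eq_zero.1 h4).resolve_left (by simp)
    have h6 : y = 0 := by
      have := congrArg (· * τbᴴ) h5
      simpa [Matrix.mul_assoc, hb.mul_star] using this
    exact ⟨by rw [h1, h6]; simp, h6⟩
  · intro w _
    -- A sum of an element and its image under the involution is fixed; `z = 1/2` and `z = -i/2`
    -- give the real and the imaginary part of `w`.
    have key : ∀ (z : ℂ), (z • w + star z • (τa * wᴴᵀ * τbᴴ)) ∈ intertwiners m τa τb := by
      intro z _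
      have e1 : (τa * wᴴᵀ * τbᴴ)ᴴᵀ = τaᴴᵀ * w * τbᵀ := by
        rw [conjTranspose_mul, conjTranspose_mul, transpose_mul, transpose_mul, conj_conj,
          conjTranspose_conjTranspose]
      have e2 : τa * (τaᴴᵀ * w * τbᵀ) = w * τb := by
        rw [ha.conj_eq hm0, hb.transpose hm0, Matrix.mul_smul, Matrix.smul_mul, Matrix.smul_mul,
          Matrix.mul_smul, Matrix.mul_smul, smul_smul, hmm, one_smul, ← Matrix.mul_assoc,
          ← Matrix.mul_assoc, ha.mul_star, Matrix.one_mul]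
      rw [conjTranspose_add, transpose_add, conjTranspose_smul, transpose_smul,
        conjTranspose_smul, transpose_smul, e1, Matrix.mul_add, Matrix.mul_smul, Matrix.mul_smul,
        e2, star_star, Matrix.add_mul, Matrix.smul_mul, Matrix.smul_mul, Matrix.mul_assoc _ τbᴴ,
        hb.star_mul, Matrix.mul_one, add_comm]
    refine ⟨_, key (1 / 2), _, key (-Complex.I / 2), ?_⟩
    have : (1 / 2 + Complex.I * (-Complex.I / 2) : ℂ) = 1 := by
      linear_combination (-1 / 2 : ℂ) * Complex.I_mul_I
    have h2 : (star (1 / 2 : ℂ) + Complex.I * star (-Complex.I / 2) : ℂ) = 0 := by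
      simp only [Complex.star_def, map_div₀, map_neg, Complex.conj_I, map_one, map_ofNat]
      linear_combination (1 / 2 : ℂ) * Complex.I_mul_I
    rw [smul_add, smul_smul, smul_smul, add_add_add_comm, ← add_smul, ← add_smul, this, h2]
    simp

/-- Here the anti-linear involution is `w ↦ wᴴ`, which preserves `symPart`; on Hermitian matrices
transposition is complex conjugation, so the two conditions on `x` coincide. -/
lemma isRealForm_hermPart (ha : IsRealStructure m τa) :
    IsRealForm (hermPart m τa) (symPart m τa) := by
  have hle : ∀ x ∈ symPart m τa, xᴴ = x → x ∈ hermPart m τa := by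
    intro x hx hx'
    refine ⟨fun hm => ?_, hx'⟩
    rw [hx', hx hm]
  have hstar : ∀ x ∈ symPart m τa, xᴴ ∈ symPart m τa := by
    intro x hx hm
    have h := congrArg conjTranspose (hx hm)
    have h2 : xᵀᴴ = xᴴᵀ := by ext; simp
    rw [conjTranspose_mul, conjTranspose_mul, h2] at h
    calc xᴴ * τa = τa * (τaᴴ * xᴴ) * τa := by
          rw [← Matrix.mul_assoc, ha.mul_star, Matrix.one_mul]
      _ = τa * xᴴᵀ := by
        rw [h, Matrix.mul_assoc, Matrix.mul_assoc, ha.star_mul, Matrix.mul_one]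
  refine ⟨fun x hx hm => ?_, ?_, ?_⟩
  · have := hx.1 hm
    rwa [hx.2] at this
  · intro x hx y hy hxy
    have h1 : x = -(Complex.I • y) := eq_neg_of_add_eq_zero_left hxy
    have h2 := hx.2
    rw [h1, conjTranspose_neg, conjTranspose_smul, hy.2, Complex.star_def, Complex.conj_I,
      neg_smul, neg_neg] at h2
    have h4 : (2 * Complex.I) • y = 0 := by
      rw [mul_smul, two_smul]
      nth_rewrite 1 [h2]
      simp
    have h6 : y = 0 := (smul_eq_zero.1 h4).resolve_left (by simp)
    exact ⟨by rw [h1, h6]; simp, h6⟩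
  · intro w hw
    refine ⟨(1 / 2 : ℂ) • (w + wᴴ), hle _ ?_ ?_,
      (-Complex.I / 2) • (w - wᴴ), hle _ ?_ ?_, ?_⟩
    · exact Submodule.smul_mem _ _ (add_mem hw (hstar w hw))
    · rw [conjTranspose_smul, conjTranspose_add, conjTranspose_conjTranspose, add_comm wᴴ]
      simp
    · exact Submodule.smul_mem _ _ (sub_mem hw (hstar w hw))
    · rw [conjTranspose_smul, conjTranspose_sub, conjTranspose_conjTranspose, ← neg_sub w,
        smul_neg, ← neg_smul]
      simp [neg_div]
    · rw [smul_smul, smul_add, smul_sub]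
      have : Complex.I * (-Complex.I / 2) = (1 / 2 : ℂ) := by
        linear_combination (-1 / 2 : ℂ) * Complex.I_mul_I
      rw [this, add_add_sub_cancel, ← add_smul]
      norm_num

/-- The factor `1 + |m|` as a real number. -/
def scale (m : ℤ) : ℝ := 1 + |(m : ℝ)|

lemma scale_zero : scale 0 = 1 := by simp [scale]

lemma scale_of_ne (hm : m = 1 ∨ m = -1) : scale m = 2 := by
  rcases hm with rfl | rfl <;> norm_num [scale]

lemma scale_pos (m : ℤ) : 0 < scale m := by unfold scale; positivity

/-- `M ↦ τ Mᵀ τᴴ`. -/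
def twistTranspose (τ : Matrix a a ℂ) : Matrix a a ℂ →ₗ[ℂ] Matrix a a ℂ where
  toFun M := τ * Mᵀ * τᴴ
  map_add' X Y := by simp [Matrix.mul_add, Matrix.add_mul]
  map_smul' r X := by simp

/-- The diagonal coefficient at the matrix unit `E_ij` is `τ_ij conj(τ_ji) = m |τ_ij|²`, and these
add up to `m Tr(τ τᴴ)`. -/
lemma trace_twistTranspose (ha : IsRealStructure m τa) (hm : m ≠ 0) :
    LinearMap.trace ℂ _ (twistTranspose τa) = m * Fintype.card a := by
  rw [LinearMap.trace_eq_matrix_trace ℂ (Matrix.stdBasis ℂ a a), Matrix.trace]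
  have h1 : ∀ x : a × a, (LinearMap.toMatrix (Matrix.stdBasis ℂ a a) (Matrix.stdBasis ℂ a a)
      (twistTranspose τa)).diag x = m * (τa x.1 x.2 * star (τa x.1 x.2)) := by
    rintro ⟨i, j⟩
    have h2 : τa j i = m * τa i j := by
      have := congrFun (congrFun (ha.transpose hm) i) j
      simpa using this
    rw [Matrix.diag_apply, LinearMap.toMatrix_apply, Matrix.stdBasis_eq_single]
    show (τa * (Matrix.single i j (1 : ℂ))ᵀ * τaᴴ : Matrix a a ℂ) i j = _
    rw [Matrix.transpose_single, Matrix.mul_apply]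
    rw [Finset.sum_eq_single i]
    · simp [h2]
      ring
    · intro k _ hk
      simp [hk]
    · simp
  rw [Finset.sum_congr rfl fun x _ => h1 x, ← Finset.mul_sum, Fintype.sum_prod_type]
  congr 1
  have h3 := congrArg Matrix.trace ha.mul_star
  rw [Matrix.trace_one] at h3
  rw [← h3]
  simp [Matrix.trace, Matrix.mul_apply]

/-- For `m ≠ 0` half the sum of the identity and `twistTranspose` projects onto `symPart`; its trace
is the dimension. -/
lemma finrank_symPart (ha : IsRealStructure m τa) (hm : m = 0 ∨ m = 1 ∨ m = -1) :
    scale m * (finrank ℂ (symPart m τa) : ℝ) = Fintype.card a * (Fintype.card a + m) := by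
  rcases hm with rfl | hm
  · have : symPart 0 τa = ⊤ := by ext; simp [symPart]
    rw [this, finrank_top, finrank_matrix, scale_zero]
    simp
  · have hm0 : m ≠ 0 := by rcases hm with h | h <;> simp [h]
    have hmm : m * m = 1 := by rcases hm with h | h <;> simp [h]
    have hP : LinearMap.IsProj (symPart m τa)
        ((1 / 2 : ℂ) • (LinearMap.id + twistTranspose τa)) := by
      refine ⟨fun x => Submodule.smul_mem _ _ ?_, fun x hx => ?_⟩
      · intro _
        show (x + τa * xᵀ * τaᴴ) * τa = τa * (x + τa * xᵀ * τaᴴ)ᵀ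
        rw [transpose_add, transpose_mul, transpose_mul, transpose_transpose, ha.conj_eq hm0,
          ha.transpose hm0, Matrix.add_mul, Matrix.mul_add, Matrix.mul_assoc _ τaᴴ, ha.star_mul,
          Matrix.mul_one, Matrix.smul_mul, Matrix.mul_smul, Matrix.mul_smul, Matrix.mul_smul,
          Matrix.mul_smul, smul_smul, hmm, one_smul, ← Matrix.mul_assoc, ha.mul_star, Matrix.one_mul, add_comm]
      · show (1 / 2 : ℂ) • (x + τa * xᵀ * τaᴴ) = x
        rw [← hx hm0, Matrix.mul_assoc, ha.mul_star, Matrix.mul_one, ← two_smul ℂ x, smul_smul]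
        norm_num
    have h := hP.trace
    rw [map_smul, map_add, trace_twistTranspose ha hm0, LinearMap.trace_id, finrank_matrix] at h
    rw [scale_of_ne hm]
    have h2 : (2 : ℂ) * (finrank ℂ (symPart m τa) : ℂ) =
        Fintype.card a * (Fintype.card a + m) := by
      rw [← h]
      simp
      ring
    exact_mod_cast h2

lemma finrank_hermPart (ha : IsRealStructure m τa) (hm : m = 0 ∨ m = 1 ∨ m = -1) :
    scale m * (finrank ℝ (hermPart m τa) : ℝ) = Fintype.card a * (Fintype.card a + m) := by
  rw [(isRealForm_hermPart ha).finrank_eq, finrank_symPart ha hm]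

lemma finrank_intertwiners (ha : IsRealStructure m τa) (hb : IsRealStructure m τb)
    (hm : m = 0 ∨ m = 1 ∨ m = -1) :
    scale m * (finrank ℝ (intertwiners m τa τb) : ℝ) = 2 * Fintype.card a * Fintype.card b := by
  rcases hm with rfl | hm
  · rw [intertwiners_zero, finrank_top, finrank_real_of_complex, finrank_matrix, scale_zero]
    simp [mul_assoc]
  · rw [(isRealForm_intertwiners ha hb hm).finrank_eq, finrank_top, finrank_matrix,
      scale_of_ne hm]
    simp [mul_assoc]

lemma sup_hermPart_skewPart (ha : IsRealStructure m τa) :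
    hermPart m τa ⊔ skewPart m τa = intertwiners m τa τa := by
  apply le_antisymm
  · exact sup_le (fun x hx => hx.1) (fun x hx => hx.1)
  · intro x hx
    have hx' := intertwiners_star ha ha hx
    rw [Submodule.mem_sup]
    refine ⟨(1 / 2 : ℝ) • (x + xᴴ), ⟨Submodule.smul_mem _ _ (add_mem hx hx'), ?_⟩,
      (1 / 2 : ℝ) • (x - xᴴ), ⟨Submodule.smul_mem _ _ (sub_mem hx hx'), ?_⟩, ?_⟩
    · simp [add_comm]
    · simp [← smul_neg]
    · rw [← smul_add, add_add_sub_cancel, ← two_smul ℝ, smul_smul]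
      norm_num

lemma finrank_herm_add_skew (ha : IsRealStructure m τa) :
    finrank ℝ (hermPart m τa) + finrank ℝ (skewPart m τa) =
      finrank ℝ (intertwiners m τa τa) := by
  have h := Submodule.finrank_sup_add_finrank_inf_eq (hermPart m τa) (skewPart m τa)
  have h2 : hermPart m τa ⊓ skewPart m τa = ⊥ := by
    rw [eq_bot_iff]
    rintro x ⟨⟨_, h1⟩, ⟨_, h2⟩⟩
    rw [h1] at h2
    have h3 : (2 : ℝ) • x = 0 := by
      rw [two_smul]; nth_rewrite 1 [h2]; simp
    simpa using h3
  rw [h2, finrank_bot, add_zero, sup_hermPart_skewPart ha] at h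
  exact h.symm

lemma finrank_skewPart (ha : IsRealStructure m τa) (hm : m = 0 ∨ m = 1 ∨ m = -1) :
    scale m * (finrank ℝ (skewPart m τa) : ℝ) = Fintype.card a * (Fintype.card a - m) := by
  have h1 := finrank_hermPart ha hm
  have h2 := finrank_intertwiners ha ha hm
  have h3 : (finrank ℝ (hermPart m τa) : ℝ) + finrank ℝ (skewPart m τa) =
      finrank ℝ (intertwiners m τa τa) := by exact_mod_cast finrank_herm_add_skew ha
  rw [← h3] at h2
  linear_combination h2 - h1

end Structure

end

end BosonSector

namespace BosonSector

noncomputable section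

set_option linter.unusedSectionVars false

open scoped Matrix.Norms.Frobenius
open Module

/-! ### Jacobians of the group actions -/

section Jacobian

variable {a b c : Type*} [Fintype a] [Fintype b] [Fintype c] [DecidableEq a] [DecidableEq b]
  [DecidableEq c] {m : ℤ} {τa : Matrix a a ℂ} {τb : Matrix b b ℂ} {τc : Matrix c c ℂ}

/-- Left multiplication as a complex linear map. -/
def mulLeftLin (g : Matrix a a ℂ) : Matrix a b ℂ →ₗ[ℂ] Matrix a b ℂ where
  toFun X := g * X
  map_add' := Matrix.mul_add g
  map_smul' r := Matrix.mul_smul g r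

lemma norm_det_mulLeftLin (g : Matrix a a ℂ) (hg : g.det ≠ 0) :
    ‖LinearMap.det (mulLeftLin (b := b) g)‖ = ‖g.det‖ ^ (Fintype.card b : ℝ) := by
  let f : Matrix a a ℂ →* ℝ :=
    { toFun := fun g => ‖LinearMap.det (mulLeftLin (b := b) g)‖
      map_one' := by
        have : mulLeftLin (b := b) (1 : Matrix a a ℂ) = LinearMap.id := by
          ext1 X; exact Matrix.one_mul X
        rw [this, LinearMap.det_id, norm_one]
      map_mul' := fun g h => by
        have : mulLeftLin (b := b) (g * h) = mulLeftLin g ∘ₗ mulLeftLin h := by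
          ext1 X; exact Matrix.mul_assoc g h X
        rw [this, LinearMap.det_comp, norm_mul] }
  refine character_eq_of_scalar f (fun g => norm_nonneg (LinearMap.det (mulLeftLin (b := b) g))) _ (fun t ht => ?_) g hg
  have : mulLeftLin (b := b) (t • (1 : Matrix a a ℂ)) = t • LinearMap.id := by
    ext1 X
    show (t • (1 : Matrix a a ℂ)) * X = t • X
    rw [Matrix.smul_mul, Matrix.one_mul]
  show ‖LinearMap.det (mulLeftLin (b := b) (t • (1 : Matrix a a ℂ)))‖ = _
  rw [this, LinearMap.det_smul, LinearMap.det_id, finrank_matrix, mul_one, norm_pow,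
    ← Real.rpow_natCast]
  simp [mul_comm]

lemma norm_det_restrictScalars {E : Type*} [AddCommGroup E] [Module ℂ E] [Module ℝ E]
    [IsScalarTower ℝ ℂ E] (T : E →ₗ[ℂ] E) :
    ‖LinearMap.det (T.restrictScalars ℝ)‖ = ‖LinearMap.det T‖ ^ 2 := by
  rw [LinearMap.det_restrictScalars, Algebra.norm_complex_eq]
  simp [Complex.normSq_eq_norm_sq]

/-- For `m = 0` the real determinant of a complex-linear map is the squared modulus of the complex
one, giving the exponent `2 card b`. For `m ≠ 0` the space is a real form of all matrices, the real
and complex determinants agree, and the exponent is `card b`. Both equal `2 card b / scale m`. -/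
lemma map_mul_left_subVol (ha : IsRealStructure m τa) (hb : IsRealStructure m τb)
    (hm : m = 0 ∨ m = 1 ∨ m = -1) {g : Matrix a a ℂ} (hg : g ∈ intertwiners m τa τa)
    (hd : g.det ≠ 0) :
    (subVol (intertwiners m τa τb)).map (fun X => g * X) =
      ENNReal.ofReal (‖g.det‖ ^ (-(2 * Fintype.card b / scale m : ℝ))) •
        subVol (intertwiners m τa τb) := by
  let T : Matrix a b ℂ →ₗ[ℝ] Matrix a b ℂ := (mulLeftLin g).restrictScalars ℝ
  have hT : ∀ X ∈ intertwiners m τa τb, T X ∈ intertwiners m τa τb := fun X hX =>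
    intertwiners_mul hg hX
  have key : ‖LinearMap.det (T.restrict hT)‖ = ‖g.det‖ ^ (2 * Fintype.card b / scale m : ℝ) := by
    rcases hm with rfl | hm
    · have h1 : LinearMap.det (T.restrict hT) = LinearMap.det T := by
        let e : intertwiners 0 τa τb ≃ₗ[ℝ] Matrix a b ℂ :=
          (LinearEquiv.ofEq _ _ intertwiners_zero).trans Submodule.topEquiv
        rw [← LinearMap.det_conj (T.restrict hT) e]
        congr 1
      rw [h1, norm_det_restrictScalars, norm_det_mulLeftLin g hd, ← Real.rpow_natCast,
        ← Real.rpow_mul (norm_nonneg _), scale_zero]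
      congr 1
      push_cast
      ring
    · have h1 := (isRealForm_intertwiners ha hb hm).det_eq (mulLeftLin g)
        (fun _ _ => Submodule.mem_top) (T.restrict hT) (fun _ => rfl)
      have h2 : LinearMap.det ((mulLeftLin g).restrict
          (fun (x : Matrix a b ℂ) (_ : x ∈ (⊤ : Submodule ℂ (Matrix a b ℂ))) =>
            (Submodule.mem_top : mulLeftLin g x ∈ ⊤))) = LinearMap.det (mulLeftLin (b := b) g) := by
        rw [← LinearMap.det_conj _ Submodule.topEquiv]
        congr 1
      rw [h2] at h1
      have h3 := congrArg norm h1
      rw [norm_det_mulLeftLin g hd, Complex.norm_real] at h3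
      rw [← h3, scale_of_ne hm]
      congr 1
      ring
  have hpos : 0 < ‖g.det‖ := norm_pos_iff.2 hd
  have hne : LinearMap.det (T.restrict hT) ≠ 0 := by
    rw [← norm_ne_zero_iff, key]
    positivity
  have := map_linear_subVol _ T hT hne
  rw [abs_inv, ← Real.norm_eq_abs, key, ← Real.rpow_neg hpos.le] at this
  exact this

/-- Conjugate transposition preserves the volume. -/
lemma map_star_subVol (ha : IsRealStructure m τa) (hb : IsRealStructure m τb) :
    (subVol (intertwiners m τa τb)).map (fun X => Xᴴ) = subVol (intertwiners m τb τa) := by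
  let T : Matrix a b ℂ →ₗ[ℝ] Matrix b a ℂ :=
    { toFun := fun X => Xᴴ
      map_add' := fun X Y => conjTranspose_add X Y
      map_smul' := fun r X => by simp }
  have h := map_isometry_subVol (intertwiners m τa τb) T
    (fun X _ => frobenius_norm_conjTranspose X)
  have h2 : (intertwiners m τa τb).map T = intertwiners m τb τa := by
    ext Y
    constructor
    · rintro ⟨X, hX, rfl⟩
      exact intertwiners_star ha hb hX
    · intro hY
      exact ⟨Yᴴ, intertwiners_star hb ha hY, conjTranspose_conjTranspose Y⟩
  rw [h2] at h
  exact h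

lemma map_mul_right_subVol (ha : IsRealStructure m τa) (hb : IsRealStructure m τb)
    (hm : m = 0 ∨ m = 1 ∨ m = -1) {g : Matrix b b ℂ} (hg : g ∈ intertwiners m τb τb)
    (hd : g.det ≠ 0) :
    (subVol (intertwiners m τa τb)).map (fun X => X * g) =
      ENNReal.ofReal (‖g.det‖ ^ (-(2 * Fintype.card a / scale m : ℝ))) •
        subVol (intertwiners m τa τb) := by
  have hd' : gᴴ.det ≠ 0 := by rw [det_conjTranspose]; simpa using hd
  have h := map_mul_left_subVol hb ha hm (intertwiners_star hb hb hg) hd'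
  rw [← map_star_subVol ha hb] at h
  have h2 := congrArg (Measure.map (fun X => Xᴴ)) h
  have c1 : Continuous fun X : Matrix a b ℂ => Xᴴ := continuous_id.matrix_conjTranspose
  have c2 : Continuous fun X : Matrix b a ℂ => Xᴴ := continuous_id.matrix_conjTranspose
  have c3 : Continuous fun X : Matrix b a ℂ => gᴴ * X := continuous_const.matrix_mul continuous_id
  rw [Measure.map_map c3.measurable c1.measurable, Measure.map_map c2.measurable
    (c3.comp c1).measurable, Measure.map_smul, Measure.map_map c2.measurable c1.measurable] at h2
  have e1 : (fun X : Matrix b a ℂ => Xᴴ) ∘ (fun X => gᴴ * X) ∘ (fun X : Matrix a b ℂ => Xᴴ) =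
      fun X => X * g := by ext1 X; simp
  have e2 : (fun X : Matrix b a ℂ => Xᴴ) ∘ (fun X : Matrix a b ℂ => Xᴴ) = id := by ext1 X; simp
  rw [e1, e2, Measure.map_id, det_conjTranspose, norm_star] at h2
  exact h2

/-- The complex-linear extension of `x ↦ g x gᴴ` from `hermPart` to `symPart`. -/
def symAction (m : ℤ) (τ g : Matrix a a ℂ) : Matrix a a ℂ →ₗ[ℂ] Matrix a a ℂ where
  toFun x := g * x * (if m = 0 then gᴴ else τ * gᵀ * τᴴ)
  map_add' x y := by rw [Matrix.mul_add, Matrix.add_mul]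
  map_smul' r x := by simp

lemma symAction_mem (ha : IsRealStructure m τa) (hm : m = 0 ∨ m = 1 ∨ m = -1)
    (g : Matrix a a ℂ) : ∀ x ∈ symPart m τa, symAction m τa g x ∈ symPart m τa := by
  intro x hx hm0
  have hmm : m * m = 1 := by
    rcases hm with h | h | h
    · exact absurd h hm0
    all_goals simp [h]
  have h1 : symAction m τa g x = g * x * (τa * gᵀ * τaᴴ) := by
    show g * x * (if m = 0 then gᴴ else τa * gᵀ * τaᴴ) = _
    rw [if_neg hm0]
  rw [h1]
  calc g * x * (τa * gᵀ * τaᴴ) * τa = g * (x * τa) * gᵀ * (τaᴴ * τa) := by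
        simp only [Matrix.mul_assoc]
    _ = g * (τa * xᵀ) * gᵀ := by rw [ha.star_mul, Matrix.mul_one, hx hm0]
    _ = (τa * τaᴴ) * (g * (τa * xᵀ) * gᵀ) := by rw [ha.mul_star, Matrix.one_mul]
    _ = τa * (g * x * (τa * gᵀ * τaᴴ))ᵀ := by
        simp only [transpose_mul, transpose_transpose, ha.conj_eq hm0, ha.transpose hm0,
          Matrix.mul_assoc, Matrix.smul_mul, Matrix.mul_smul, smul_smul, hmm, one_smul]

/-- The formula defining `symAction` is multiplicative in every complex `g`, also in those that do
not commute with the real structure, so the character lemma applies. A scalar `t` acts by a number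
of modulus `|t|²` on a space of dimension `card a (card a + m) / scale m`. -/
lemma norm_det_symAction (ha : IsRealStructure m τa) (hm : m = 0 ∨ m = 1 ∨ m = -1)
    (g : Matrix a a ℂ) (hg : g.det ≠ 0) :
    ‖LinearMap.det ((symAction m τa g).restrict (symAction_mem ha hm g))‖ =
      ‖g.det‖ ^ (2 * (Fintype.card a + m) / scale m : ℝ) := by
  have hscal : ∀ t : ℂ, symAction m τa (t • 1) = (t * (if m = 0 then star t else t)) •
      LinearMap.id := by
    intro t
    ext1 x
    show (t • (1 : Matrix a a ℂ)) * x * (if m = 0 then (t • (1 : Matrix a a ℂ))ᴴ else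
      τa * (t • (1 : Matrix a a ℂ))ᵀ * τaᴴ) = (t * (if m = 0 then star t else t)) • x
    split_ifs
    · simp [smul_smul, mul_comm]
    · simp [smul_smul, ha.mul_star]
  let f : Matrix a a ℂ →* ℝ :=
    { toFun := fun g => ‖LinearMap.det ((symAction m τa g).restrict (symAction_mem ha hm g))‖
      map_one' := by
        have : (symAction m τa 1).restrict (symAction_mem ha hm 1) = LinearMap.id := by
          ext1 X
          apply Subtype.ext
          have := congrArg (fun T => T (X : Matrix a a ℂ)) (hscal 1)
          simpa using this
        rw [this, LinearMap.det_id, norm_one]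
      map_mul' := fun g h => by
        have : (symAction m τa (g * h)).restrict (symAction_mem ha hm (g * h)) =
            (symAction m τa g).restrict (symAction_mem ha hm g) ∘ₗ
            (symAction m τa h).restrict (symAction_mem ha hm h) := by
          ext1 X
          apply Subtype.ext
          show g * h * (X : Matrix a a ℂ) * (if m = 0 then (g * h)ᴴ else τa * (g * h)ᵀ * τaᴴ) =
            g * (h * (X : Matrix a a ℂ) * (if m = 0 then hᴴ else τa * hᵀ * τaᴴ)) *
              (if m = 0 then gᴴ else τa * gᵀ * τaᴴ)
          split_ifs
          · simp [Matrix.mul_assoc]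
          · rw [transpose_mul]
            have : τa * (hᵀ * gᵀ) * τaᴴ = τa * hᵀ * (τaᴴ * τa) * gᵀ * τaᴴ := by
              rw [ha.star_mul, Matrix.mul_one, Matrix.mul_assoc τa hᵀ]
            rw [this]
            simp only [Matrix.mul_assoc]
        rw [this, LinearMap.det_comp, norm_mul] }
  refine character_eq_of_scalar f (fun g => norm_nonneg (LinearMap.det
    ((symAction m τa g).restrict (symAction_mem ha hm g)))) _ (fun t ht => ?_) g hg
  have h1 : (symAction m τa (t • 1)).restrict (symAction_mem ha hm (t • 1)) =
      (t * (if m = 0 then star t else t)) • LinearMap.id := by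
    ext1 X
    apply Subtype.ext
    exact congrArg (fun T => T (X : Matrix a a ℂ)) (hscal t)
  show ‖LinearMap.det ((symAction m τa (t • 1)).restrict (symAction_mem ha hm (t • 1)))‖ = _
  have h2 : ‖t * (if m = 0 then star t else t)‖ = ‖t‖ ^ (2 : ℝ) := by
    rw [norm_mul, Real.rpow_two, sq]
    split_ifs <;> simp
  rw [h1, LinearMap.det_smul, LinearMap.det_id, mul_one, norm_pow, h2, ← Real.rpow_natCast,
    ← Real.rpow_mul (norm_nonneg _)]
  congr 1
  have h3 := finrank_symPart ha hm
  have h4 := scale_pos m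
  field_simp
  rw [mul_comm] at h3
  linear_combination h3

lemma map_conj_subVol (ha : IsRealStructure m τa) (hm : m = 0 ∨ m = 1 ∨ m = -1)
    {g : Matrix a a ℂ} (hg : g ∈ intertwiners m τa τa) (hd : g.det ≠ 0) :
    (subVol (hermPart m τa)).map (fun x => g * x * gᴴ) =
      ENNReal.ofReal (‖g.det‖ ^ (-(2 * (Fintype.card a + m) / scale m : ℝ))) •
        subVol (hermPart m τa) := by
  let T : Matrix a a ℂ →ₗ[ℝ] Matrix a a ℂ :=
    { toFun := fun x => g * x * gᴴ
      map_add' := fun x y => by rw [Matrix.mul_add, Matrix.add_mul]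
      map_smul' := fun r x => by simp }
  have hT : ∀ x ∈ hermPart m τa, T x ∈ hermPart m τa := fun x hx => conj_mem_hermPart ha hg hx
  -- For an intertwiner `g` with `m ≠ 0` one has `gᴴ = τ gᵀ τᴴ`, so `symAction` does extend `x ↦ g x
  -- gᴴ`.
  have h1 := (isRealForm_hermPart ha).det_eq (symAction m τa g) (symAction_mem ha hm g)
    (T.restrict hT) (fun x => by
      show g * (x : Matrix a a ℂ) * gᴴ = g * (x : Matrix a a ℂ) *
        (if m = 0 then gᴴ else τa * gᵀ * τaᴴ)
      split_ifs with h0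
      · rfl
      · have h2 := intertwiners_star ha ha hg h0
        rw [conjTranspose_conjTranspose] at h2
        rw [← h2, Matrix.mul_assoc gᴴ, ha.mul_star, Matrix.mul_one])
  have key := congrArg norm h1
  rw [norm_det_symAction ha hm g hd, Complex.norm_real] at key
  have hpos : 0 < ‖g.det‖ := norm_pos_iff.2 hd
  have hne : LinearMap.det (T.restrict hT) ≠ 0 := by
    rw [← norm_ne_zero_iff, ← key]
    positivity
  have := map_linear_subVol _ T hT hne
  rw [abs_inv, ← Real.norm_eq_abs, ← key, ← Real.rpow_neg hpos.le] at this
  exact this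

end Jacobian

end

end BosonSector

namespace BosonSector

noncomputable section

set_option linter.unusedSectionVars false

/-! ### Square roots and equivalence of real structures -/

section SquareRoot

open scoped MatrixOrder

variable {a b c : Type*} [Fintype a] [Fintype b] [Fintype c] [DecidableEq a] [DecidableEq b]
  [DecidableEq c] {m : ℤ} {τa : Matrix a a ℂ} {τb : Matrix b b ℂ} {τc : Matrix c c ℂ}

lemma exists_posDef_sqrt {x : Matrix a a ℂ} (hx : x.PosDef) :
    ∃ h : Matrix a a ℂ, h.PosDef ∧ h * h = x ∧ ∀ k : Matrix a a ℂ, k.PosSemidef → k * k = x →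
      k = h := by
  have hnn : 0 ≤ x := hx.posSemidef.nonneg
  have h1 : CFC.sqrt x * CFC.sqrt x = x := CFC.sqrt_mul_sqrt_self x
  have h2 : (CFC.sqrt x).PosSemidef := (CFC.sqrt_nonneg x).posSemidef
  refine ⟨CFC.sqrt x, ?_, h1, fun k hk hkx => ?_⟩
  · rw [h2.posDef_iff_isUnit]
    refine isUnit_of_mul_isUnit_left (y := CFC.sqrt x) ?_
    rw [h1]
    exact hx.isUnit
  · exact (CFC.sqrt_unique hkx hk.nonneg).symm

/-- If `h` is the positive square root of `x`, then `τ conj(h) τᴴ` is another one, so by uniqueness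
`h` commutes with the real structure. This is the transitivity of the group on the cone. -/
lemma exists_sqrt_mem (ha : IsRealStructure m τa) {x : Matrix a a ℂ} (hx : x.PosDef)
    (hxm : x ∈ hermPart m τa) :
    ∃ h ∈ hermPart m τa, h.PosDef ∧ h * hᴴ = x := by
  obtain ⟨h, hp, hh, hu⟩ := exists_posDef_sqrt hx
  refine ⟨h, ⟨fun hm => ?_, hp.isHermitian⟩, hp, by rw [hp.isHermitian, hh]⟩
  have h1 : (τa * hᴴᵀ * τaᴴ).PosSemidef := by
    rw [hp.isHermitian]
    exact hp.posSemidef.transpose.mul_mul_conjTranspose_same τa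
  have h2 := hu _ h1 (by
    calc τa * hᴴᵀ * τaᴴ * (τa * hᴴᵀ * τaᴴ) = τa * hᴴᵀ * (τaᴴ * τa) * hᴴᵀ * τaᴴ := by
          simp only [Matrix.mul_assoc]
      _ = τa * (h * h)ᴴᵀ * τaᴴ := by
        rw [ha.star_mul, Matrix.mul_one, conjTranspose_mul, transpose_mul]
        simp only [Matrix.mul_assoc]
      _ = x := by
        rw [hh, ← hxm.1 hm, Matrix.mul_assoc, ha.mul_star, Matrix.mul_one])
  calc h * τa = τa * hᴴᵀ * τaᴴ * τa := by rw [h2]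
    _ = τa * hᴴᵀ := by rw [Matrix.mul_assoc, ha.star_mul, Matrix.mul_one]

/-- Write `1 = P + iQ` with intertwiners `P`, `Q`. The polynomial `det(P + zQ)` does not vanish at
`z = i`, hence it does not vanish at some real `t`, and `P + tQ` is again an intertwiner. -/
lemma exists_invertible (ha : IsRealStructure m τa) (hm : m = 0 ∨ m = 1 ∨ m = -1)
    {τ : Matrix a a ℂ} (hτ : IsRealStructure m τ) :
    ∃ g ∈ intertwiners m τa τ, g.det ≠ 0 := by
  rcases hm with rfl | hm
  · exact ⟨1, by rw [intertwiners_zero]; trivial, by simp⟩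
  · obtain ⟨P, hP, Q, hQ, h⟩ := (isRealForm_intertwiners ha hτ hm).span 1 Submodule.mem_top
    let p : Polynomial ℂ := (P.map Polynomial.C + (Polynomial.X : Polynomial ℂ) •
      Q.map Polynomial.C).det
    have hp : ∀ z : ℂ, p.eval z = (P + z • Q).det := by
      intro z
      rw [← Polynomial.coe_evalRingHom, RingHom.map_det]
      congr 1
      ext i j
      simp
      ring
    have hp0 : p ≠ 0 := by
      intro h0
      have := hp Complex.I
      rw [← h, h0] at this
      simp at this
    have : ∃ t : ℝ, p.eval (t : ℂ) ≠ 0 := by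
      by_contra hc
      push Not at hc
      refine hp0 (Polynomial.eq_zero_of_infinite_isRoot p ?_)
      refine Set.Infinite.mono (s := Set.range ((↑) : ℝ → ℂ)) ?_
        (Set.infinite_range_of_injective Complex.ofReal_injective)
      rintro _ ⟨t, rfl⟩
      exact hc t
    obtain ⟨t, ht⟩ := this
    refine ⟨P + t • Q, add_mem hP (Submodule.smul_mem _ t hQ), ?_⟩
    rw [hp] at ht
    exact ht

/-- The unitary factor `(g gᴴ)^{-1/2} g` of an invertible intertwiner `g` is an intertwiner. Hence
real structures of the same type and size are unitarily equivalent. -/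
lemma exists_unitary (ha : IsRealStructure m τa) (hb : IsRealStructure m τb)
    (hm : m = 0 ∨ m = 1 ∨ m = -1) (hcard : Fintype.card a = Fintype.card b) :
    ∃ u ∈ intertwiners m τa τb, u * uᴴ = 1 ∧ uᴴ * u = 1 := by
  let e : a ≃ b := Fintype.equivOfCardEq hcard
  have hτ : IsRealStructure m (τb.submatrix e e) := by
    refine ⟨?_, ?_, fun h0 => ?_⟩
    · rw [conjTranspose_submatrix, submatrix_mul_equiv, hb.mul_star, submatrix_one_equiv]
    · rw [conjTranspose_submatrix, submatrix_mul_equiv, hb.star_mul, submatrix_one_equiv]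
    · rw [transpose_submatrix, hb.transpose h0]; rfl
  obtain ⟨g, hg, hd⟩ := exists_invertible ha hm hτ
  have hgu : IsUnit g := (isUnit_iff_isUnit_det g).2 hd.isUnit
  have hpos : (g * gᴴ).PosDef := by
    rw [Matrix.posSemidef_self_mul_conjTranspose g |>.posDef_iff_isUnit, isUnit_iff_isUnit_det,
      det_mul, det_conjTranspose]
    exact hd.isUnit.mul hd.isUnit.star
  obtain ⟨h, hh, hhp, hhg⟩ := exists_sqrt_mem ha hpos (mul_star_mem_hermPart ha hτ hg)
  have hhd : h.det ≠ 0 := ((isUnit_iff_isUnit_det h).1 hhp.isUnit).ne_zero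
  have hu : h⁻¹ * g * (h⁻¹ * g)ᴴ = 1 := by
    rw [conjTranspose_mul, Matrix.mul_assoc, ← Matrix.mul_assoc g, ← hhg,
      conjTranspose_nonsing_inv, hhp.isHermitian, Matrix.mul_assoc, mul_nonsing_inv _ hhd.isUnit,
      Matrix.mul_one, nonsing_inv_mul _ hhd.isUnit]
  have hmem : h⁻¹ * g ∈ intertwiners m τa (τb.submatrix e e) :=
    intertwiners_mul (intertwiners_inv hh.1 hhd) hg
  have key : ∀ v : Matrix a a ℂ, v.submatrix id e.symm * (v.submatrix id e.symm)ᴴ = v * vᴴ := by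
    intro v
    rw [conjTranspose_submatrix, submatrix_mul_equiv, submatrix_id_id]
  refine ⟨(h⁻¹ * g).submatrix id e.symm, fun h0 => ?_, ?_, ?_⟩
  · have h1 := hmem h0
    have h2 : τb = (τb.submatrix e e).submatrix e.symm e.symm := by simp
    have h3 : (h⁻¹ * g * τb.submatrix e e).submatrix id e.symm =
        (τa * (h⁻¹ * g)ᴴᵀ).submatrix id e.symm := by rw [h1]
    rw [h2, submatrix_mul_equiv, h3]
    rfl
  · rw [key, hu]
  · rw [conjTranspose_submatrix]
    rw [← submatrix_mul _ _ _ id _ Function.bijective_id, mul_eq_one_comm.1 hu,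
      submatrix_one_equiv]

end SquareRoot

end

end BosonSector

namespace BosonSector

noncomputable section

set_option linter.unusedSectionVars false

open scoped Matrix.Norms.Frobenius
open Module

/-! ### The cone of positive elements -/

section Positive

variable {a b c : Type*} [Fintype a] [Fintype b] [Fintype c] [DecidableEq a] [DecidableEq b]
  [DecidableEq c] {m : ℤ} {τa : Matrix a a ℂ} {τb : Matrix b b ℂ} {τc : Matrix c c ℂ}

/-- The Frobenius norm is submultiplicative, so applying `h` to an eigenvector, viewed as a
one-column matrix, shows that each eigenvalue of `1 + h` is at distance less than 1 from 1. -/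
lemma posDef_one_add {h : Matrix a a ℂ} (hh : hᴴ = h) (hn : ‖h‖ < 1) : (1 + h).PosDef := by
  have hH : (1 + h).IsHermitian := by
    rw [IsHermitian, conjTranspose_add, conjTranspose_one, hh]
  rw [hH.posDef_iff_eigenvalues_pos]
  intro i
  have h1 := hH.mulVec_eigenvectorBasis i
  set v : a → ℂ := ⇑(hH.eigenvectorBasis i) with hv
  have hv0 : v ≠ 0 := by
    intro h0
    apply hH.eigenvectorBasis.toBasis.ne_zero i
    rw [OrthonormalBasis.coe_toBasis]
    ext j
    exact congrFun h0 j
  have h2 : h * replicateCol Unit v = (hH.eigenvalues i - 1) • replicateCol Unit v := by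
    rw [Matrix.add_mulVec, Matrix.one_mulVec] at h1
    have h3 : h *ᵥ v = (hH.eigenvalues i - 1) • v := by
      rw [sub_smul, one_smul, ← h1]; simp
    ext j k
    have := congrFun h3 j
    simpa [Matrix.mul_apply, mulVec, dotProduct, replicateCol] using this
  have h4 : 0 < ‖replicateCol Unit v‖ := by
    rw [norm_pos_iff]
    intro h0
    apply hv0
    ext j
    exact congrFun (congrFun h0 j) ()
  have h5 := frobenius_norm_mul h (replicateCol Unit v)
  rw [h2, norm_smul] at h5
  have h6 : ‖hH.eigenvalues i - 1‖ < 1 := (le_of_mul_le_mul_right h5 h4).trans_lt hn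
  rw [Real.norm_eq_abs, abs_lt] at h6
  linarith

/-- The positive definite elements of `hermPart`. -/
def posSet (m : ℤ) (τ : Matrix a a ℂ) : Set (Matrix a a ℂ) := {x | x ∈ hermPart m τ ∧ x.PosDef}

lemma isClosed_posSemidef : IsClosed {x : Matrix a a ℂ | x.PosSemidef} := by
  have : {x : Matrix a a ℂ | x.PosSemidef} = {x | xᴴ = x} ∩
      ⋂ v : a → ℂ, {x | 0 ≤ star v ⬝ᵥ (x *ᵥ v)} := by
    ext x
    simp only [Set.mem_ofPred_eq, posSemidef_iff_dotProduct_mulVec, IsHermitian, Set.mem_inter_iff,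
      Set.mem_iInter]
  rw [this]
  refine IsClosed.inter (isClosed_eq continuous_id.matrix_conjTranspose continuous_id) ?_
  refine isClosed_iInter fun v => ?_
  refine isClosed_le continuous_const ?_
  exact Continuous.dotProduct continuous_const (Continuous.matrix_mulVec continuous_id
    continuous_const)

lemma measurableSet_posDef : MeasurableSet {x : Matrix a a ℂ | x.PosDef} := by
  have : {x : Matrix a a ℂ | x.PosDef} = {x | x.PosSemidef} ∩ {x | x.det ≠ 0} := by
    ext x
    constructor
    · intro hx
      exact ⟨hx.posSemidef, ((isUnit_iff_isUnit_det x).1 hx.isUnit).ne_zero⟩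
    · rintro ⟨h1, h2⟩
      exact (PosSemidef.posDef_iff_isUnit h1).2 ((isUnit_iff_isUnit_det x).2 (Ne.isUnit h2))
  rw [this]
  exact isClosed_posSemidef.measurableSet.inter
    (isOpen_ne_fun (continuous_id.matrix_det) continuous_const).measurableSet

lemma measurableSet_posSet : MeasurableSet (posSet m τa) :=
  (measurableSet_submodule (hermPart m τa)).inter measurableSet_posDef

lemma subVol_posSet_pos : 0 < subVol (hermPart m τa) (posSet m τa) := by
  have h1 : (1 : Matrix a a ℂ) ∈ hermPart m τa := ⟨one_mem_intertwiners, by simp⟩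
  refine (subVol_pos (hermPart m τa) (U := Metric.ball 1 1) Metric.isOpen_ball
    ⟨1, Metric.mem_ball_self one_pos, h1⟩).trans_le ?_
  refine measure_mono_ae ?_
  filter_upwards [ae_mem_subVol (hermPart m τa)] with x hx hb
  have hb' : ‖x - 1‖ < 1 := by
    rw [← dist_eq_norm]; exact hb
  refine ⟨hx, ?_⟩
  have := posDef_one_add (h := x - 1) (by rw [conjTranspose_sub, hx.2]; simp) hb'
  simpa using this

lemma conj_mem_posSet (ha : IsRealStructure m τa) {g x : Matrix a a ℂ}
    (hg : g ∈ intertwiners m τa τa) (hd : g.det ≠ 0) (hx : x ∈ posSet m τa) :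
    g * x * gᴴ ∈ posSet m τa := by
  refine ⟨conj_mem_hermPart ha hg hx.1, ?_⟩
  have hu : IsUnit g := (isUnit_iff_isUnit_det g).2 hd.isUnit
  exact (IsUnit.posDef_star_right_conjugate_iff hu).2 hx.2

lemma conj_mem_posSet_iff (ha : IsRealStructure m τa) {g x : Matrix a a ℂ}
    (hg : g ∈ intertwiners m τa τa) (hd : g.det ≠ 0) :
    g * x * gᴴ ∈ posSet m τa ↔ x ∈ posSet m τa := by
  refine ⟨fun h => ?_, conj_mem_posSet ha hg hd⟩
  have hdi : g⁻¹.det ≠ 0 := by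
    rw [det_nonsing_inv]
    simpa using hd
  have := conj_mem_posSet ha (intertwiners_inv hg hd) hdi h
  have e : g⁻¹ * (g * x * gᴴ) * g⁻¹ᴴ = x := by
    rw [conjTranspose_nonsing_inv, ← Matrix.mul_assoc, ← Matrix.mul_assoc,
      nonsing_inv_mul _ hd.isUnit, Matrix.one_mul, Matrix.mul_assoc, mul_nonsing_inv, Matrix.mul_one]
    rw [det_conjTranspose]
    exact hd.isUnit.star
  rwa [e] at this

/-- A power of the absolute value of the determinant, as a density. -/
def detDensity (e : ℝ) (x : Matrix a a ℂ) : ENNReal := ENNReal.ofReal (‖x.det‖ ^ e)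

lemma continuous_det' : Continuous fun x : Matrix a a ℂ => x.det := continuous_id.matrix_det

@[fun_prop]
lemma measurable_detDensity (e : ℝ) : Measurable (detDensity (a := a) e) := by
  unfold detDensity
  have : Measurable fun x : Matrix a a ℂ => x.det := continuous_det'.measurable
  fun_prop

lemma detDensity_mul (e : ℝ) (x y : Matrix a a ℂ) :
    detDensity e (x * y) = detDensity e x * detDensity e y := by
  unfold detDensity
  rw [det_mul, norm_mul, Real.mul_rpow (norm_nonneg _) (norm_nonneg _),
    ENNReal.ofReal_mul (by positivity)]

lemma detDensity_star (e : ℝ) (x : Matrix a a ℂ) : detDensity e xᴴ = detDensity e x := by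
  unfold detDensity
  rw [det_conjTranspose, norm_star]

lemma detDensity_add (e f : ℝ) {x : Matrix a a ℂ} (hx : x.det ≠ 0) :
    detDensity (e + f) x = detDensity e x * detDensity f x := by
  unfold detDensity
  rw [Real.rpow_add (norm_pos_iff.2 hx), ENNReal.ofReal_mul (by positivity)]

lemma detDensity_zero (x : Matrix a a ℂ) : detDensity 0 x = 1 := by simp [detDensity]

lemma detDensity_ne_top (e : ℝ) (x : Matrix a a ℂ) : detDensity e x ≠ ⊤ := ENNReal.ofReal_ne_top

lemma detDensity_ne_zero (e : ℝ) {x : Matrix a a ℂ} (hx : x.det ≠ 0) : detDensity e x ≠ 0 := by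
  unfold detDensity
  rw [ENNReal.ofReal_ne_zero_iff]
  have := norm_pos_iff.2 hx
  positivity

lemma posSet_det_ne_zero {x : Matrix a a ℂ} (hx : x ∈ posSet m τa) : x.det ≠ 0 :=
  ((isUnit_iff_isUnit_det x).1 hx.2.isUnit).ne_zero

lemma measurable_inv_matrix : Measurable fun g : Matrix a a ℂ => g⁻¹ := by
  simp only [Matrix.inv_def, Ring.inverse_eq_inv]
  have h1 : Measurable fun x : Matrix a a ℂ => x.det := continuous_det'.measurable
  have h2 : Measurable fun x : Matrix a a ℂ => x.adjugate :=
    (continuous_id.matrix_adjugate).measurable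
  refine measurable_pi_iff.2 fun i => measurable_pi_iff.2 fun j => ?_
  have h3 : Measurable fun x : Matrix a a ℂ => x.adjugate i j := by
    have : Measurable fun x : Matrix a a ℂ => x i j := by
      exact (measurable_pi_apply j).comp (measurable_pi_apply i)
    exact this.comp h2
  exact h1.inv.mul h3

end Positive

end

end BosonSector

namespace BosonSector

noncomputable section

set_option linter.unusedSectionVars false

open scoped Matrix.Norms.Frobenius
open Module

/-! ### Invariant measures on the cone and on the group -/

section Invariant

variable {a b c : Type*} [Fintype a] [Fintype b] [Fintype c] [DecidableEq a] [DecidableEq b]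
  [DecidableEq c] {m : ℤ} {τa : Matrix a a ℂ} {τb : Matrix b b ℂ} {τc : Matrix c c ℂ}

@[fun_prop]
lemma measurable_matrix_mul {α : Type*} [MeasurableSpace α] {f : α → Matrix a b ℂ}
    {g : α → Matrix b c ℂ} (hf : Measurable f) (hg : Measurable g) :
    Measurable fun x => f x * g x := by
  have h : Continuous fun p : Matrix a b ℂ × Matrix b c ℂ => p.1 * p.2 :=
    continuous_fst.matrix_mul continuous_snd
  exact Measurable.comp (g := fun p : Matrix a b ℂ × Matrix b c ℂ => p.1 * p.2)
    (f := fun x => (f x, g x)) h.measurable (hf.prodMk hg)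

@[fun_prop]
lemma measurable_matrix_conjTranspose {α : Type*} [MeasurableSpace α] {f : α → Matrix a b ℂ}
    (hf : Measurable f) : Measurable fun x => (f x)ᴴ := by
  have h : Continuous fun p : Matrix a b ℂ => pᴴ := continuous_id.matrix_conjTranspose
  exact h.measurable.comp hf

@[fun_prop]
lemma measurable_matrix_inv {α : Type*} [MeasurableSpace α] {f : α → Matrix a a ℂ}
    (hf : Measurable f) : Measurable fun x => (f x)⁻¹ :=
  measurable_inv_matrix.comp hf

@[fun_prop]
lemma measurable_matrix_det {α : Type*} [MeasurableSpace α] {f : α → Matrix a a ℂ}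
    (hf : Measurable f) : Measurable fun x => (f x).det :=
  (continuous_det'.measurable).comp hf

/-- If `T` multiplies a measure and a density by the same constant, then it preserves the measure
with this density. -/
lemma map_withDensity_eq {α : Type*} [MeasurableSpace α] {μ : Measure α} {T : α → α}
    (hT : Measurable T) {k : ENNReal} (hμ : μ.map T = k • μ) {w : α → ENNReal} (hw : Measurable w)
    (hk : ∀ x, w (T x) = k * w x) (hk0 : k ≠ 0) (hkt : k ≠ ⊤) :
    (μ.withDensity w).map T = μ.withDensity w := by
  refine Measure.ext_of_lintegral _ fun f hf => ?_
  have h1 := lintegral_withDensity_eq_lintegral_mul μ hw (hf.comp hT)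
  simp only [Function.comp_apply] at h1
  rw [lintegral_map hf hT, h1, lintegral_withDensity_eq_lintegral_mul _ hw hf]
  have h2 : ∫⁻ x, (w * f) (T x) ∂μ = k * ∫⁻ x, (w * f) x ∂μ := by
    rw [← lintegral_map (hw.mul hf) hT, hμ, lintegral_smul_measure, smul_eq_mul]
  have h3 : ∀ x, (w * f) (T x) = k * (w * (f ∘ T)) x := by
    intro x
    simp only [Pi.mul_apply, Function.comp, hk, mul_assoc]
  simp only [h3] at h2
  rw [lintegral_const_mul _ (hw.mul (hf.comp hT))] at h2
  exact (ENNReal.mul_right_inj hk0 hkt).1 h2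

lemma map_restrict_eq {α : Type*} [MeasurableSpace α] {μ : Measure α} {T : α → α}
    (hT : Measurable T) {k : ENNReal} (hμ : μ.map T = k • μ) {S : Set α} (hS : MeasurableSet S)
    (h : T ⁻¹' S = S) : (μ.restrict S).map T = k • μ.restrict S := by
  have := Measure.restrict_map (μ := μ) hT hS
  rw [h, hμ, Measure.restrict_smul] at this
  exact this.symm

/-- Invariant measures on the domain of positive elements. -/
structure IsInvariant (m : ℤ) (τ : Matrix a a ℂ) (μ : Measure (Matrix a a ℂ)) : Prop where
  null : μ (posSet m τ)ᶜ = 0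
  inv : ∀ g ∈ intertwiners m τ τ, g.det ≠ 0 → μ.map (fun x => g * x * gᴴ) = μ

/-- The Euclidean volume on the domain of positive elements. -/
def posVol (m : ℤ) (τ : Matrix a a ℂ) : Measure (Matrix a a ℂ) :=
  (subVol (hermPart m τ)).restrict (posSet m τ)

instance sigmaFinite_posVol : SigmaFinite (posVol m τa) := by
  unfold posVol; infer_instance

instance sigmaFinite_withDensity_detDensity (μ : Measure (Matrix a a ℂ)) [SigmaFinite μ] (e : ℝ) :
    SigmaFinite (μ.withDensity (detDensity e)) :=
  SigmaFinite.withDensity_of_ne_top (Filter.Eventually.of_forall fun x => detDensity_ne_top e x)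

/-- The invariant measure on the domain of positive elements. -/
def invVol (m : ℤ) (τ : Matrix a a ℂ) : Measure (Matrix a a ℂ) :=
  (posVol m τ).withDensity (detDensity (-((Fintype.card a + m) / scale m)))

instance sigmaFinite_invVol : SigmaFinite (invVol m τa) := by
  unfold invVol; infer_instance

lemma isInvariant_invVol (ha : IsRealStructure m τa) (hm : m = 0 ∨ m = 1 ∨ m = -1) :
    IsInvariant m τa (invVol m τa) := by
  constructor
  · refine withDensity_absolutelyContinuous _ _ ?_
    rw [posVol, Measure.restrict_apply measurableSet_posSet.compl]
    simp
  · intro g hg hd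
    have h1 := map_restrict_eq (by fun_prop) (map_conj_subVol ha hm hg hd)
      (measurableSet_posSet (m := m) (τa := τa))
      (by ext x; exact conj_mem_posSet_iff ha hg hd)
    refine map_withDensity_eq (by fun_prop) h1 (measurable_detDensity _) (fun x => ?_) ?_ ?_
    · rw [detDensity_mul, detDensity_mul, detDensity_star, mul_comm, ← mul_assoc,
        ← detDensity_add _ _ hd]
      congr 1
      unfold detDensity
      congr 2
      ring
    · exact detDensity_ne_zero _ hd
    · exact detDensity_ne_top _ g

/-- The invariant measure on the group of invertible elements. -/
def groupVol (m : ℤ) (τ : Matrix a a ℂ) : Measure (Matrix a a ℂ) :=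
  ((subVol (intertwiners m τ τ)).restrict {g | g.det ≠ 0}).withDensity
    (detDensity (-(2 * Fintype.card a / scale m)))

instance sigmaFinite_groupVol : SigmaFinite (groupVol m τa) := by
  unfold groupVol; infer_instance

lemma measurableSet_det_ne_zero : MeasurableSet {g : Matrix a a ℂ | g.det ≠ 0} :=
  (isOpen_ne_fun continuous_det' continuous_const).measurableSet

lemma map_mul_left_groupVol (ha : IsRealStructure m τa) (hm : m = 0 ∨ m = 1 ∨ m = -1)
    {g : Matrix a a ℂ} (hg : g ∈ intertwiners m τa τa) (hd : g.det ≠ 0) :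
    (groupVol m τa).map (fun x => g * x) = groupVol m τa := by
  have h1 := map_restrict_eq (by fun_prop) (map_mul_left_subVol ha ha hm hg hd)
    measurableSet_det_ne_zero (by ext x; simp [hd])
  refine map_withDensity_eq (by fun_prop) h1 (measurable_detDensity _) (fun x => ?_) ?_ ?_
  · rw [detDensity_mul]
    rfl
  · exact detDensity_ne_zero _ hd
  · exact detDensity_ne_top _ g

lemma map_mul_right_groupVol (ha : IsRealStructure m τa) (hm : m = 0 ∨ m = 1 ∨ m = -1)
    {g : Matrix a a ℂ} (hg : g ∈ intertwiners m τa τa) (hd : g.det ≠ 0) :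
    (groupVol m τa).map (fun x => x * g) = groupVol m τa := by
  have h1 := map_restrict_eq (by fun_prop) (map_mul_right_subVol ha ha hm hg hd)
    measurableSet_det_ne_zero (by ext x; simp [hd])
  refine map_withDensity_eq (by fun_prop) h1 (measurable_detDensity _)
    (fun x => ?_) ?_ ?_
  · rw [detDensity_mul, mul_comm]
    rfl
  · exact detDensity_ne_zero _ hd
  · exact detDensity_ne_top _ g

lemma ae_groupVol : ∀ᵐ g ∂groupVol m τa, g ∈ intertwiners m τa τa ∧ g.det ≠ 0 := by
  refine (withDensity_absolutelyContinuous _ _).ae_le ?_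
  filter_upwards [ae_restrict_mem measurableSet_det_ne_zero,
    ae_restrict_of_ae (ae_mem_subVol (intertwiners m τa τa))] with g h1 h2
  exact ⟨h2, h1⟩

lemma IsInvariant.ae_mem {μ : Measure (Matrix a a ℂ)} (h : IsInvariant m τa μ) :
    ∀ᵐ x ∂μ, x ∈ posSet m τa := h.null

/-- Write `x = k kᴴ` with `k` in the group; right invariance absorbs `k`. In the companion statement
with `g⁻¹`, left invariance does. -/
lemma lintegral_conj_groupVol (ha : IsRealStructure m τa)
    (hm : m = 0 ∨ m = 1 ∨ m = -1) {ψ : Matrix a a ℂ → ENNReal} (hψ : Measurable ψ)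
    {x : Matrix a a ℂ} (hx : x ∈ posSet m τa) :
    ∫⁻ g, ψ (g * x * gᴴ) ∂groupVol m τa = ∫⁻ g, ψ (g * gᴴ) ∂groupVol m τa := by
  obtain ⟨k, hk, hkp, rfl⟩ := exists_sqrt_mem ha hx.2 hx.1
  have hkd : k.det ≠ 0 := posSet_det_ne_zero (m := m) (τa := τa) ⟨hk, hkp⟩
  conv_rhs => rw [← map_mul_right_groupVol ha hm hk.1 hkd]
  rw [lintegral_map (by fun_prop) (by fun_prop)]
  refine lintegral_congr fun g => ?_
  rw [conjTranspose_mul]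
  simp only [Matrix.mul_assoc]

lemma lintegral_conj_inv_groupVol (ha : IsRealStructure m τa)
    (hm : m = 0 ∨ m = 1 ∨ m = -1) {φ : Matrix a a ℂ → ENNReal} (hφ : Measurable φ)
    {x : Matrix a a ℂ} (hx : x ∈ posSet m τa) :
    ∫⁻ g, φ (g⁻¹ * x * (g⁻¹)ᴴ) ∂groupVol m τa = ∫⁻ g, φ (g⁻¹ * (g⁻¹)ᴴ) ∂groupVol m τa := by
  obtain ⟨k, hk, hkp, rfl⟩ := exists_sqrt_mem ha hx.2 hx.1
  have hkd : k.det ≠ 0 := posSet_det_ne_zero (m := m) (τa := τa) ⟨hk, hkp⟩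
  conv_lhs => rw [← map_mul_left_groupVol ha hm hk.1 hkd]
  rw [lintegral_map (by fun_prop) (by fun_prop)]
  refine lintegral_congr fun g => ?_
  have hu : IsUnit k.det := hkd.isUnit
  have hu' : IsUnit kᴴ.det := by rw [det_conjTranspose]; exact hu.star
  congr 1
  rw [Matrix.mul_inv_rev, conjTranspose_mul, conjTranspose_nonsing_inv k]
  calc g⁻¹ * k⁻¹ * (k * kᴴ) * (kᴴ⁻¹ * g⁻¹ᴴ) = g⁻¹ * (k⁻¹ * k) * (kᴴ * kᴴ⁻¹) * g⁻¹ᴴ := by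
        simp only [Matrix.mul_assoc]
    _ = g⁻¹ * g⁻¹ᴴ := by
      rw [nonsing_inv_mul _ hu, mul_nonsing_inv _ hu', Matrix.mul_one, Matrix.mul_one]

lemma IsInvariant.lintegral_conj {μ : Measure (Matrix a a ℂ)} (h : IsInvariant m τa μ)
    {φ ψ : Matrix a a ℂ → ENNReal} (hφ : Measurable φ) (hψ : Measurable ψ) {g : Matrix a a ℂ}
    (hg : g ∈ intertwiners m τa τa ∧ g.det ≠ 0) :
    ∫⁻ x, φ x * ψ (g * x * gᴴ) ∂μ = ∫⁻ x, φ (g⁻¹ * x * (g⁻¹)ᴴ) * ψ x ∂μ := by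
  conv_rhs => rw [← h.inv g hg.1 hg.2]
  rw [lintegral_map (by fun_prop) (by fun_prop)]
  refine lintegral_congr fun x => ?_
  have hu : IsUnit g.det := hg.2.isUnit
  have hu' : IsUnit gᴴ.det := by rw [det_conjTranspose]; exact hu.star
  have : g⁻¹ * (g * x * gᴴ) * (g⁻¹)ᴴ = x := by
    rw [conjTranspose_nonsing_inv, ← Matrix.mul_assoc, ← Matrix.mul_assoc, nonsing_inv_mul _ hu,
      Matrix.one_mul, Matrix.mul_assoc, mul_nonsing_inv _ hu', Matrix.mul_one]
  rw [this]

/-- Averaging over the group: the double integral of `φ(x) ψ(g x gᴴ)` evaluated in two ways. -/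
lemma IsInvariant.lintegral_mul_lintegral (ha : IsRealStructure m τa)
    (hm : m = 0 ∨ m = 1 ∨ m = -1) {μ : Measure (Matrix a a ℂ)} [SigmaFinite μ]
    (h : IsInvariant m τa μ) {φ ψ : Matrix a a ℂ → ENNReal} (hφ : Measurable φ)
    (hψ : Measurable ψ) :
    (∫⁻ g, ψ (g * gᴴ) ∂groupVol m τa) * ∫⁻ x, φ x ∂μ =
      (∫⁻ g, φ (g⁻¹ * (g⁻¹)ᴴ) ∂groupVol m τa) * ∫⁻ x, ψ x ∂μ := by
  have m1 : Measurable fun p : Matrix a a ℂ × Matrix a a ℂ => φ p.1 * ψ (p.2 * p.1 * p.2ᴴ) := by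
    fun_prop
  have m2 : Measurable fun p : Matrix a a ℂ × Matrix a a ℂ =>
      φ (p.2⁻¹ * p.1 * (p.2⁻¹)ᴴ) * ψ p.1 := by
    fun_prop
  have h1 : ∫⁻ x, ∫⁻ g, φ x * ψ (g * x * gᴴ) ∂groupVol m τa ∂μ =
      (∫⁻ g, ψ (g * gᴴ) ∂groupVol m τa) * ∫⁻ x, φ x ∂μ := by
    rw [mul_comm, ← lintegral_mul_const _ hφ]
    refine lintegral_congr_ae ?_
    filter_upwards [h.ae_mem] with x hx
    have mm : Measurable fun g : Matrix a a ℂ => ψ (g * x * gᴴ) := by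
      fun_prop
    rw [lintegral_const_mul _ mm, lintegral_conj_groupVol ha hm hψ hx]
  have h2 : ∫⁻ g, ∫⁻ x, φ x * ψ (g * x * gᴴ) ∂μ ∂groupVol m τa =
      ∫⁻ g, ∫⁻ x, φ (g⁻¹ * x * (g⁻¹)ᴴ) * ψ x ∂μ ∂groupVol m τa :=
    lintegral_congr_ae (ae_groupVol.mono fun g hg => h.lintegral_conj hφ hψ hg)
  have h3 : ∫⁻ x, ∫⁻ g, φ (g⁻¹ * x * (g⁻¹)ᴴ) * ψ x ∂groupVol m τa ∂μ =
      (∫⁻ g, φ (g⁻¹ * (g⁻¹)ᴴ) ∂groupVol m τa) * ∫⁻ x, ψ x ∂μ := by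
    rw [← lintegral_const_mul _ hψ]
    refine lintegral_congr_ae ?_
    filter_upwards [h.ae_mem] with x hx
    have mm : Measurable fun g : Matrix a a ℂ => φ (g⁻¹ * x * (g⁻¹)ᴴ) := by
      fun_prop
    rw [lintegral_mul_const _ mm, lintegral_conj_inv_groupVol ha hm hφ hx]
  have s1 := lintegral_lintegral_swap (μ := μ) (ν := groupVol m τa)
    (f := fun x g => φ x * ψ (g * x * gᴴ)) m1.aemeasurable
  have s2 := lintegral_lintegral_swap (μ := μ) (ν := groupVol m τa)
    (f := fun x g => φ (g⁻¹ * x * (g⁻¹)ᴴ) * ψ x) m2.aemeasurable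
  rw [← h1, s1, h2, ← s2, h3]

end Invariant

end

end BosonSector

namespace BosonSector

noncomputable section

set_option linter.unusedSectionVars false

open scoped Matrix.Norms.Frobenius
open Module

/-! ### The image of Lebesgue measure under `X ↦ X Xᴴ`, up to a constant -/

section Gram

variable {a b c : Type*} [Fintype a] [Fintype b] [Fintype c] [DecidableEq a] [DecidableEq b]
  [DecidableEq c] {m : ℤ} {τa : Matrix a a ℂ} {τb : Matrix b b ℂ} {τc : Matrix c c ℂ}

lemma IsRealStructure.fromBlocks (ha : IsRealStructure m τa) (hc : IsRealStructure m τc) :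
    IsRealStructure m (fromBlocks τa 0 0 τc) := by
  refine ⟨?_, ?_, fun h => ?_⟩
  · simp [fromBlocks_conjTranspose, fromBlocks_multiply, ha.mul_star, hc.mul_star]
  · simp [fromBlocks_conjTranspose, fromBlocks_multiply, ha.star_mul, hc.star_mul]
  · simp [fromBlocks_transpose, fromBlocks_smul, ha.transpose h, hc.transpose h]

/-- The target structure is unitarily equivalent to the direct sum of those on `a` and `c`, from
which one projects to the first summand. One such `X` is enough to make almost every intertwiner
surjective. -/
lemma exists_coisometry (ha : IsRealStructure m τa) (hb : IsRealStructure m τb)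
    (hc : IsRealStructure m τc) (hm : m = 0 ∨ m = 1 ∨ m = -1)
    (hcard : Fintype.card a + Fintype.card c = Fintype.card b) :
    ∃ X ∈ intertwiners m τa τb, X * Xᴴ = 1 := by
  obtain ⟨u, hu, hu1, hu2⟩ := exists_unitary (ha.fromBlocks hc) hb hm (by simpa using hcard)
  have h0 : (fromCols 1 0 : Matrix a (a ⊕ c) ℂ) ∈ intertwiners m τa (fromBlocks τa 0 0 τc) := by
    intro _
    ext i (j | j)
    · simp [Matrix.mul_apply, Matrix.one_apply]
    · simp [Matrix.mul_apply]
  refine ⟨_, intertwiners_mul h0 hu, ?_⟩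
  rw [conjTranspose_mul, Matrix.mul_assoc, ← Matrix.mul_assoc u, hu1, Matrix.one_mul,
    conjTranspose_fromCols_eq_fromRows_conjTranspose, fromCols_mul_fromRows]
  simp

lemma posDef_of_det_ne_zero {X Y : Matrix a b ℂ} (h : (X * Yᴴ).det ≠ 0) : (X * Xᴴ).PosDef := by
  refine PosDef.mul_conjTranspose_self X ?_
  intro v w hvw
  have hvw' : v ᵥ* X = w ᵥ* X := hvw
  have h1 : v ᵥ* (X * Yᴴ) = w ᵥ* (X * Yᴴ) := by
    rw [← vecMul_vecMul, ← vecMul_vecMul, hvw']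
  have hu : IsUnit (X * Yᴴ).det := h.isUnit
  have h2 := congrArg (fun z => z ᵥ* (X * Yᴴ)⁻¹) h1
  simpa [vecMul_vecMul, mul_nonsing_inv _ hu] using h2

/-- Along each line `X + tY`, the determinant of `(X + tY) Yᴴ = X Yᴴ + t` is a characteristic
polynomial in `t` and has finitely many zeros. By Fubini and translation invariance `X Yᴴ` is almost
surely invertible, and then `X Xᴴ` is positive definite. -/
lemma subVol_not_posDef {Y : Matrix a b ℂ} (hY : Y ∈ intertwiners m τa τb) (hYY : Y * Yᴴ = 1) :
    ∀ᵐ X ∂subVol (intertwiners m τa τb), (X * Xᴴ).PosDef := by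
  set μ := subVol (intertwiners m τa τb) with hμ
  let E : Set (Matrix a b ℂ) := {X | (X * Yᴴ).det = 0}
  have hE : MeasurableSet E := by
    have : Measurable fun X : Matrix a b ℂ => (X * Yᴴ).det := by fun_prop
    exact this (measurableSet_singleton 0)
  have hadd : Continuous fun p : ℝ × Matrix a b ℂ => p.1 • Y + p.2 := by fun_prop
  let S : Set (ℝ × Matrix a b ℂ) := {p | p.1 • Y + p.2 ∈ E}
  have hS : MeasurableSet S := hadd.measurable hE
  have h1 : (volume.prod μ) S = 0 := by
    rw [Measure.prod_apply_symm hS, lintegral_eq_zero_iff (measurable_measure_prodMk_right hS)]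
    refine Filter.Eventually.of_forall fun X => ?_
    refine Set.Finite.measure_zero ?_ _
    have hinj : Function.Injective ((↑) : ℝ → ℂ) := Complex.ofReal_injective
    refine Set.Finite.of_finite_image (f := ((↑) : ℝ → ℂ)) ?_ hinj.injOn
    refine Set.Finite.subset (Polynomial.finite_setOfPred_isRoot
      (Matrix.charpoly_monic (-(X * Yᴴ))).ne_zero) ?_
    rintro _ ⟨t, ht, rfl⟩
    have ht' : ((t • Y + X) * Yᴴ).det = 0 := ht
    show (charpoly (-(X * Yᴴ))).eval (t : ℂ) = 0
    rw [Matrix.eval_charpoly, ← ht']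
    congr 1
    rw [Matrix.add_mul, Matrix.smul_mul, hYY, sub_neg_eq_add]
    congr 1
    ext i j
    simp [Matrix.scalar_apply, Matrix.diagonal_apply, Matrix.one_apply]
  rw [Measure.prod_apply hS] at h1
  have h2 : ∀ t : ℝ, μ (Prod.mk t ⁻¹' S) = μ E := by
    intro t
    have h3 := map_add_subVol (intertwiners m τa τb) (Submodule.smul_mem _ t hY)
    have h4 : Measurable fun X : Matrix a b ℂ => t • Y + X :=
      (by fun_prop : Continuous fun X : Matrix a b ℂ => t • Y + X).measurable
    have h5 := congrArg (fun ρ => ρ E) h3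
    simp only [Measure.map_apply h4 hE] at h5
    exact h5
  simp only [h2, lintegral_const, Real.volume_univ] at h1
  have h3 : μ E = 0 := by
    by_contra hne
    rw [ENNReal.mul_top hne] at h1
    exact ENNReal.top_ne_zero h1
  refine measure_mono_null (fun X hX => ?_) h3
  by_contra hne
  exact hX (posDef_of_det_ne_zero hne)

/-- The image of the volume of the space of intertwiners under `X ↦ X Xᴴ`. -/
def gramVol (m : ℤ) (τa : Matrix a a ℂ) (τb : Matrix b b ℂ) : Measure (Matrix a a ℂ) :=
  (subVol (intertwiners m τa τb)).map fun X => X * Xᴴ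

lemma measurable_trace_re : Measurable fun x : Matrix a a ℂ => x.trace.re :=
  (Complex.continuous_re.comp (continuous_id.matrix_trace)).measurable

/-- `Tr(X Xᴴ) = ‖X‖²`, so sublevel sets of the trace pull back to bounded sets. -/
instance sigmaFinite_gramVol : SigmaFinite (gramVol m τa τb) := by
  refine ⟨⟨⟨fun n : ℕ => {x | x.trace.re ≤ n}, fun _ => trivial, fun n => ?_, ?_⟩⟩⟩
  · rw [gramVol, Measure.map_apply (by fun_prop)
      (measurableSet_le measurable_trace_re measurable_const)]
    refine (measure_mono (?_ : _ ⊆ Metric.closedBall (0 : Matrix a b ℂ) (n + 1))).trans_lt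
      (subVol_lt_top _ Metric.isBounded_closedBall)
    intro X hX
    rw [mem_closedBall_zero_iff]
    have h1 : ‖X‖ ^ 2 ≤ n := by
      rw [norm_sq_eq_trace]; exact hX
    nlinarith [norm_nonneg X, sq_nonneg (‖X‖ - 1)]
  · rw [Set.eq_univ_iff_forall]
    intro x
    obtain ⟨n, hn⟩ := exists_nat_ge x.trace.re
    exact Set.mem_iUnion.2 ⟨n, hn⟩

lemma lintegral_exp_gramVol :
    ∫⁻ x, ENNReal.ofReal (Real.exp (-x.trace.re)) ∂gramVol m τa τb =
      ENNReal.ofReal (Real.pi ^ ((finrank ℝ (intertwiners m τa τb) : ℝ) / 2)) := by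
  have := measurable_trace_re (a := a)
  rw [gramVol, lintegral_map (by fun_prop) (by fun_prop), ← lintegral_gaussian_subVol]
  simp only [norm_sq_eq_trace]

lemma ae_gramVol (ha : IsRealStructure m τa) (hb : IsRealStructure m τb)
    {Y : Matrix a b ℂ} (hY : Y ∈ intertwiners m τa τb) (hYY : Y * Yᴴ = 1) :
    ∀ᵐ x ∂gramVol m τa τb, x ∈ posSet m τa := by
  refine (ae_map_iff (p := fun x => x ∈ posSet m τa) (by fun_prop) measurableSet_posSet).2 ?_
  filter_upwards [subVol_not_posDef hY hYY, ae_mem_subVol (intertwiners m τa τb)] with X h1 h2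
  exact ⟨mul_star_mem_hermPart ha hb h2, h1⟩

lemma isInvariant_gramVol (ha : IsRealStructure m τa) (hb : IsRealStructure m τb)
    (hm : m = 0 ∨ m = 1 ∨ m = -1)
    {Y : Matrix a b ℂ} (hY : Y ∈ intertwiners m τa τb) (hYY : Y * Yᴴ = 1) :
    IsInvariant m τa
      ((gramVol m τa τb).withDensity (detDensity (-(Fintype.card b / scale m)))) := by
  constructor
  · exact withDensity_absolutelyContinuous _ _ (ae_gramVol ha hb hY hYY)
  · intro g hg hd
    have h1 : (gramVol m τa τb).map (fun x => g * x * gᴴ) =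
        ENNReal.ofReal (‖g.det‖ ^ (-(2 * Fintype.card b / scale m : ℝ))) • gramVol m τa τb := by
      rw [gramVol, Measure.map_map (by fun_prop) (by fun_prop), ← Measure.map_smul,
        ← map_mul_left_subVol ha hb hm hg hd, Measure.map_map (by fun_prop) (by fun_prop)]
      congr 1
      ext1 X
      simp only [Function.comp, conjTranspose_mul, Matrix.mul_assoc]
    refine map_withDensity_eq (by fun_prop) h1 (measurable_detDensity _) (fun x => ?_) ?_ ?_
    · rw [detDensity_mul, detDensity_mul, detDensity_star, mul_comm, ← mul_assoc,
        ← detDensity_add _ _ hd]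
      congr 1
      unfold detDensity
      congr 2
      ring
    · exact detDensity_ne_zero _ hd
    · exact detDensity_ne_top _ g

/-- The Haar measure of the group projects to the cone as a weighted square Gram measure, which
serves as the reference measure in the uniqueness theorem. -/
lemma lintegral_groupVol {ψ : Matrix a a ℂ → ENNReal}
    (hψ : Measurable ψ) :
    ∫⁻ g, ψ (g * gᴴ) ∂groupVol m τa =
      ∫⁻ x, ψ x ∂(gramVol m τa τa).withDensity (detDensity (-(Fintype.card a / scale m))) := by
  have h0 := subVol_not_posDef (τa := τa) (τb := τa) (m := m)
    (Y := (1 : Matrix a a ℂ)) one_mem_intertwiners (by simp)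
  have hdet : ∀ᵐ g ∂subVol (intertwiners m τa τa), g.det ≠ 0 := by
    filter_upwards [h0] with g hg hd
    have := ((isUnit_iff_isUnit_det _).1 hg.isUnit).ne_zero
    rw [det_mul, hd, zero_mul] at this
    exact this rfl
  have hr : (subVol (intertwiners m τa τa)).restrict {g | g.det ≠ 0} =
      subVol (intertwiners m τa τa) := Measure.restrict_eq_self_of_ae_mem hdet
  rw [groupVol, hr, lintegral_withDensity_eq_lintegral_mul _ (measurable_detDensity _)
    (by fun_prop), lintegral_withDensity_eq_lintegral_mul _ (measurable_detDensity _) hψ, gramVol,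
    lintegral_map (by fun_prop) (by fun_prop)]
  refine lintegral_congr_ae ?_
  filter_upwards [hdet] with g hg
  simp only [Pi.mul_apply]
  congr 1
  rw [detDensity_mul, detDensity_star, ← detDensity_add _ _ hg]
  congr 1
  ring

/-- The two powers of the determinant cancel and a Gaussian integral remains. It supplies a test
function whose integral is known to be finite and nonzero. -/
lemma lintegral_exp_detDensity (ha : IsRealStructure m τa) (hb : IsRealStructure m τb)
    {Y : Matrix a b ℂ} (hY : Y ∈ intertwiners m τa τb) (hYY : Y * Yᴴ = 1) (e : ℝ) :
    ∫⁻ x, ENNReal.ofReal (Real.exp (-x.trace.re)) * detDensity e x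
        ∂(gramVol m τa τb).withDensity (detDensity (-e)) =
      ENNReal.ofReal (Real.pi ^ ((finrank ℝ (intertwiners m τa τb) : ℝ) / 2)) := by
  have := measurable_trace_re (a := a)
  rw [lintegral_withDensity_eq_lintegral_mul _ (measurable_detDensity _) (by fun_prop),
    ← lintegral_exp_gramVol]
  refine lintegral_congr_ae ?_
  filter_upwards [ae_gramVol ha hb hY hYY] with x hx
  simp only [Pi.mul_apply]
  rw [mul_left_comm, ← detDensity_add _ _ (posSet_det_ne_zero hx), neg_add_cancel,
    detDensity_zero, mul_one]

/-- Invariant measures on the domain of positive elements are proportional. -/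
lemma IsInvariant.eq_smul (ha : IsRealStructure m τa) (hm : m = 0 ∨ m = 1 ∨ m = -1)
    {μ : Measure (Matrix a a ℂ)} [SigmaFinite μ] (h : IsInvariant m τa μ) (hμ : μ ≠ 0) :
    ∃ k : ENNReal, k ≠ 0 ∧ k ≠ ⊤ ∧
      μ = k • (gramVol m τa τa).withDensity (detDensity (-(Fintype.card a / scale m))) := by
  set W := (gramVol m τa τa).withDensity (detDensity (-(Fintype.card a / scale m))) with hW
  have htr := measurable_trace_re (a := a)
  have h1 : (1 : Matrix a a ℂ) * 1ᴴ = 1 := by simp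
  have hWi : IsInvariant m τa W := isInvariant_gramVol ha ha hm one_mem_intertwiners h1
  let ψ : Matrix a a ℂ → ENNReal := fun x =>
    ENNReal.ofReal (Real.exp (-x.trace.re)) * detDensity (Fintype.card a / scale m) x
  have hψ : Measurable ψ := by fun_prop
  have hP : ∫⁻ x, ψ x ∂W = ENNReal.ofReal
      (Real.pi ^ ((finrank ℝ (intertwiners m τa τa) : ℝ) / 2)) :=
    lintegral_exp_detDensity ha ha one_mem_intertwiners h1 _
  set P := ENNReal.ofReal (Real.pi ^ ((finrank ℝ (intertwiners m τa τa) : ℝ) / 2)) with hPdef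
  have hP0 : P ≠ 0 := by
    rw [hPdef, ENNReal.ofReal_ne_zero_iff]; positivity
  have hPt : P ≠ ⊤ := ENNReal.ofReal_ne_top
  -- The averaging identity is used for `μ` and for `W` with the same `φ` and `ψ`. The instance for
  -- `W` identifies the group integral of `φ(g⁻¹ (g⁻¹)ᴴ)` with `∫ φ dW`, so unimodularity need not
  -- be discussed.
  have key : ∀ φ : Matrix a a ℂ → ENNReal, Measurable φ →
      P * ∫⁻ x, φ x ∂μ = (∫⁻ x, φ x ∂W) * ∫⁻ x, ψ x ∂μ := by
    intro φ hφ
    have e1 := h.lintegral_mul_lintegral ha hm hφ hψ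
    have e2 := hWi.lintegral_mul_lintegral ha hm hφ hψ
    rw [lintegral_groupVol hψ, hP] at e1 e2
    have e3 : ∫⁻ x, φ x ∂W = ∫⁻ g, φ (g⁻¹ * (g⁻¹)ᴴ) ∂groupVol m τa := by
      rw [mul_comm P] at e2
      exact (ENNReal.mul_left_inj hP0 hPt).1 e2
    rw [e1, e3]
  set J := ∫⁻ x, ψ x ∂μ with hJ
  have hset : ∀ S, MeasurableSet S → P * μ S = W S * J := by
    intro S hS
    have := key (S.indicator 1) (measurable_one.indicator hS)
    rwa [lintegral_indicator_one hS, lintegral_indicator_one hS] at this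
  have hWne : W ≠ 0 := by
    intro h0
    rw [h0] at hP
    simp at hP
    exact hP0 hP.symm
  have hJ0 : J ≠ 0 := by
    intro h0
    apply hμ
    rw [← Measure.measure_univ_eq_zero]
    have := hset Set.univ MeasurableSet.univ
    rw [h0, mul_zero] at this
    exact (mul_eq_zero.1 this).resolve_left hP0
  -- With `J` infinite, every set of finite `μ`-measure would be `W`-null, and countably many such
  -- sets cover the space.
  have hJt : J ≠ ⊤ := by
    intro ht
    apply hWne
    rw [← Measure.measure_univ_eq_zero, ← iUnion_spanningSets μ, measure_iUnion_null_iff]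
    intro n
    by_contra hne
    have h2 := hset (spanningSets μ n) (measurableSet_spanningSets μ n)
    rw [ht, ENNReal.mul_top hne] at h2
    exact (ENNReal.mul_ne_top hPt (measure_spanningSets_lt_top μ n).ne) h2
  refine ⟨J / P, ENNReal.div_ne_zero.2 ⟨hJ0, hPt⟩, ENNReal.div_ne_top hJt hP0, ?_⟩
  refine Measure.ext fun S hS => ?_
  rw [Measure.smul_apply, smul_eq_mul, ENNReal.div_eq_inv_mul, mul_assoc, mul_comm J, ← hset S hS,
    ← mul_assoc, ENNReal.inv_mul_cancel hP0 hPt, one_mul]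

lemma invVol_ne_zero : invVol m τa ≠ 0 := by
  intro h0
  have h1 : posVol m τa Set.univ = 0 := by
    have h2 := (withDensity_absolutelyContinuous' (μ := posVol m τa)
      (f := detDensity (-((Fintype.card a + m) / scale m))) (by fun_prop) ?_)
    · have := h2 (s := Set.univ) (by
        have h3 : invVol m τa Set.univ = 0 := by rw [h0]; rfl
        exact h3)
      exact this
    · filter_upwards [ae_restrict_mem measurableSet_posSet] with x hx
      exact detDensity_ne_zero _ (posSet_det_ne_zero hx)
  rw [posVol, Measure.restrict_apply MeasurableSet.univ, Set.univ_inter] at h1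
  exact subVol_posSet_pos.ne' h1

/-- The image of the volume under `X ↦ X Xᴴ`, up to a constant. -/
lemma exists_gramVol_eq (ha : IsRealStructure m τa) (hb : IsRealStructure m τb)
    (hc : IsRealStructure m τc) (hm : m = 0 ∨ m = 1 ∨ m = -1)
    (hcard : Fintype.card a + Fintype.card c = Fintype.card b) :
    ∃ k : ENNReal, k ≠ 0 ∧ k ≠ ⊤ ∧ gramVol m τa τb =
      k • (posVol m τa).withDensity (detDensity ((Fintype.card c - m) / scale m)) := by
  obtain ⟨Y, hY, hYY⟩ := exists_coisometry ha hb hc hm hcard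
  obtain ⟨k₁, h10, h1t, h1⟩ := (isInvariant_invVol ha hm).eq_smul ha hm invVol_ne_zero
  set e : ℝ := Fintype.card b / scale m with he
  have hback : ((gramVol m τa τb).withDensity (detDensity (-e))).withDensity (detDensity e) =
      gramVol m τa τb := by
    rw [← withDensity_mul _ (by fun_prop) (by fun_prop)]
    conv_rhs => rw [← withDensity_one (μ := gramVol m τa τb)]
    refine withDensity_congr_ae ?_
    filter_upwards [ae_gramVol ha hb hY hYY] with x hx
    rw [Pi.mul_apply, ← detDensity_add _ _ (posSet_det_ne_zero hx), neg_add_cancel,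
      detDensity_zero]
    rfl
  have hne : (gramVol m τa τb).withDensity (detDensity (-e)) ≠ 0 := by
    intro h0
    rw [h0] at hback
    have h2 := lintegral_exp_gramVol (m := m) (τa := τa) (τb := τb)
    rw [← hback] at h2
    simp at h2
    have : (0 : ℝ) < Real.pi ^ ((finrank ℝ (intertwiners m τa τb) : ℝ) / 2) := by positivity
    linarith [h2]
  obtain ⟨k₂, h20, h2t, h2⟩ := (isInvariant_gramVol ha hb hm hY hYY).eq_smul ha hm hne
  refine ⟨k₂ / k₁, ENNReal.div_ne_zero.2 ⟨h20, h1t⟩, ENNReal.div_ne_top h2t h10, ?_⟩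
  set W := (gramVol m τa τa).withDensity (detDensity (-(Fintype.card a / scale m))) with hW
  have h3 : W = k₁⁻¹ • invVol m τa := by
    rw [h1, smul_smul, ENNReal.inv_mul_cancel h10 h1t, one_smul]
  rw [← hback, h2, h3, smul_smul, withDensity_smul_measure, ← div_eq_mul_inv, invVol,
    ← withDensity_mul _ (by fun_prop) (by fun_prop)]
  congr 1
  refine withDensity_congr_ae ?_
  filter_upwards [ae_restrict_mem measurableSet_posSet] with x hx
  rw [Pi.mul_apply, ← detDensity_add _ _ (posSet_det_ne_zero hx)]
  congr 1
  -- Removing the weight `-b / scale` of the Gram measure and inserting the weight `-(a + m) /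
  -- scale` of the invariant measure leaves the exponent `(b - a - m) / scale = (c - m) / scale`.
  have hcard' : (Fintype.card a : ℝ) + Fintype.card c = Fintype.card b := by exact_mod_cast hcard
  rw [he, ← hcard']
  ring

end Gram

end

end BosonSector

namespace BosonSector

noncomputable section

set_option linter.unusedSectionVars false

open scoped Matrix.Norms.Frobenius
open Module

/-! ### Estimates for the polar map near the identity -/

section NearIdentity

variable {a b : Type*} [Fintype a] [Fintype b] [DecidableEq a] [DecidableEq b] {m : ℤ}
  {τ : Matrix b b ℂ}

lemma norm_mul_unitary (X : Matrix a b ℂ) {k : Matrix b b ℂ} (hk : k * kᴴ = 1) :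
    ‖X * k‖ = ‖X‖ := by
  rw [← sq_eq_sq₀ (norm_nonneg _) (norm_nonneg _), norm_sq_eq_trace, norm_sq_eq_trace,
    conjTranspose_mul, Matrix.mul_assoc, ← Matrix.mul_assoc k, hk, Matrix.one_mul]

lemma norm_add_sq_of_herm_skew {h A : Matrix b b ℂ} (hh : hᴴ = h) (hA : Aᴴ = -A) :
    ‖h + A‖ ^ 2 = ‖h‖ ^ 2 + ‖A‖ ^ 2 := by
  rw [norm_sq_eq_trace, norm_sq_eq_trace, norm_sq_eq_trace, conjTranspose_add, hh, hA,
    Matrix.add_mul, Matrix.mul_add, Matrix.mul_add, trace_add, trace_add, trace_add,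
    Matrix.mul_neg, trace_neg, trace_mul_comm h A]
  simp only [Complex.add_re, Complex.neg_re]
  ring

lemma norm_le_of_herm_skew {h A : Matrix b b ℂ} (hh : hᴴ = h) (hA : Aᴴ = -A) :
    ‖h‖ ≤ ‖h + A‖ ∧ ‖A‖ ≤ ‖h + A‖ := by
  have := norm_add_sq_of_herm_skew hh hA
  constructor
  · exact le_of_sq_le_sq (by nlinarith [sq_nonneg ‖A‖]) (norm_nonneg _)
  · exact le_of_sq_le_sq (by nlinarith [sq_nonneg ‖h‖]) (norm_nonneg _)

/-- The anti-Hermitian part of a matrix. -/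
def skewOf (k : Matrix b b ℂ) : Matrix b b ℂ := (1 / 2 : ℝ) • (k - kᴴ)

/-- The Hermitian part of a matrix. -/
def hermOf (k : Matrix b b ℂ) : Matrix b b ℂ := (1 / 2 : ℝ) • (k + kᴴ)

lemma hermOf_add_skewOf (k : Matrix b b ℂ) : hermOf k + skewOf k = k := by
  rw [hermOf, skewOf, ← smul_add, add_add_sub_cancel, ← two_smul ℝ, smul_smul]
  norm_num

lemma conjTranspose_skewOf (k : Matrix b b ℂ) : (skewOf k)ᴴ = -skewOf k := by
  simp [skewOf, ← smul_neg]

lemma conjTranspose_hermOf (k : Matrix b b ℂ) : (hermOf k)ᴴ = hermOf k := by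
  simp [hermOf, add_comm]

lemma norm_skewOf_le (k : Matrix b b ℂ) : ‖skewOf k‖ ≤ ‖k‖ := by
  have := (norm_le_of_herm_skew (conjTranspose_hermOf k) (conjTranspose_skewOf k)).2
  rwa [hermOf_add_skewOf] at this

lemma norm_hermOf_le (k : Matrix b b ℂ) : ‖hermOf k‖ ≤ ‖k‖ := by
  have := (norm_le_of_herm_skew (conjTranspose_hermOf k) (conjTranspose_skewOf k)).1
  rwa [hermOf_add_skewOf] at this

lemma skewOf_sub (k l : Matrix b b ℂ) : skewOf (k - l) = skewOf k - skewOf l := by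
  simp only [skewOf, conjTranspose_sub, ← smul_sub]
  congr 1
  abel

lemma hermOf_sub (k l : Matrix b b ℂ) : hermOf (k - l) = hermOf k - hermOf l := by
  simp only [hermOf, conjTranspose_sub, ← smul_sub]
  congr 1
  abel

lemma hermOf_one : hermOf (1 : Matrix b b ℂ) = 1 := by
  rw [hermOf, conjTranspose_one, ← two_smul ℝ, smul_smul]
  norm_num

lemma skewOf_one : skewOf (1 : Matrix b b ℂ) = 0 := by simp [skewOf]

/-- `(k + kᴴ)² - (k - kᴴ)² = 2 (k kᴴ + kᴴ k) = 4`. So the Hermitian part of a unitary matrix depends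
on the anti-Hermitian part only to second order. -/
lemma hermOf_sq {k : Matrix b b ℂ} (hk : k * kᴴ = 1) :
    hermOf k * hermOf k = 1 + skewOf k * skewOf k := by
  have hk' : kᴴ * k = 1 := mul_eq_one_comm.1 hk
  simp only [hermOf, skewOf, Matrix.smul_mul, Matrix.mul_smul, Matrix.add_mul, Matrix.mul_add,
    Matrix.sub_mul, Matrix.mul_sub, hk, hk']
  module

lemma norm_sq_sub_sq_le {x y : Matrix b b ℂ} {ε : ℝ} (hx : ‖x‖ ≤ ε) (hy : ‖y‖ ≤ ε) :
    ‖x * x - y * y‖ ≤ 2 * ε * ‖x - y‖ := by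
  have : x * x - y * y = x * (x - y) + (x - y) * y := by noncomm_ring
  rw [this]
  calc ‖x * (x - y) + (x - y) * y‖ ≤ ‖x‖ * ‖x - y‖ + ‖x - y‖ * ‖y‖ :=
        (norm_add_le _ _).trans (add_le_add (frobenius_norm_mul _ _) (frobenius_norm_mul _ _))
    _ ≤ ε * ‖x - y‖ + ‖x - y‖ * ε := by gcongr
    _ = _ := by ring

variable {ε : ℝ} {k l : Matrix b b ℂ}

/-- With `k = H + A` and `l = H' + A'`, `2(H - H') = (A² - A'²) - ((H - 1)² - (H' - 1)²)`. Both
brackets are differences of squares of matrices of norm at most `ε`, and the one in `H` is absorbed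
on the left since `2 - 2ε ≥ 1`. -/
lemma norm_hermOf_sub_le (hε : ε ≤ 1 / 2) (hk : k * kᴴ = 1) (hl : l * lᴴ = 1)
    (hk1 : ‖k - 1‖ ≤ ε) (hl1 : ‖l - 1‖ ≤ ε) :
    ‖hermOf k - hermOf l‖ ≤ 2 * ε * ‖skewOf k - skewOf l‖ := by
  have e1 : ‖hermOf k - 1‖ ≤ ε := by
    rw [← hermOf_one, ← hermOf_sub]; exact (norm_hermOf_le _).trans hk1
  have e2 : ‖hermOf l - 1‖ ≤ ε := by
    rw [← hermOf_one, ← hermOf_sub]; exact (norm_hermOf_le _).trans hl1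
  have s1 : ‖skewOf k‖ ≤ ε := by
    have := (norm_skewOf_le (k - 1)).trans hk1
    rwa [skewOf_sub, skewOf_one, sub_zero] at this
  have s2 : ‖skewOf l‖ ≤ ε := by
    have := (norm_skewOf_le (l - 1)).trans hl1
    rwa [skewOf_sub, skewOf_one, sub_zero] at this
  have h1 := norm_sq_sub_sq_le e1 e2
  have h2 := norm_sq_sub_sq_le s1 s2
  have h3 : (2 : ℝ) • (hermOf k - hermOf l) = (skewOf k * skewOf k - skewOf l * skewOf l) -
      ((hermOf k - 1) * (hermOf k - 1) - (hermOf l - 1) * (hermOf l - 1)) := by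
    have p1 := hermOf_sq hk
    have p2 := hermOf_sq hl
    have p3 : skewOf k * skewOf k = hermOf k * hermOf k - 1 := by rw [p1]; abel
    have p4 : skewOf l * skewOf l = hermOf l * hermOf l - 1 := by rw [p2]; abel
    rw [p3, p4, two_smul]
    noncomm_ring
  have h4 : ‖(2 : ℝ) • (hermOf k - hermOf l)‖ ≤ 2 * ε * ‖skewOf k - skewOf l‖ +
      2 * ε * ‖hermOf k - hermOf l‖ := by
    rw [h3]
    refine (norm_sub_le _ _).trans (add_le_add h2 ?_)
    rwa [sub_sub_sub_cancel_right] at h1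
  rw [norm_smul, Real.norm_ofNat] at h4
  nlinarith [norm_nonneg (hermOf k - hermOf l)]

lemma norm_sub_le_skewOf (hε : ε ≤ 1 / 2) (hk : k * kᴴ = 1) (hl : l * lᴴ = 1)
    (hk1 : ‖k - 1‖ ≤ ε) (hl1 : ‖l - 1‖ ≤ ε) :
    ‖k - l‖ ≤ (1 + 2 * ε) * ‖skewOf k - skewOf l‖ := by
  have h1 := norm_hermOf_sub_le hε hk hl hk1 hl1
  have h2 : k - l = (hermOf k - hermOf l) + (skewOf k - skewOf l) := by
    rw [← hermOf_sub, ← skewOf_sub, hermOf_add_skewOf]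
  calc ‖k - l‖ ≤ ‖hermOf k - hermOf l‖ + ‖skewOf k - skewOf l‖ := by
        conv_lhs => rw [h2]
        exact norm_add_le _ _
    _ ≤ _ := by linarith

lemma norm_skewOf_sub_le : ‖skewOf k - skewOf l‖ ≤ ‖k - l‖ := by
  rw [← skewOf_sub]
  exact norm_skewOf_le _

/-- The error is the change of the Hermitian parts plus `(h - h')(k - 1) + h'(k - l)`. These
contribute `2ε`, `ε` and `2ε`; Hermitian and anti-Hermitian matrices are orthogonal, so each
increment is bounded by the norm of the sum. -/
lemma norm_polar_sub_le {h h' : Matrix b b ℂ} (hε0 : 0 ≤ ε) (hε : ε ≤ 1 / 2) (hk : k * kᴴ = 1)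
    (hl : l * lᴴ = 1) (hk1 : ‖k - 1‖ ≤ ε) (hl1 : ‖l - 1‖ ≤ ε) (hh : hᴴ = h) (hh' : h'ᴴ = h')
    (hn' : ‖h'‖ ≤ ε) :
    ‖((1 + h) * k - (1 + h') * l) - ((h + skewOf k) - (h' + skewOf l))‖ ≤
      5 * ε * ‖(h + skewOf k) - (h' + skewOf l)‖ := by
  have e0 : (h + skewOf k) - (h' + skewOf l) = (h - h') + (skewOf k - skewOf l) := by abel
  have e1 : ((1 + h) * k - (1 + h') * l) - ((h + skewOf k) - (h' + skewOf l)) =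
      (hermOf k - hermOf l) + ((h - h') * (k - 1) + h' * (k - l)) := by
    have p1 : k - skewOf k = hermOf k := by
      conv_lhs => rw [← hermOf_add_skewOf k]
      have : skewOf (hermOf k + skewOf k) = skewOf k := by rw [hermOf_add_skewOf]
      rw [this]; abel
    have p2 : l - skewOf l = hermOf l := by
      conv_lhs => rw [← hermOf_add_skewOf l]
      have : skewOf (hermOf l + skewOf l) = skewOf l := by rw [hermOf_add_skewOf]
      rw [this]; abel
    rw [← p1, ← p2]
    noncomm_ring
  have hs : (h - h')ᴴ = h - h' := by rw [conjTranspose_sub, hh, hh']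
  have hA : (skewOf k - skewOf l)ᴴ = -(skewOf k - skewOf l) := by
    rw [conjTranspose_sub, conjTranspose_skewOf, conjTranspose_skewOf]; abel
  obtain ⟨n1, n2⟩ := norm_le_of_herm_skew hs hA
  have b1 := norm_hermOf_sub_le hε hk hl hk1 hl1
  have b2 := norm_sub_le_skewOf hε hk hl hk1 hl1
  rw [e1, e0]
  have b3 : ‖(h - h') * (k - 1)‖ ≤ ‖h - h'‖ * ε :=
    (frobenius_norm_mul _ _).trans (by gcongr)
  have b4 : ‖h' * (k - l)‖ ≤ ε * ‖k - l‖ :=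
    (frobenius_norm_mul _ _).trans (by gcongr)
  have b5 := norm_add_le (hermOf k - hermOf l) ((h - h') * (k - 1) + h' * (k - l))
  have b6 := norm_add_le ((h - h') * (k - 1)) (h' * (k - l))
  set N := ‖h - h' + (skewOf k - skewOf l)‖
  set x := ‖skewOf k - skewOf l‖
  set y := ‖h - h'‖
  have hx : 0 ≤ x := norm_nonneg _
  have c1 : ε * ‖k - l‖ ≤ ε * ((1 + 2 * ε) * x) := by gcongr
  have c2 : ε * ((1 + 2 * ε) * x) ≤ ε * (2 * x) := by
    gcongr; linarith
  have c3 : ε * x ≤ ε * N := by gcongr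
  have c4 : y * ε ≤ N * ε := by gcongr
  linarith

lemma norm_sq_one_add_sub {h h' : Matrix b b ℂ} (hn : ‖h‖ ≤ ε) (hn' : ‖h'‖ ≤ ε) :
    ‖((1 + h) * (1 + h) - (1 + h') * (1 + h')) - (2 : ℝ) • (h - h')‖ ≤ 2 * ε * ‖h - h'‖ := by
  have : ((1 + h) * (1 + h) - (1 + h') * (1 + h')) - (2 : ℝ) • (h - h') = h * h - h' * h' := by
    rw [two_smul]
    noncomm_ring
  rw [this]
  exact norm_sq_sub_sq_le hn hn'

end NearIdentity

end

end BosonSector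

namespace BosonSector

noncomputable section

set_option linter.unusedSectionVars false

open scoped Matrix.Norms.Frobenius
open Module

/-! ### Volume comparison by almost isometric parametrizations -/

section Tube

variable {a b : Type*} [Fintype a] [Fintype b] [DecidableEq a] [DecidableEq b] {m : ℤ}
  {τ : Matrix b b ℂ}

/-- The unitary intertwiners. -/
def unitarySet (m : ℤ) (τ : Matrix b b ℂ) : Set (Matrix b b ℂ) :=
  {k | k ∈ intertwiners m τ τ ∧ k * kᴴ = 1}

/-- The unitary intertwiners near the identity. -/
def unitaryBall (m : ℤ) (τ : Matrix b b ℂ) (ε : ℝ) : Set (Matrix b b ℂ) :=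
  unitarySet m τ ∩ Metric.closedBall 1 ε

/-- The small elements of `hermPart`. -/
def hermBall (m : ℤ) (τ : Matrix b b ℂ) (ε : ℝ) : Set (Matrix b b ℂ) :=
  (hermPart m τ : Set (Matrix b b ℂ)) ∩ Metric.closedBall 0 ε

/-- The matrices `(1 + h) k` with `h` small Hermitian and `k ∈ S`. -/
def polarSet (m : ℤ) (τ : Matrix b b ℂ) (ε : ℝ) (S : Set (Matrix b b ℂ)) : Set (Matrix b b ℂ) :=
  (fun p : Matrix b b ℂ × Matrix b b ℂ => (1 + p.1) * p.2) '' (hermBall m τ ε ×ˢ S)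

/-- The volume of the group of unitary intertwiners. -/
def unitaryVol (m : ℤ) (τ : Matrix b b ℂ) : ENNReal :=
  μHE[finrank ℝ (skewPart m τ)] (unitarySet m τ)

instance properSpace_matrix : ProperSpace (Matrix a b ℂ) := FiniteDimensional.proper ℝ _

lemma continuous_matrix_mul {α : Type*} [TopologicalSpace α] {f : α → Matrix a b ℂ}
    {g : α → Matrix b b ℂ} (hf : Continuous f) (hg : Continuous g) :
    Continuous fun x => f x * g x := hf.matrix_mul hg

lemma isClosed_unitarySet : IsClosed (unitarySet m τ) := by
  refine IsClosed.inter ((intertwiners m τ τ).closed_of_finiteDimensional)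
    (isClosed_eq ?_ continuous_const)
  exact continuous_id.matrix_mul continuous_id.matrix_conjTranspose

lemma isCompact_unitarySet : IsCompact (unitarySet m τ) := by
  refine Metric.isCompact_of_isClosed_isBounded isClosed_unitarySet ?_
  refine (Metric.isBounded_closedBall (x := (0 : Matrix b b ℂ)) (r := ‖(1 : Matrix b b ℂ)‖)).subset ?_
  intro k hk
  rw [mem_closedBall_zero_iff]
  have := norm_mul_unitary (1 : Matrix b b ℂ) hk.2
  rw [Matrix.one_mul] at this
  exact this.le

lemma isCompact_unitaryBall (ε : ℝ) : IsCompact (unitaryBall m τ ε) :=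
  isCompact_unitarySet.inter_right Metric.isClosed_closedBall

lemma isCompact_hermBall (ε : ℝ) : IsCompact (hermBall m τ ε) :=
  (isCompact_closedBall 0 ε).inter_left (hermPart m τ).closed_of_finiteDimensional

lemma isCompact_polarSet (ε : ℝ) {S : Set (Matrix b b ℂ)} (hS : IsCompact S) :
    IsCompact (polarSet m τ ε S) := by
  refine ((isCompact_hermBall ε).prod hS).image ?_
  exact continuous_matrix_mul (continuous_const.add continuous_fst) continuous_snd

lemma skewOf_mem (hτ : IsRealStructure m τ) {k : Matrix b b ℂ} (hk : k ∈ intertwiners m τ τ) :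
    skewOf k ∈ skewPart m τ :=
  ⟨Submodule.smul_mem _ _ (sub_mem hk (intertwiners_star hτ hτ hk)), conjTranspose_skewOf k⟩

lemma continuous_skewOf : Continuous (skewOf : Matrix b b ℂ → Matrix b b ℂ) := by
  have h : Continuous fun k : Matrix b b ℂ => kᴴ := continuous_id.matrix_conjTranspose
  exact (continuous_id.sub h).const_smul (1 / 2 : ℝ)

lemma unitaryBall_norm {ε : ℝ} {k : Matrix b b ℂ} (hk : k ∈ unitaryBall m τ ε) : ‖k - 1‖ ≤ ε := by
  rw [← dist_eq_norm]; exact hk.2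

lemma hermBall_norm {ε : ℝ} {h : Matrix b b ℂ} (hh : h ∈ hermBall m τ ε) : ‖h‖ ≤ ε :=
  mem_closedBall_zero_iff.1 hh.2

variable {ε r : ℝ}

lemma unitaryBall_vol_le (hε : ε ≤ 1 / 2) (hr0 : 0 ≤ r) (hr : 1 + 5 * ε ≤ r) (hε0 : 0 < ε) (d : ℕ) :
    μHE[d] (unitaryBall m τ ε) ≤ ENNReal.ofReal (r ^ d) * μHE[d] (skewOf '' unitaryBall m τ ε) := by
  have := euclideanHausdorffMeasure_range_le d (fun k : unitaryBall m τ ε => (k : Matrix b b ℂ))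
    (fun k : unitaryBall m τ ε => skewOf (k : Matrix b b ℂ)) r hr0 (fun k l => by
      rw [dist_eq_norm, dist_eq_norm]
      refine (norm_sub_le_skewOf hε k.2.1.2 l.2.1.2 (unitaryBall_norm k.2)
        (unitaryBall_norm l.2)).trans ?_
      gcongr
      linarith)
  rwa [Subtype.range_coe, ← Set.image_eq_range] at this

lemma skewOf_unitaryBall_vol_le (hr : 1 ≤ r) (d : ℕ) :
    μHE[d] (skewOf '' unitaryBall m τ ε) ≤ ENNReal.ofReal (r ^ d) * μHE[d] (unitaryBall m τ ε) := by
  have := euclideanHausdorffMeasure_range_le d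
    (fun k : unitaryBall m τ ε => skewOf (k : Matrix b b ℂ))
    (fun k : unitaryBall m τ ε => (k : Matrix b b ℂ)) r (by linarith) (fun k l => by
      rw [dist_eq_norm, dist_eq_norm]
      refine norm_skewOf_sub_le.trans ?_
      exact le_mul_of_one_le_left (norm_nonneg _) hr)
  rwa [Subtype.range_coe, ← Set.image_eq_range] at this

/-- The sums of small Hermitian matrices and of anti-Hermitian parts of unitary matrices. -/
def sumSet (m : ℤ) (τ : Matrix b b ℂ) (ε : ℝ) : Set (Matrix b b ℂ) :=
  (fun p : Matrix b b ℂ × Matrix b b ℂ => p.1 + skewOf p.2) ''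
    (hermBall m τ ε ×ˢ unitaryBall m τ ε)

/-- Both sets are parametrized by the pairs `(h, k)`, and increments of the two parametrizations
differ by at most `5ε` relative to the linear one. -/
lemma polarSet_vol_le (hε : ε ≤ 1 / 2) (hr0 : 0 ≤ r) (hr : 1 + 5 * ε ≤ r) (hε0 : 0 < ε) (d : ℕ) :
    μHE[d] (polarSet m τ ε (unitaryBall m τ ε)) ≤
      ENNReal.ofReal (r ^ d) * μHE[d] (sumSet m τ ε) := by
  have := euclideanHausdorffMeasure_range_le d
    (fun p : (hermBall m τ ε ×ˢ unitaryBall m τ ε : Set (Matrix b b ℂ × Matrix b b ℂ)) =>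
      (1 + p.1.1) * p.1.2)
    (fun p => p.1.1 + skewOf p.1.2) r hr0 (fun p q => by
      rw [dist_eq_norm, dist_eq_norm]
      have h1 := norm_polar_sub_le hε0.le hε p.2.2.1.2 q.2.2.1.2 (unitaryBall_norm p.2.2)
        (unitaryBall_norm q.2.2) p.2.1.1.2 q.2.1.1.2 (hermBall_norm q.2.1)
      set x := (1 + p.1.1) * p.1.2 - (1 + q.1.1) * q.1.2
      set y := p.1.1 + skewOf p.1.2 - (q.1.1 + skewOf q.1.2)
      calc ‖x‖ = ‖y + (x - y)‖ := by rw [add_sub_cancel]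
        _ ≤ ‖y‖ + ‖x - y‖ := norm_add_le _ _
        _ ≤ ‖y‖ + 5 * ε * ‖y‖ := by gcongr
        _ = (1 + 5 * ε) * ‖y‖ := by ring
        _ ≤ r * ‖y‖ := by gcongr)
  rwa [← Set.image_eq_range (fun p : Matrix b b ℂ × Matrix b b ℂ => (1 + p.1) * p.2),
    ← Set.image_eq_range (fun p : Matrix b b ℂ × Matrix b b ℂ => p.1 + skewOf p.2)] at this

/-- The reverse comparison: the same error bound is moved to the side of the linear increment,
leaving the factor `1 - 5ε` there. -/
lemma sumSet_vol_le (hε : ε ≤ 1 / 2) (hr0 : 0 ≤ r) (hr : 1 ≤ r * (1 - 5 * ε)) (hε0 : 0 < ε)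
    (d : ℕ) :
    μHE[d] (sumSet m τ ε) ≤
      ENNReal.ofReal (r ^ d) * μHE[d] (polarSet m τ ε (unitaryBall m τ ε)) := by
  have := euclideanHausdorffMeasure_range_le d
    (fun p : (hermBall m τ ε ×ˢ unitaryBall m τ ε : Set (Matrix b b ℂ × Matrix b b ℂ)) =>
      p.1.1 + skewOf p.1.2)
    (fun p => (1 + p.1.1) * p.1.2) r hr0 (fun p q => by
      rw [dist_eq_norm, dist_eq_norm]
      have h1 := norm_polar_sub_le hε0.le hε p.2.2.1.2 q.2.2.1.2 (unitaryBall_norm p.2.2)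
        (unitaryBall_norm q.2.2) p.2.1.1.2 q.2.1.1.2 (hermBall_norm q.2.1)
      set x := (1 + p.1.1) * p.1.2 - (1 + q.1.1) * q.1.2
      set y := p.1.1 + skewOf p.1.2 - (q.1.1 + skewOf q.1.2)
      have h2 : ‖y‖ ≤ ‖x‖ + 5 * ε * ‖y‖ := by
        calc ‖y‖ = ‖x - (x - y)‖ := by rw [sub_sub_cancel]
          _ ≤ ‖x‖ + ‖x - y‖ := norm_sub_le _ _
          _ ≤ ‖x‖ + 5 * ε * ‖y‖ := by gcongr
      calc ‖y‖ ≤ r * (1 - 5 * ε) * ‖y‖ := le_mul_of_one_le_left (norm_nonneg _) hr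
        _ = r * (‖y‖ - 5 * ε * ‖y‖) := by ring
        _ ≤ r * ‖x‖ := by gcongr; linarith)
  rwa [← Set.image_eq_range (fun p : Matrix b b ℂ × Matrix b b ℂ => p.1 + skewOf p.2),
    ← Set.image_eq_range (fun p : Matrix b b ℂ × Matrix b b ℂ => (1 + p.1) * p.2)] at this

/-- The squares of the matrices `1 + h`. -/
def squareSet (m : ℤ) (τ : Matrix b b ℂ) (ε : ℝ) : Set (Matrix b b ℂ) :=
  (fun h => (1 + h) * (1 + h)) '' hermBall m τ ε

lemma squareSet_vol_le (hε0 : 0 < ε) (hr : 1 + 5 * ε ≤ r) (d : ℕ) :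
    μHE[d] (squareSet m τ ε) ≤ ENNReal.ofReal ((2 * r) ^ d) * μHE[d] (hermBall m τ ε) := by
  have := euclideanHausdorffMeasure_range_le d
    (fun h : hermBall m τ ε => (1 + (h : Matrix b b ℂ)) * (1 + (h : Matrix b b ℂ)))
    (fun h => (h : Matrix b b ℂ)) (2 * r) (by linarith) (fun p q => by
      rw [dist_eq_norm, dist_eq_norm]
      have h1 := norm_sq_one_add_sub (hermBall_norm p.2) (hermBall_norm q.2)
      have h2 := norm_le_norm_add_norm_sub' ((1 + (p : Matrix b b ℂ)) * (1 + (p : Matrix b b ℂ)) -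
        (1 + (q : Matrix b b ℂ)) * (1 + (q : Matrix b b ℂ)))
        ((2 : ℝ) • ((p : Matrix b b ℂ) - (q : Matrix b b ℂ)))
      rw [norm_smul, Real.norm_ofNat] at h2
      nlinarith [norm_nonneg ((p : Matrix b b ℂ) - (q : Matrix b b ℂ))])
  rwa [Subtype.range_coe, ← Set.image_eq_range (fun h : Matrix b b ℂ => (1 + h) * (1 + h))] at this

lemma hermBall_vol_le (hε0 : 0 < ε) (hr0 : 0 ≤ r) (hr : 1 ≤ r * (1 - 5 * ε)) (d : ℕ) :
    μHE[d] (hermBall m τ ε) ≤ ENNReal.ofReal ((r / 2) ^ d) * μHE[d] (squareSet m τ ε) := by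
  have := euclideanHausdorffMeasure_range_le d (fun h : hermBall m τ ε => (h : Matrix b b ℂ))
    (fun h => (1 + (h : Matrix b b ℂ)) * (1 + (h : Matrix b b ℂ))) (r / 2) (by linarith)
    (fun p q => by
      rw [dist_eq_norm, dist_eq_norm]
      have h1 := norm_sq_one_add_sub (hermBall_norm p.2) (hermBall_norm q.2)
      have h2 := norm_le_norm_add_norm_sub ((1 + (p : Matrix b b ℂ)) * (1 + (p : Matrix b b ℂ)) -
        (1 + (q : Matrix b b ℂ)) * (1 + (q : Matrix b b ℂ)))
        ((2 : ℝ) • ((p : Matrix b b ℂ) - (q : Matrix b b ℂ)))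
      rw [norm_smul, Real.norm_ofNat] at h2
      set y := ‖(p : Matrix b b ℂ) - (q : Matrix b b ℂ)‖
      set x := ‖(1 + (p : Matrix b b ℂ)) * (1 + (p : Matrix b b ℂ)) -
        (1 + (q : Matrix b b ℂ)) * (1 + (q : Matrix b b ℂ))‖
      have hy : 0 ≤ y := norm_nonneg _
      have h3 : 2 * (1 - ε) * y ≤ x := by linarith
      have h4 : y ≤ r * (1 - 5 * ε) * y := le_mul_of_one_le_left hy hr
      have h5 : r * (2 * (1 - ε) * y) ≤ r * x := by gcongr
      have h6 : 0 ≤ r * (ε * y) := by positivity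
      nlinarith)
  rwa [Subtype.range_coe, ← Set.image_eq_range (fun h : Matrix b b ℂ => (1 + h) * (1 + h))] at this

end Tube

end

end BosonSector

namespace BosonSector

noncomputable section

set_option linter.unusedSectionVars false

open scoped Matrix.Norms.Frobenius
open Module

/-! ### The volume of the unitary group -/

section TubeVolume

variable {a b : Type*} [Fintype a] [Fintype b] [DecidableEq a] [DecidableEq b] {m : ℤ}
  {τ : Matrix b b ℂ} {ε r : ℝ}

lemma isCompact_sumSet : IsCompact (sumSet m τ ε) := by
  refine ((isCompact_hermBall ε).prod (isCompact_unitaryBall ε)).image ?_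
  exact continuous_fst.add (continuous_skewOf.comp continuous_snd)

lemma isCompact_squareSet : IsCompact (squareSet m τ ε) := by
  refine (isCompact_hermBall ε).image ?_
  exact continuous_matrix_mul (continuous_const.add continuous_id) (continuous_const.add continuous_id)

lemma polarSet_subset {S : Set (Matrix b b ℂ)}
    (hS : S ⊆ unitarySet m τ) : polarSet m τ ε S ⊆ intertwiners m τ τ := by
  rintro _ ⟨⟨h, k⟩, ⟨hh, hk⟩, rfl⟩
  exact intertwiners_mul (add_mem one_mem_intertwiners hh.1.1) (hS hk).1

lemma sumSet_subset (hτ : IsRealStructure m τ) : sumSet m τ ε ⊆ intertwiners m τ τ := by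
  rintro _ ⟨⟨h, k⟩, ⟨hh, hk⟩, rfl⟩
  exact add_mem hh.1.1 (skewOf_mem hτ hk.1.1).1

/-- The intertwiners are the orthogonal sum of their Hermitian and anti-Hermitian parts, and in this
decomposition the set is a product. -/
lemma subVol_sumSet (hτ : IsRealStructure m τ) :
    subVol (intertwiners m τ τ) (sumSet m τ ε) =
      subVol (hermPart m τ) (hermBall m τ ε) *
        subVol (skewPart m τ) (skewOf '' unitaryBall m τ ε) := by
  have h1 := map_add_prod_subVol (hermPart m τ) (skewPart m τ)
    (fun x hx y hy => norm_add_sq_of_herm_skew hx.2 hy.2)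
  rw [sup_hermPart_skewPart hτ] at h1
  rw [← h1, Measure.map_apply (by fun_prop) isCompact_sumSet.isClosed.measurableSet,
    ← Measure.prod_prod]
  apply measure_congr
  filter_upwards [Measure.quasiMeasurePreserving_fst.ae (ae_mem_subVol (hermPart m τ)),
    Measure.quasiMeasurePreserving_snd.ae (ae_mem_subVol (skewPart m τ))] with p hp1 hp2
  refine propext ⟨?_, ?_⟩
  · rintro ⟨⟨h, k⟩, ⟨hh, hk⟩, heq⟩
    have heq' : h + skewOf k = p.1 + p.2 := heq
    have e1 : (h - p.1)ᴴ = h - p.1 := by rw [conjTranspose_sub, hh.1.2, hp1.2]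
    have e2 : (skewOf k - p.2)ᴴ = -(skewOf k - p.2) := by
      rw [conjTranspose_sub, conjTranspose_skewOf, hp2.2]; abel
    have e3 : (h - p.1) + (skewOf k - p.2) = 0 := by
      rw [sub_add_sub_comm, heq', sub_self]
    have e4 := norm_le_of_herm_skew e1 e2
    rw [e3, norm_zero] at e4
    have e5 : h = p.1 := sub_eq_zero.1 (norm_le_zero_iff.1 e4.1)
    have e6 : skewOf k = p.2 := sub_eq_zero.1 (norm_le_zero_iff.1 e4.2)
    exact ⟨e5 ▸ hh, ⟨k, hk, e6⟩⟩
  · rintro ⟨h1, ⟨k, hk, h2⟩⟩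
    refine ⟨(p.1, k), ⟨h1, hk⟩, ?_⟩
    show p.1 + skewOf k = p.1 + p.2
    rw [h2]

lemma posDef_of_mem_hermBall (hε : ε < 1) {h : Matrix b b ℂ} (hh : h ∈ hermBall m τ ε) :
    (1 + h).PosDef := posDef_one_add hh.1.2 ((hermBall_norm hh).trans_lt hε)

lemma isUnit_det_of_mem_hermBall (hε : ε < 1) {h : Matrix b b ℂ} (hh : h ∈ hermBall m τ ε) :
    IsUnit (1 + h).det :=
  (isUnit_iff_isUnit_det _).1 (posDef_of_mem_hermBall hε hh).isUnit

lemma squareSet_subset (hτ : IsRealStructure m τ) (hε : ε < 1) :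
    squareSet m τ ε ⊆ posSet m τ := by
  rintro _ ⟨h, hh, rfl⟩
  have hs : (1 + h)ᴴ = 1 + h := (posDef_of_mem_hermBall hε hh).1
  have h1 : (1 : Matrix b b ℂ) ∈ posSet m τ :=
    ⟨⟨one_mem_intertwiners, by simp⟩, PosDef.one⟩
  have h2 := conj_mem_posSet hτ (add_mem one_mem_intertwiners hh.1.1)
    (isUnit_det_of_mem_hermBall hε hh).ne_zero h1
  rwa [Matrix.mul_one, hs] at h2

/-- This is the polar decomposition: `1 + h` is a Hermitian square root of `M Mᴴ`, and `(1 + h)⁻¹ M`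
is unitary. -/
lemma mem_polarSet_iff (hε : ε < 1) {M : Matrix b b ℂ}
    (hM : M ∈ intertwiners m τ τ) :
    M ∈ polarSet m τ ε (unitarySet m τ) ↔ M * Mᴴ ∈ squareSet m τ ε := by
  constructor
  · rintro ⟨⟨h, k⟩, ⟨hh, hk⟩, rfl⟩
    refine ⟨h, hh, ?_⟩
    have hs : (1 + h)ᴴ = 1 + h := (posDef_of_mem_hermBall hε hh).1
    have : k * kᴴ = 1 := hk.2
    show (1 + h) * (1 + h) = (1 + h) * k * ((1 + h) * k)ᴴ
    rw [conjTranspose_mul, Matrix.mul_assoc, ← Matrix.mul_assoc k, this, Matrix.one_mul, hs]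
  · rintro ⟨h, hh, heq⟩
    have heq' : (1 + h) * (1 + h) = M * Mᴴ := heq
    have hs : (1 + h)ᴴ = 1 + h := (posDef_of_mem_hermBall hε hh).1
    have hu := isUnit_det_of_mem_hermBall hε hh
    have hA : 1 + h ∈ intertwiners m τ τ := add_mem one_mem_intertwiners hh.1.1
    refine ⟨(h, (1 + h)⁻¹ * M), ⟨hh, intertwiners_mul (intertwiners_inv hA hu.ne_zero) hM, ?_⟩, ?_⟩
    · rw [conjTranspose_mul, conjTranspose_nonsing_inv, hs, Matrix.mul_assoc,
        ← Matrix.mul_assoc M, ← heq', Matrix.mul_assoc (1 + h), mul_nonsing_inv _ hu,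
        Matrix.mul_one, nonsing_inv_mul _ hu]
    · show (1 + h) * ((1 + h)⁻¹ * M) = M
      rw [← Matrix.mul_assoc, mul_nonsing_inv _ hu, Matrix.one_mul]

/-- The products determine `(1 + h)²`, and squaring is injective near 1 because it is a perturbation
of `2h` with relative error at most `ε < 1`. -/
lemma polar_unique (hε : ε < 1) {h h' k k' : Matrix b b ℂ}
    (hh : h ∈ hermBall m τ ε) (hh' : h' ∈ hermBall m τ ε) (hk : k * kᴴ = 1) (hk' : k' * k'ᴴ = 1)
    (heq : (1 + h) * k = (1 + h') * k') : k = k' := by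
  have hs : (1 + h)ᴴ = 1 + h := (posDef_of_mem_hermBall hε hh).1
  have hs' : (1 + h')ᴴ = 1 + h' := (posDef_of_mem_hermBall hε hh').1
  have h1 : (1 + h) * (1 + h) = (1 + h') * (1 + h') := by
    have := congrArg (fun M => M * Mᴴ) heq
    simp only [conjTranspose_mul] at this
    rwa [Matrix.mul_assoc, ← Matrix.mul_assoc k, hk, Matrix.one_mul, hs,
      Matrix.mul_assoc, ← Matrix.mul_assoc k', hk', Matrix.one_mul, hs'] at this
  have h2 := norm_sq_one_add_sub (hermBall_norm hh) (hermBall_norm hh')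
  rw [h1, sub_self, zero_sub, norm_neg, norm_smul, Real.norm_ofNat] at h2
  have h3 : ‖h - h'‖ = 0 := by nlinarith [norm_nonneg (h - h')]
  have h4 : h = h' := sub_eq_zero.1 (norm_eq_zero.1 h3)
  subst h4
  have := congrArg (fun M => (1 + h)⁻¹ * M) heq
  simpa only [← Matrix.mul_assoc, nonsing_inv_mul _ (isUnit_det_of_mem_hermBall hε hh),
    Matrix.one_mul] using this

/-- Right multiplication by a unitary matrix. -/
def mulRightIsometry {k : Matrix b b ℂ} (hk : k * kᴴ = 1) : Matrix a b ℂ ≃ᵢ Matrix a b ℂ where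
  toFun X := X * k
  invFun X := X * kᴴ
  left_inv X := by simp [Matrix.mul_assoc, hk]
  right_inv X := by simp [Matrix.mul_assoc, mul_eq_one_comm.1 hk]
  isometry_toFun := Isometry.of_dist_eq fun X Y => by
    rw [dist_eq_norm, dist_eq_norm, ← Matrix.sub_mul, norm_mul_unitary _ hk]

/-- The conjugate transpose. -/
def starIsometry : Matrix a b ℂ ≃ᵢ Matrix b a ℂ where
  toFun X := Xᴴ
  invFun X := Xᴴ
  left_inv X := by simp
  right_inv X := by simp
  isometry_toFun := Isometry.of_dist_eq fun X Y => by
    rw [dist_eq_norm, dist_eq_norm, ← conjTranspose_sub, frobenius_norm_conjTranspose]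

lemma unitarySet_star_mul (hτ : IsRealStructure m τ) {k : Matrix b b ℂ}
    (hk : k ∈ unitarySet m τ) : kᴴ ∈ unitarySet m τ :=
  ⟨intertwiners_star hτ hτ hk.1, by
    rw [conjTranspose_conjTranspose]; exact mul_eq_one_comm.1 hk.2⟩

lemma unitarySet_mul {k l : Matrix b b ℂ}
    (hk : k ∈ unitarySet m τ) (hl : l ∈ unitarySet m τ) : k * l ∈ unitarySet m τ :=
  ⟨intertwiners_mul hk.1 hl.1, by
    rw [conjTranspose_mul, Matrix.mul_assoc, ← Matrix.mul_assoc l, hl.2, Matrix.one_mul, hk.2]⟩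

lemma exists_finite_cover (hτ : IsRealStructure m τ) (hε : 0 < ε) :
    ∃ t : Finset (Matrix b b ℂ), (∀ l ∈ t, l ∈ unitarySet m τ) ∧
      ∀ k ∈ unitarySet m τ, ∃ l ∈ t, k * lᴴ ∈ unitaryBall m τ ε := by
  obtain ⟨t, ht, hc⟩ := (isCompact_unitarySet (m := m) (τ := τ)).elim_nhds_subcover
    (fun l => Metric.ball l ε) (fun l _ => Metric.ball_mem_nhds l hε)
  refine ⟨t, ht, fun k hk => ?_⟩
  obtain ⟨l, hl, hkl⟩ := Set.mem_iUnion₂.1 (hc hk)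
  refine ⟨l, hl, unitarySet_mul hk (unitarySet_star_mul hτ (ht l hl)), ?_⟩
  have hl' : lᴴ * lᴴᴴ = 1 := (unitarySet_star_mul hτ (ht l hl)).2
  have h1 : k * lᴴ - 1 = (k - l) * lᴴ := by rw [Matrix.sub_mul, (ht l hl).2]
  rw [Metric.mem_closedBall, dist_eq_norm, h1, norm_mul_unitary _ hl', ← dist_eq_norm]
  exact (Metric.mem_ball.1 hkl).le

lemma measure_preimage_mulRight (d : ℕ) {k : Matrix b b ℂ} (hk : k * kᴴ = 1)
    {S : Set (Matrix a b ℂ)} (hS : MeasurableSet S) :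
    μHE[d] {X : Matrix a b ℂ | X * k ∈ S} = μHE[d] S :=
  ((mulRightIsometry hk).measurePreserving_euclideanHausdorffMeasure d).measure_preimage
    hS.nullMeasurableSet

lemma measure_preimage_star (d : ℕ) {S : Set (Matrix a b ℂ)} (hS : MeasurableSet S) :
    μHE[d] {X : Matrix b a ℂ | Xᴴ ∈ S} = μHE[d] S :=
  (starIsometry.measurePreserving_euclideanHausdorffMeasure d).measure_preimage
    hS.nullMeasurableSet

lemma measure_preimage_mul_star (d : ℕ) {k : Matrix b b ℂ} (hk : k * kᴴ = 1)
    {S : Set (Matrix b b ℂ)} (hS : MeasurableSet S) :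
    μHE[d] {X : Matrix b b ℂ | k * Xᴴ ∈ S} = μHE[d] S := by
  have hm : Measurable fun X : Matrix b b ℂ => Xᴴ :=
    (continuous_id.matrix_conjTranspose).measurable
  have hk' : kᴴ * kᴴᴴ = 1 := by
    rw [conjTranspose_conjTranspose]; exact mul_eq_one_comm.1 hk
  have h1 := measure_preimage_mulRight d hk' (hm hS)
  have h2 := measure_preimage_star d hS
  refine Eq.trans ?_ (h1.trans h2)
  congr 1
  ext X
  simp [conjTranspose_mul]

lemma skewOf_unitaryBall_subset (hτ : IsRealStructure m τ) :
    skewOf '' unitaryBall m τ ε ⊆ skewPart m τ := by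
  rintro _ ⟨k, hk, rfl⟩
  exact skewOf_mem hτ hk.1.1

lemma skewOf_unitaryBall_lt_top (hτ : IsRealStructure m τ) :
    μHE[finrank ℝ (skewPart m τ)] (skewOf '' unitaryBall m τ ε) < ⊤ := by
  rw [← subVol_of_le _ (skewOf_unitaryBall_subset hτ)]
  exact subVol_lt_top _ (((isCompact_unitaryBall ε).image continuous_skewOf).isBounded)

/-- By compactness finitely many translates of a ball around 1 cover the group, and this ball is a
Lipschitz image of a bounded subset of `skewPart`. -/
lemma unitaryVol_lt_top (hτ : IsRealStructure m τ) : unitaryVol m τ < ⊤ := by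
  obtain ⟨t, ht, hc⟩ := exists_finite_cover (τ := τ) hτ (ε := 1 / 2) (by norm_num)
  have h1 : μHE[finrank ℝ (skewPart m τ)] (unitaryBall m τ (1 / 2)) < ⊤ :=
    (unitaryBall_vol_le le_rfl (r := 4) (by norm_num) (by norm_num) (by norm_num) _).trans_lt
      (ENNReal.mul_lt_top ENNReal.ofReal_lt_top (skewOf_unitaryBall_lt_top hτ))
  have h2 : unitarySet m τ ⊆
      ⋃ l ∈ t, {X : Matrix b b ℂ | X * lᴴ ∈ unitaryBall m τ (1 / 2)} := by
    intro k hk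
    obtain ⟨l, hl, h⟩ := hc k hk
    exact Set.mem_iUnion₂.2 ⟨l, hl, h⟩
  refine (measure_mono h2).trans_lt ((measure_biUnion_finset_le _ _).trans_lt ?_)
  refine ENNReal.sum_lt_top.2 fun l hl => ?_
  rwa [measure_preimage_mulRight _ (unitarySet_star_mul hτ (ht l hl)).2
    (isCompact_unitaryBall _).isClosed.measurableSet]

lemma subVol_preimage_mulRight (hτ : IsRealStructure m τ) {k : Matrix b b ℂ}
    (hk : k ∈ unitarySet m τ)
    {S : Set (Matrix b b ℂ)} (hS : MeasurableSet S) (hSA : S ⊆ intertwiners m τ τ) :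
    subVol (intertwiners m τ τ) {X : Matrix b b ℂ | X * k ∈ S} =
      subVol (intertwiners m τ τ) S := by
  rw [subVol_of_le _ hSA, subVol_of_le, measure_preimage_mulRight _ hk.2 hS]
  intro X hX
  have h1 := intertwiners_mul (hSA hX) (unitarySet_star_mul hτ hk).1
  rwa [Matrix.mul_assoc, hk.2, Matrix.mul_one] at h1

/-- The passage from a neighbourhood of 1 to the whole group: the tube over a subset of the group
has volume proportional to the subset. It avoids charts at other points. -/
lemma polarSet_mul_unitaryVol (hτ : IsRealStructure m τ) (hε : ε < 1) :
    subVol (intertwiners m τ τ) (polarSet m τ ε (unitaryBall m τ ε)) * unitaryVol m τ =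
      subVol (intertwiners m τ τ) (polarSet m τ ε (unitarySet m τ)) *
        μHE[finrank ℝ (skewPart m τ)] (unitaryBall m τ ε) := by
  set μ := subVol (intertwiners m τ τ)
  set d := finrank ℝ (skewPart m τ)
  set YS := polarSet m τ ε (unitaryBall m τ ε) with hYS
  set YK := polarSet m τ ε (unitarySet m τ) with hYK
  have hSK : unitaryBall m τ ε ⊆ unitarySet m τ := Set.inter_subset_left
  have hYSK : YS ⊆ YK := Set.image_mono (Set.prod_mono le_rfl hSK)
  have mYS : MeasurableSet YS := (isCompact_polarSet ε (isCompact_unitaryBall ε)).isClosed.measurableSet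
  have mYK : MeasurableSet YK := (isCompact_polarSet ε isCompact_unitarySet).isClosed.measurableSet
  have mK : MeasurableSet (unitarySet m τ) := isClosed_unitarySet.measurableSet
  have mS : MeasurableSet (unitaryBall m τ ε) := (isCompact_unitaryBall ε).isClosed.measurableSet
  let κ := (μHE[d] : Measure (Matrix b b ℂ)).restrict (unitarySet m τ)
  have : IsFiniteMeasure κ := ⟨by
    rw [Measure.restrict_apply_univ]; exact unitaryVol_lt_top hτ⟩
  -- The measure of `E` is computed in both orders. For fixed `X = (1 + h) k` the slice is `{l : k
  -- lᴴ` is close to `1}`, a translate of the inverse ball; for fixed `l` it is a translate of the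
  -- small tube.
  let E : Set (Matrix b b ℂ × Matrix b b ℂ) := {p | p.1 * p.2ᴴ ∈ YS}
  have mE : MeasurableSet E := by
    have : Measurable fun p : Matrix b b ℂ × Matrix b b ℂ => p.1 * p.2ᴴ := by fun_prop
    exact this mYS
  have h1 : ((μ.restrict YK).prod κ) E = μ YK * μHE[d] (unitaryBall m τ ε) := by
    rw [Measure.prod_apply mE]
    have : ∀ X ∈ YK, κ (Prod.mk X ⁻¹' E) = μHE[d] (unitaryBall m τ ε) := by
      rintro _ ⟨⟨h, k⟩, ⟨hh, hk⟩, rfl⟩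
      rw [← measure_preimage_mul_star d hk.2 mS, Measure.restrict_apply (measurable_prodMk_left mE)]
      congr 1
      ext l
      constructor
      · rintro ⟨⟨⟨h', k'⟩, ⟨hh', hk'⟩, heq⟩, hl⟩
        have heq' : (1 + h') * k' = (1 + h) * (k * lᴴ) := by rw [← Matrix.mul_assoc]; exact heq
        have := polar_unique hε hh' hh hk'.1.2
          (unitarySet_mul hk (unitarySet_star_mul hτ hl)).2 heq'
        show k * lᴴ ∈ unitaryBall m τ ε
        rw [← this]
        exact hk'
      · intro hl
        have hl' : k * lᴴ ∈ unitaryBall m τ ε := hl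
        refine ⟨⟨(h, k * lᴴ), ⟨hh, hl'⟩, (Matrix.mul_assoc _ _ _).symm⟩, ?_⟩
        have h2 := unitarySet_star_mul hτ (unitarySet_mul (unitarySet_star_mul hτ hk) hl'.1)
        rwa [← Matrix.mul_assoc, mul_eq_one_comm.1 hk.2, Matrix.one_mul,
          conjTranspose_conjTranspose] at h2
    rw [setLIntegral_congr_fun mYK this, setLIntegral_const, mul_comm]
  have h2 : ((μ.restrict YK).prod κ) E = μ YS * unitaryVol m τ := by
    rw [Measure.prod_apply_symm mE]
    have : ∀ l ∈ unitarySet m τ, (μ.restrict YK) ((fun X => (X, l)) ⁻¹' E) = μ YS := by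
      intro l hl
      have hl' := unitarySet_star_mul hτ hl
      rw [Measure.restrict_apply (measurable_prodMk_right mE),
        ← subVol_preimage_mulRight hτ hl' mYS (polarSet_subset hSK)]
      congr 1
      ext X
      refine ⟨fun h => h.1, fun h => ⟨h, ?_⟩⟩
      have h3 : X * lᴴ ∈ YS := h
      obtain ⟨⟨h', k'⟩, ⟨hh', hk'⟩, heq⟩ := h3
      refine ⟨(h', k' * l), ⟨hh', unitarySet_mul hk'.1 hl⟩, ?_⟩
      have heq' : (1 + h') * k' = X * lᴴ := heq
      show (1 + h') * (k' * l) = X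
      rw [← Matrix.mul_assoc, heq', Matrix.mul_assoc, mul_eq_one_comm.1 hl.2, Matrix.mul_one]
    rw [setLIntegral_congr_fun mK this, setLIntegral_const]
    rfl
  rw [← h2, h1]

lemma subVol_polarSet (hε : ε < 1) :
    subVol (intertwiners m τ τ) (polarSet m τ ε (unitarySet m τ)) =
      gramVol m τ τ (squareSet m τ ε) := by
  rw [gramVol, Measure.map_apply (by fun_prop) isCompact_squareSet.isClosed.measurableSet]
  apply measure_congr
  filter_upwards [ae_mem_subVol (intertwiners m τ τ)] with M hM
  exact propext (mem_polarSet_iff hε hM)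

lemma subVol_polarSet_ne_zero (hτ : IsRealStructure m τ) (hε : 0 < ε)
    (h0 : subVol (intertwiners m τ τ) (polarSet m τ ε (unitarySet m τ)) ≠ 0) :
    subVol (intertwiners m τ τ) (polarSet m τ ε (unitaryBall m τ ε)) ≠ 0 := by
  intro h
  apply h0
  have hSK : unitaryBall m τ ε ⊆ unitarySet m τ := Set.inter_subset_left
  obtain ⟨t, ht, hc⟩ := exists_finite_cover (τ := τ) hτ hε
  have h2 : polarSet m τ ε (unitarySet m τ) ⊆
      ⋃ l ∈ t, {X : Matrix b b ℂ | X * lᴴ ∈ polarSet m τ ε (unitaryBall m τ ε)} := by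
    rintro _ ⟨⟨h, k⟩, ⟨hh, hk⟩, rfl⟩
    obtain ⟨l, hl, hkl⟩ := hc k hk
    exact Set.mem_iUnion₂.2 ⟨l, hl, ⟨(h, k * lᴴ), ⟨hh, hkl⟩, (Matrix.mul_assoc _ _ _).symm⟩⟩
  refine measure_mono_null h2 ((measure_biUnion_null_iff t.countable_toSet).2 fun l hl => ?_)
  rw [subVol_preimage_mulRight hτ (unitarySet_star_mul hτ (ht l hl))
    (isCompact_polarSet ε (isCompact_unitaryBall ε)).isClosed.measurableSet
    (polarSet_subset hSK), h]

lemma hermBall_vol_pos (hε : 0 < ε) : 0 < μHE[finrank ℝ (hermPart m τ)] (hermBall m τ ε) := by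
  have hle : hermBall m τ ε ⊆ hermPart m τ := Set.inter_subset_left
  rw [← subVol_of_le _ hle]
  have := subVol_pos (hermPart m τ) (U := Metric.ball 0 ε) Metric.isOpen_ball
    ⟨0, Metric.mem_ball_self hε, zero_mem _⟩
  refine this.trans_le ?_
  refine measure_mono_ae ?_
  filter_upwards [ae_mem_subVol (hermPart m τ)] with x hx hx'
  exact ⟨hx, Metric.ball_subset_closedBall hx'⟩

lemma setLIntegral_detDensity_bounds {μ : Measure (Matrix b b ℂ)} {S : Set (Matrix b b ℂ)}
    (hS : MeasurableSet S) {δ e : ℝ} (hδ : 0 < δ)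
    (h : ∀ x ∈ S, ‖x.det‖ ^ e ≤ δ ∧ 1 ≤ δ * ‖x.det‖ ^ e) :
    (μ.withDensity (detDensity e)) S ≤ ENNReal.ofReal δ * μ S ∧
      μ S ≤ ENNReal.ofReal δ * (μ.withDensity (detDensity e)) S := by
  rw [withDensity_apply _ hS]
  constructor
  · rw [← setLIntegral_const]
    exact setLIntegral_mono' hS fun x hx => ENNReal.ofReal_le_ofReal (h x hx).1
  · rw [← lintegral_const_mul _ (by fun_prop), ← setLIntegral_one]
    refine setLIntegral_mono' hS fun x hx => ?_
    rw [detDensity, ← ENNReal.ofReal_mul hδ.le, ← ENNReal.ofReal_one]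
    exact ENNReal.ofReal_le_ofReal (h x hx).2

lemma exists_det_bound (e : ℝ) {δ : ℝ} (hδ : 1 < δ) : ∃ ε₀ > 0, ∀ h : Matrix b b ℂ, ‖h‖ ≤ ε₀ →
    ‖((1 + h) * (1 + h)).det‖ ^ e ≤ δ ∧ 1 ≤ δ * ‖((1 + h) * (1 + h)).det‖ ^ e := by
  have hc : ContinuousAt (fun h : Matrix b b ℂ => ‖((1 + h) * (1 + h)).det‖ ^ e) 0 := by
    refine ContinuousAt.rpow_const ?_ (Or.inl (by simp))
    have : Continuous fun h : Matrix b b ℂ => (1 + h) * (1 + h) :=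
      continuous_matrix_mul (continuous_const.add continuous_id) (continuous_const.add continuous_id)
    exact (continuous_det'.comp this).norm.continuousAt
  have h1 : ∀ᶠ y in nhds ((fun h : Matrix b b ℂ => ‖((1 + h) * (1 + h)).det‖ ^ e) 0),
      y < δ ∧ δ⁻¹ < y := by
    have : (fun h : Matrix b b ℂ => ‖((1 + h) * (1 + h)).det‖ ^ e) 0 = 1 := by simp
    rw [this]
    exact (eventually_lt_nhds hδ).and (eventually_gt_nhds (inv_lt_one_of_one_lt₀ hδ))
  obtain ⟨ε₀, h0, h2⟩ := Metric.eventually_nhds_iff.1 (hc.eventually h1)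
  refine ⟨ε₀ / 2, by positivity, fun h hh => ?_⟩
  obtain ⟨h3, h4⟩ := h2 (y := h) (by rw [dist_zero_right]; linarith)
  have hδ0 : 0 < δ := by linarith
  exact ⟨h3.le, by rw [mul_comm]; exact ((inv_lt_iff_one_lt_mul₀ hδ0).1 h4).le⟩

/-- Meaning of the letters: `Y` and `Z` are the tubes over the small ball `σ` and over the whole
group `V`; `υ` is the anti-Hermitian image of `σ`; `β` is the Hermitian ball and `q` its image under
`(1 + h)²`; `P` is the power of 2 and `D` the distortion. -/
lemma tube_bounds_aux {Y Z V σ υ β q k D P : ENNReal} {nA nH nK : ℕ} (hY0 : Y ≠ 0) (hY : Y ≠ ⊤)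
    (hf : Y * V = Z * σ) (b1 : Y ≤ D ^ nA * (β * υ)) (b2 : β * υ ≤ D ^ nA * Y)
    (c1 : σ ≤ D ^ nK * υ) (c2 : υ ≤ D ^ nK * σ) (d1 : q ≤ P * D ^ nH * β)
    (d2 : P * β ≤ D ^ nH * q) (e1 : Z ≤ D * (k * q)) (e2 : k * q ≤ D * Z) :
    V ≤ k * P * D ^ (1 + nH + nK + nA) ∧ k * P ≤ V * D ^ (1 + nH + nK + nA) := by
  constructor
  · refine (ENNReal.mul_le_mul_iff_right hY0 hY).1 ?_
    calc Y * V = Z * σ := hf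
      _ ≤ (D * (k * (P * D ^ nH * β))) * (D ^ nK * υ) := by gcongr; exact e1.trans (by gcongr)
      _ = D * k * P * D ^ nH * D ^ nK * (β * υ) := by ring
      _ ≤ D * k * P * D ^ nH * D ^ nK * (D ^ nA * Y) := by gcongr
      _ = _ := by ring
  · refine (ENNReal.mul_le_mul_iff_right hY0 hY).1 ?_
    calc Y * (k * P) ≤ D ^ nA * (β * υ) * (k * P) := by gcongr
      _ ≤ D ^ nA * (β * (D ^ nK * σ)) * (k * P) := by gcongr
      _ = D ^ nA * D ^ nK * σ * k * (P * β) := by ring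
      _ ≤ D ^ nA * D ^ nK * σ * k * (D ^ nH * q) := by gcongr
      _ = D ^ nA * D ^ nK * D ^ nH * σ * (k * q) := by ring
      _ ≤ D ^ nA * D ^ nK * D ^ nH * σ * (D * Z) := by gcongr
      _ = D ^ nA * D ^ nK * D ^ nH * D * (Z * σ) := by ring
      _ = D ^ nA * D ^ nK * D ^ nH * D * (Y * V) := by rw [hf]
      _ = _ := by ring

lemma unitaryVol_bounds (hτ : IsRealStructure m τ) {k : ENNReal} {e : ℝ} (hk0 : k ≠ 0)
    (hk : gramVol m τ τ = k • (posVol m τ).withDensity (detDensity e)) {δ : ℝ} (hδ : 1 < δ) :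
    unitaryVol m τ ≤ k * 2 ^ finrank ℝ (hermPart m τ) * ENNReal.ofReal δ ^
      (1 + finrank ℝ (hermPart m τ) + finrank ℝ (skewPart m τ) +
        finrank ℝ (intertwiners m τ τ)) ∧
    k * 2 ^ finrank ℝ (hermPart m τ) ≤ unitaryVol m τ * ENNReal.ofReal δ ^
      (1 + finrank ℝ (hermPart m τ) + finrank ℝ (skewPart m τ) +
        finrank ℝ (intertwiners m τ τ)) := by
  obtain ⟨ε₀, h0, hdet⟩ := exists_det_bound (b := b) e hδ
  have hδ0 : 0 < δ := by linarith
  have hδ1 : 0 < 1 - δ⁻¹ := sub_pos.2 (inv_lt_one_of_one_lt₀ hδ)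
  -- The second bound means `1 ≤ δ (1 - 5ε)`, which also implies `1 + 5ε ≤ δ`; so one `δ` controls
  -- the distortion in both directions.
  obtain ⟨ε, hε0, hε1, hε2⟩ : ∃ ε > 0, ε ≤ ε₀ ∧ ε ≤ (1 - δ⁻¹) / 5 :=
    ⟨min ε₀ ((1 - δ⁻¹) / 5), by positivity, min_le_left _ _, min_le_right _ _⟩
  have hr2 : 1 ≤ δ * (1 - 5 * ε) := by
    have : δ⁻¹ ≤ 1 - 5 * ε := by linarith
    calc 1 = δ * δ⁻¹ := (mul_inv_cancel₀ hδ0.ne').symm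
      _ ≤ _ := by gcongr
  have hε5 : ε < 1 / 5 := by
    have : 0 < δ⁻¹ := by positivity
    linarith
  have hr1 : 1 + 5 * ε ≤ δ := by nlinarith [mul_pos hδ0 (mul_pos hε0 hε0)]
  have hε12 : ε ≤ 1 / 2 := by linarith
  have hε : ε < 1 := by linarith
  have hSK : unitaryBall m τ ε ⊆ unitarySet m τ := Set.inter_subset_left
  have hBH : hermBall m τ ε ⊆ hermPart m τ := Set.inter_subset_left
  have hb1 := polarSet_vol_le (m := m) (τ := τ) hε12 hδ0.le hr1 hε0
    (finrank ℝ (intertwiners m τ τ))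
  have hb2 := sumSet_vol_le (m := m) (τ := τ) hε12 hδ0.le hr2 hε0
    (finrank ℝ (intertwiners m τ τ))
  rw [← subVol_of_le _ (polarSet_subset hSK), ← subVol_of_le _ (sumSet_subset hτ),
    subVol_sumSet hτ, subVol_of_le _ hBH, subVol_of_le _ (skewOf_unitaryBall_subset hτ),
    ENNReal.ofReal_pow hδ0.le] at hb1 hb2
  have hc1 := unitaryBall_vol_le (m := m) (τ := τ) hε12 hδ0.le hr1 hε0
    (finrank ℝ (skewPart m τ))
  have hc2 := skewOf_unitaryBall_vol_le (m := m) (τ := τ) (ε := ε) hδ.le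
    (finrank ℝ (skewPart m τ))
  rw [ENNReal.ofReal_pow hδ0.le] at hc1 hc2
  have hd1 := squareSet_vol_le (m := m) (τ := τ) hε0 hr1 (finrank ℝ (hermPart m τ))
  have hd2 := hermBall_vol_le (m := m) (τ := τ) hε0 hδ0.le hr2 (finrank ℝ (hermPart m τ))
  rw [mul_pow, ENNReal.ofReal_mul (by positivity), ENNReal.ofReal_pow (by norm_num),
    ENNReal.ofReal_pow hδ0.le, ENNReal.ofReal_ofNat] at hd1
  have hd2' : 2 ^ finrank ℝ (hermPart m τ) * μHE[finrank ℝ (hermPart m τ)] (hermBall m τ ε) ≤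
      ENNReal.ofReal δ ^ finrank ℝ (hermPart m τ) *
        μHE[finrank ℝ (hermPart m τ)] (squareSet m τ ε) := by
    calc _ ≤ _ := mul_le_mul_right hd2 _
      _ = _ := by
        rw [← mul_assoc, ← ENNReal.ofReal_pow hδ0.le]
        congr 1
        have : (2 : ENNReal) ^ finrank ℝ (hermPart m τ) =
            ENNReal.ofReal (2 ^ finrank ℝ (hermPart m τ)) := by
          rw [ENNReal.ofReal_pow (by norm_num), ENNReal.ofReal_ofNat]
        rw [this, ← ENNReal.ofReal_mul (by positivity), ← mul_pow, mul_div_cancel₀ _ two_ne_zero]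
  have hmQ : MeasurableSet (squareSet m τ ε) := isCompact_squareSet.isClosed.measurableSet
  have hQ : posVol m τ (squareSet m τ ε) =
      μHE[finrank ℝ (hermPart m τ)] (squareSet m τ ε) := by
    rw [posVol, Measure.restrict_eq_self _ (squareSet_subset hτ hε),
      subVol_of_le _ ((squareSet_subset hτ hε).trans fun x hx => hx.1)]
  obtain ⟨he1, he2⟩ := setLIntegral_detDensity_bounds (μ := posVol m τ) hmQ (e := e) hδ0 (by
    rintro _ ⟨h, hh, rfl⟩
    exact hdet h ((hermBall_norm hh).trans hε1))
  rw [hQ] at he1 he2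
  have hZ := subVol_polarSet (m := m) (τ := τ) hε
  rw [hk, Measure.smul_apply, smul_eq_mul] at hZ
  have hZ1 : subVol (intertwiners m τ τ) (polarSet m τ ε (unitarySet m τ)) ≤
      ENNReal.ofReal δ * (k * μHE[finrank ℝ (hermPart m τ)] (squareSet m τ ε)) := by
    rw [hZ, mul_left_comm]
    gcongr
  have hZ2 : k * μHE[finrank ℝ (hermPart m τ)] (squareSet m τ ε) ≤
      ENNReal.ofReal δ * subVol (intertwiners m τ τ) (polarSet m τ ε (unitarySet m τ)) := by
    rw [hZ, mul_left_comm]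
    gcongr
  have hY0 : subVol (intertwiners m τ τ) (polarSet m τ ε (unitaryBall m τ ε)) ≠ 0 := by
    refine subVol_polarSet_ne_zero hτ hε0 fun h => ?_
    rw [h, mul_zero, nonpos_iff_eq_zero, mul_eq_zero] at hZ2
    have hq := hZ2.resolve_left hk0
    rw [hq, mul_zero, nonpos_iff_eq_zero] at hd2
    exact (hermBall_vol_pos hε0).ne' hd2
  have hY : subVol (intertwiners m τ τ) (polarSet m τ ε (unitaryBall m τ ε)) ≠ ⊤ :=
    (subVol_lt_top _ (isCompact_polarSet ε (isCompact_unitaryBall ε)).isBounded).ne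
  exact tube_bounds_aux hY0 hY (polarSet_mul_unitaryVol hτ hε) hb1 hb2 hc1 hc2 hd1 hd2' hZ1 hZ2

/-- The tube around the group has volume close to `vol(K)` times that of the Hermitian ball; by
hypothesis it is also close to `k` times the volume of the squares, near which `Det^e` is almost 1.
The errors vanish as `δ → 1`. -/
theorem unitaryVol_eq (hτ : IsRealStructure m τ) {k : ENNReal} {e : ℝ} (hk0 : k ≠ 0)
    (hk : gramVol m τ τ = k • (posVol m τ).withDensity (detDensity e)) :
    unitaryVol m τ = k * 2 ^ finrank ℝ (hermPart m τ) := by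
  have key : ∀ x y : ENNReal, ∀ N : ℕ, (∀ δ : ℝ, 1 < δ → x ≤ y * ENNReal.ofReal δ ^ N) →
      x ≤ y := by
    intro x y N h
    have ht : Filter.Tendsto (fun δ : ℝ => y * ENNReal.ofReal δ ^ N) (nhdsWithin 1 (Set.Ioi 1))
        (nhds (y * 1)) := by
      refine ENNReal.Tendsto.const_mul ?_ (Or.inl one_ne_zero)
      have hc : Continuous fun δ : ℝ => ENNReal.ofReal δ ^ N :=
        (ENNReal.continuous_pow N).comp ENNReal.continuous_ofReal
      have := hc.tendsto 1
      simp only [ENNReal.ofReal_one, one_pow] at this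
      exact this.mono_left nhdsWithin_le_nhds
    rw [mul_one] at ht
    exact ge_of_tendsto ht (by filter_upwards [self_mem_nhdsWithin] with δ hδ using h δ hδ)
  exact le_antisymm (key _ _ _ fun δ hδ => (unitaryVol_bounds hτ hk0 hk hδ).1)
    (key _ _ _ fun δ hδ => (unitaryVol_bounds hτ hk0 hk hδ).2)

end TubeVolume

end

end BosonSector

namespace BosonSector

noncomputable section

set_option linter.unusedSectionVars false

open scoped Matrix.Norms.Frobenius
open Module

/-! ### The Gamma integral of the cone and Schur complements -/

section Gamma

variable {a c : Type*} [Fintype a] [Fintype c] [DecidableEq a]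
  [DecidableEq c] {m : ℤ} {τa : Matrix a a ℂ} {τc : Matrix c c ℂ}

/-- The function `Det(x)^e exp(-Tr x)` on the positive definite matrices. -/
def gammaDensity (e : ℝ) : Matrix a a ℂ → ENNReal :=
  {x : Matrix a a ℂ | x.PosDef}.indicator fun x =>
    ENNReal.ofReal (Real.exp (-x.trace.re)) * detDensity e x

lemma gammaDensity_of_posDef (e : ℝ) {x : Matrix a a ℂ} (hx : x.PosDef) :
    gammaDensity e x = ENNReal.ofReal (Real.exp (-x.trace.re)) * detDensity e x :=
  Set.indicator_of_mem (s := {x : Matrix a a ℂ | x.PosDef}) hx _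

lemma gammaDensity_of_not_posDef (e : ℝ) {x : Matrix a a ℂ} (hx : ¬ x.PosDef) :
    gammaDensity e x = 0 :=
  Set.indicator_of_notMem (s := {x : Matrix a a ℂ | x.PosDef}) hx _

/-- The Gamma function of the domain of positive elements. -/
def gammaInt (m : ℤ) (τ : Matrix a a ℂ) (e : ℝ) : ENNReal :=
  ∫⁻ x, gammaDensity e x ∂subVol (hermPart m τ)

@[fun_prop]
lemma measurable_gammaDensity (e : ℝ) : Measurable (gammaDensity (a := a) e) := by
  unfold gammaDensity
  have := measurable_trace_re (a := a)
  exact Measurable.indicator (by fun_prop) measurableSet_posDef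

lemma gammaInt_eq (m : ℤ) (τ : Matrix a a ℂ) (e : ℝ) :
    gammaInt m τ e =
      ∫⁻ x, ENNReal.ofReal (Real.exp (-x.trace.re)) * detDensity e x ∂posVol m τ := by
  rw [gammaInt, gammaDensity, lintegral_indicator measurableSet_posDef, posVol]
  congr 1
  apply Measure.restrict_congr_set
  filter_upwards [ae_mem_subVol (hermPart m τ)] with x hx
  exact propext ⟨fun h => ⟨hx, h⟩, fun h => h.2⟩

lemma trace_fromBlocks' (x : Matrix a a ℂ) (y : Matrix a c ℂ) (w : Matrix c a ℂ)
    (z : Matrix c c ℂ) : (fromBlocks x y w z).trace = x.trace + z.trace := by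
  simp [trace, Fintype.sum_sum_type]

@[fun_prop]
lemma measurable_gaussian_conj (x : Matrix a a ℂ) : Measurable fun y : Matrix a c ℂ =>
    ENNReal.ofReal (Real.exp (-(yᴴ * x * y).trace.re)) := by
  have h2 : Measurable fun y : Matrix a c ℂ => yᴴ * x * y := by fun_prop
  have := (measurable_trace_re (a := c)).comp h2
  exact (Real.measurable_exp.comp this.neg).ennreal_ofReal

/-- With the Schur complement `s = z - yᴴ x⁻¹ y`, the determinant is `det x det s`, the trace is `Tr
x + Tr s + Tr(yᴴ x⁻¹ y)`, and positivity means positivity of `x` and of `s`. -/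
lemma gammaDensity_fromBlocks (e : ℝ) (x : Matrix a a ℂ) (y : Matrix a c ℂ) (z : Matrix c c ℂ) :
    gammaDensity e (fromBlocks x y yᴴ z) = gammaDensity e x *
      (ENNReal.ofReal (Real.exp (-(yᴴ * x⁻¹ * y).trace.re)) *
        gammaDensity e (z - yᴴ * x⁻¹ * y)) := by
  by_cases hx : x.PosDef
  swap
  · have h1 : ¬ (fromBlocks x y yᴴ z).PosDef := fun h => hx (by
      have := h.submatrix (e := Sum.inl) Sum.inl_injective
      rwa [show (fromBlocks x y yᴴ z).submatrix Sum.inl Sum.inl = x from rfl] at this)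
    rw [gammaDensity_of_not_posDef e h1, gammaDensity_of_not_posDef e hx, zero_mul]
  have hxu : IsUnit x.det := (isUnit_iff_isUnit_det x).1 hx.isUnit
  let i : Invertible x := x.invertibleOfIsUnitDet hxu
  have hdet : (fromBlocks x y yᴴ z).det = x.det * (z - yᴴ * x⁻¹ * y).det := by
    rw [det_fromBlocks₁₁, invOf_eq_nonsing_inv]
  have hiff : (fromBlocks x y yᴴ z).PosDef ↔ (z - yᴴ * x⁻¹ * y).PosDef := by
    have key := PosDef.fromBlocks₁₁ y z hx
    constructor
    · intro h
      refine (PosSemidef.posDef_iff_isUnit (key.1 h.posSemidef)).2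
        ((isUnit_iff_isUnit_det _).2 ?_)
      have := (isUnit_iff_isUnit_det _).1 h.isUnit
      rw [hdet] at this
      exact isUnit_of_mul_isUnit_right this
    · intro h
      refine (PosSemidef.posDef_iff_isUnit (key.2 h.posSemidef)).2
        ((isUnit_iff_isUnit_det _).2 ?_)
      rw [hdet]
      exact hxu.mul ((isUnit_iff_isUnit_det _).1 h.isUnit)
  by_cases hz : (z - yᴴ * x⁻¹ * y).PosDef
  swap
  · have h1 := hiff.not.2 hz
    rw [gammaDensity_of_not_posDef e h1, gammaDensity_of_not_posDef e hz, mul_zero, mul_zero]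
  have h1 := hiff.2 hz
  have e1 : detDensity e (fromBlocks x y yᴴ z) =
      detDensity e x * detDensity e (z - yᴴ * x⁻¹ * y) := by
    unfold detDensity
    rw [hdet, norm_mul, Real.mul_rpow (norm_nonneg _) (norm_nonneg _),
      ENNReal.ofReal_mul (by positivity)]
  have e2 : ENNReal.ofReal (Real.exp (-(fromBlocks x y yᴴ z).trace.re)) =
      ENNReal.ofReal (Real.exp (-x.trace.re)) *
      (ENNReal.ofReal (Real.exp (-(yᴴ * x⁻¹ * y).trace.re)) *
      ENNReal.ofReal (Real.exp (-(z - yᴴ * x⁻¹ * y).trace.re))) := by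
    rw [← ENNReal.ofReal_mul (by positivity), ← ENNReal.ofReal_mul (by positivity), ← Real.exp_add,
      ← Real.exp_add, trace_fromBlocks', trace_sub, Complex.add_re, Complex.sub_re]
    congr 2
    ring
  rw [gammaDensity_of_posDef e h1, gammaDensity_of_posDef e hz, gammaDensity_of_posDef e hx, e1, e2]
  ring

/-- Write `x = g gᴴ` and substitute `y = g y'`. The Jacobian of left multiplication is the power of
`Det x` that shifts the argument of the Gamma integral. -/
lemma lintegral_gaussian_conj (ha : IsRealStructure m τa) (hc : IsRealStructure m τc)
    (hm : m = 0 ∨ m = 1 ∨ m = -1) {x : Matrix a a ℂ} (hx : x ∈ posSet m τa) :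
    ∫⁻ y, ENNReal.ofReal (Real.exp (-(yᴴ * x⁻¹ * y).trace.re)) ∂subVol (intertwiners m τa τc) =
      detDensity (Fintype.card c / scale m) x *
        ENNReal.ofReal (Real.pi ^ ((finrank ℝ (intertwiners m τa τc) : ℝ) / 2)) := by
  obtain ⟨g, hg, hgp, rfl⟩ := exists_sqrt_mem ha hx.2 hx.1
  have hgu : IsUnit g.det := (isUnit_iff_isUnit_det g).1 hgp.isUnit
  have hgu' : IsUnit gᴴ.det := by rw [hgp.1]; exact hgu
  have h1 := map_mul_left_subVol ha hc hm hg.1 hgu.ne_zero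
  have hφ : Measurable fun y : Matrix a c ℂ =>
      ENNReal.ofReal (Real.exp (-(yᴴ * (g * gᴴ)⁻¹ * y).trace.re)) := measurable_gaussian_conj _
  have h3 : ∫⁻ y, ENNReal.ofReal (Real.exp (-(yᴴ * (g * gᴴ)⁻¹ * y).trace.re))
      ∂(subVol (intertwiners m τa τc)).map (fun X => g * X) =
      ENNReal.ofReal (Real.pi ^ ((finrank ℝ (intertwiners m τa τc) : ℝ) / 2)) := by
    rw [lintegral_map hφ (by fun_prop), ← lintegral_gaussian_subVol]
    refine lintegral_congr fun y => ?_
    have : (g * y)ᴴ * (g * gᴴ)⁻¹ * (g * y) = yᴴ * y := by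
      rw [Matrix.mul_inv_rev, conjTranspose_mul]
      calc yᴴ * gᴴ * (gᴴ⁻¹ * g⁻¹) * (g * y) = yᴴ * (gᴴ * gᴴ⁻¹) * (g⁻¹ * g) * y := by
            simp only [Matrix.mul_assoc]
        _ = yᴴ * y := by
            rw [mul_nonsing_inv _ hgu', nonsing_inv_mul _ hgu, Matrix.mul_one, Matrix.mul_one]
    rw [this, norm_sq_eq_trace, trace_mul_comm]
  rw [h1, lintegral_smul_measure, smul_eq_mul] at h3
  rw [← h3, ← mul_assoc, detDensity_mul, detDensity_star, ← detDensity_add _ _ hgu.ne_zero]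
  have h4 : detDensity (Fintype.card c / scale m + Fintype.card c / scale m) g *
      ENNReal.ofReal (‖g.det‖ ^ (-(2 * Fintype.card c / scale m : ℝ))) = 1 := by
    change _ * detDensity (-(2 * Fintype.card c / scale m : ℝ)) g = 1
    rw [← detDensity_add _ _ hgu.ne_zero, ← detDensity_zero g]
    congr 1
    ring
  rw [h4, one_mul]

lemma lintegral_subVol_sup {E : Type*} [NormedAddCommGroup E] [InnerProductSpace ℝ E]
    [FiniteDimensional ℝ E] [MeasurableSpace E] [BorelSpace E] (S₁ S₂ : Submodule ℝ E)
    (h : ∀ x ∈ S₁, ∀ y ∈ S₂, ‖x + y‖ ^ 2 = ‖x‖ ^ 2 + ‖y‖ ^ 2) {f : E → ENNReal}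
    (hf : Measurable f) :
    ∫⁻ x, f x ∂subVol (S₁ ⊔ S₂) = ∫⁻ x, ∫⁻ y, f (x + y) ∂subVol S₂ ∂subVol S₁ := by
  rw [← map_add_prod_subVol S₁ S₂ h, lintegral_map hf (by fun_prop),
    lintegral_prod _ (by fun_prop)]

/-- The Hermitian block matrix with given blocks. -/
def blockLin (a c : Type*) : (Matrix a a ℂ × Matrix a c ℂ × Matrix c c ℂ) →ₗ[ℝ]
    Matrix (a ⊕ c) (a ⊕ c) ℂ where
  toFun p := fromBlocks p.1 p.2.1 p.2.1ᴴ p.2.2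
  map_add' p q := by simp [fromBlocks_add]
  map_smul' r p := by simp [fromBlocks_smul]

/-- The off-diagonal block occurs twice in a Hermitian matrix. This is the source of the factor `√2`
per dimension of the intertwiners. -/
lemma norm_sq_blockLin (x : Matrix a a ℂ) (y : Matrix a c ℂ) (z : Matrix c c ℂ) :
    ‖blockLin a c (x, y, z)‖ ^ 2 = ‖x‖ ^ 2 + 2 * ‖y‖ ^ 2 + ‖z‖ ^ 2 := by
  have h1 : ‖y‖ ^ 2 = (yᴴ * y).trace.re := by rw [norm_sq_eq_trace, trace_mul_comm]
  have h2 := norm_sq_eq_trace y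
  rw [norm_sq_eq_trace, norm_sq_eq_trace x, norm_sq_eq_trace z]
  show (fromBlocks x y yᴴ z * (fromBlocks x y yᴴ z)ᴴ).trace.re = _
  rw [fromBlocks_conjTranspose, conjTranspose_conjTranspose, fromBlocks_multiply, trace_fromBlocks',
    trace_add, trace_add, Complex.add_re, Complex.add_re, Complex.add_re, ← h1, ← h2]
  ring

lemma fromBlocks_mem_hermPart {x : Matrix a a ℂ} {y : Matrix a c ℂ} {z : Matrix c c ℂ}
    (ha : IsRealStructure m τa) (hc : IsRealStructure m τc)
    (hx : x ∈ hermPart m τa) (hy : y ∈ intertwiners m τa τc) (hz : z ∈ hermPart m τc) :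
    fromBlocks x y yᴴ z ∈ hermPart m (fromBlocks τa 0 0 τc) := by
  refine ⟨fun hm => ?_, ?_⟩
  · have h1 := hx.1 hm
    have h2 := hy hm
    have h3 := hz.1 hm
    have h4 := intertwiners_star ha hc hy hm
    rw [fromBlocks_conjTranspose, fromBlocks_transpose, fromBlocks_multiply, fromBlocks_multiply]
    simp only [Matrix.mul_zero, Matrix.zero_mul, add_zero, zero_add, h1, h2, h3, h4]
  · rw [fromBlocks_conjTranspose, hx.2, hz.2, conjTranspose_conjTranspose]

lemma exists_of_mem_hermPart_fromBlocks {w : Matrix (a ⊕ c) (a ⊕ c) ℂ}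
    (hw : w ∈ hermPart m (fromBlocks τa 0 0 τc)) :
    ∃ x ∈ hermPart m τa, ∃ y ∈ intertwiners m τa τc, ∃ z ∈ hermPart m τc,
      fromBlocks x y yᴴ z = w := by
  obtain ⟨h1, h2⟩ := hw
  obtain ⟨x, y, y', z, rfl⟩ : ∃ x y y' z, w = fromBlocks x y y' z :=
    ⟨_, _, _, _, (fromBlocks_toBlocks w).symm⟩
  rw [fromBlocks_conjTranspose, fromBlocks_inj] at h2
  have key : m ≠ 0 → x * τa = τa * xᴴᵀ ∧ y * τc = τa * yᴴᵀ ∧ z * τc = τc * zᴴᵀ := by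
    intro hm
    have h3 := h1 hm
    rw [fromBlocks_conjTranspose, fromBlocks_transpose, fromBlocks_multiply,
      fromBlocks_multiply] at h3
    simp only [Matrix.mul_zero, Matrix.zero_mul, add_zero, zero_add, fromBlocks_inj] at h3
    exact ⟨h3.1, h3.2.1, h3.2.2.2⟩
  refine ⟨x, ⟨fun hm => (key hm).1, h2.1⟩, y, fun hm => (key hm).2.1, z,
    ⟨fun hm => (key hm).2.2, h2.2.2.2⟩, ?_⟩
  rw [h2.2.2.1]

lemma lintegral_hermPart_fromBlocks (ha : IsRealStructure m τa) (hc : IsRealStructure m τc)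
    {f : Matrix (a ⊕ c) (a ⊕ c) ℂ → ENNReal} (hf : Measurable f) :
    ∫⁻ w, f w ∂subVol (hermPart m (fromBlocks τa 0 0 τc)) =
      ENNReal.ofReal (√2 ^ finrank ℝ (intertwiners m τa τc)) *
      ∫⁻ x, ∫⁻ y, ∫⁻ z, f (fromBlocks x y yᴴ z) ∂subVol (hermPart m τc)
        ∂subVol (intertwiners m τa τc) ∂subVol (hermPart m τa) := by
  let T₁ : Matrix a a ℂ →ₗ[ℝ] _ := blockLin a c ∘ₗ LinearMap.inl ℝ _ _
  let T₂ : Matrix a c ℂ →ₗ[ℝ] _ := blockLin a c ∘ₗ LinearMap.inr ℝ _ _ ∘ₗ LinearMap.inl ℝ _ _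
  let T₃ : Matrix c c ℂ →ₗ[ℝ] _ := blockLin a c ∘ₗ LinearMap.inr ℝ _ _ ∘ₗ LinearMap.inr ℝ _ _
  have hT : ∀ x y z, T₁ x + (T₂ y + T₃ z) = blockLin a c (x, y, z) := by
    intro x y z
    show blockLin a c (x, 0, 0) + (blockLin a c (0, y, 0) + blockLin a c (0, 0, z)) = _
    rw [← map_add, ← map_add]
    simp
  have hT' : ∀ y z, T₂ y + T₃ z = blockLin a c (0, y, z) := fun y z => by
    rw [← hT, map_zero, zero_add]
  have n1 : ∀ x, ‖T₁ x‖ ^ 2 = ‖x‖ ^ 2 := fun x => by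
    have := norm_sq_blockLin x (0 : Matrix a c ℂ) (0 : Matrix c c ℂ)
    rw [norm_zero, norm_zero] at this
    exact this.trans (by ring)
  have n2 : ∀ y, ‖T₂ y‖ ^ 2 = 2 * ‖y‖ ^ 2 := fun y => by
    have := norm_sq_blockLin 0 y (0 : Matrix c c ℂ)
    rw [norm_zero, norm_zero] at this
    exact this.trans (by ring)
  have n3 : ∀ z, ‖T₃ z‖ ^ 2 = ‖z‖ ^ 2 := fun z => by
    have := norm_sq_blockLin (0 : Matrix a a ℂ) (0 : Matrix a c ℂ) z
    rw [norm_zero, norm_zero] at this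
    exact this.trans (by ring)
  have mT₁ : Measurable T₁ := (LinearMap.continuous_of_finiteDimensional T₁).measurable
  have mT₂ : Measurable T₂ := (LinearMap.continuous_of_finiteDimensional T₂).measurable
  have mT₃ : Measurable T₃ := (LinearMap.continuous_of_finiteDimensional T₃).measurable
  set S₁ := (hermPart m τa).map T₁
  set S₂ := (intertwiners m τa τc).map T₂
  set S₃ := (hermPart m τc).map T₃
  have hS : hermPart m (fromBlocks τa 0 0 τc) = S₁ ⊔ (S₂ ⊔ S₃) := by
    apply le_antisymm
    · intro w hw
      obtain ⟨x, hx, y, hy, z, hz, rfl⟩ := exists_of_mem_hermPart_fromBlocks hw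
      rw [show fromBlocks x y yᴴ z = T₁ x + (T₂ y + T₃ z) from (hT x y z).symm]
      exact Submodule.add_mem_sup (Submodule.mem_map_of_mem hx)
        (Submodule.add_mem_sup (Submodule.mem_map_of_mem hy) (Submodule.mem_map_of_mem hz))
    · refine sup_le ?_ (sup_le ?_ ?_)
      · rintro _ ⟨x, hx, rfl⟩
        exact fromBlocks_mem_hermPart ha hc hx (zero_mem _) (zero_mem _)
      · rintro _ ⟨y, hy, rfl⟩
        exact fromBlocks_mem_hermPart ha hc (zero_mem _) hy (zero_mem _)
      · rintro _ ⟨z, hz, rfl⟩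
        exact fromBlocks_mem_hermPart ha hc (zero_mem _) (zero_mem _) hz
  have o1 : ∀ x ∈ S₁, ∀ w ∈ S₂ ⊔ S₃, ‖x + w‖ ^ 2 = ‖x‖ ^ 2 + ‖w‖ ^ 2 := by
    rintro _ ⟨x, _, rfl⟩ w hw
    obtain ⟨_, ⟨y, _, rfl⟩, _, ⟨z, _, rfl⟩, rfl⟩ := Submodule.mem_sup.1 hw
    rw [hT, n1, hT', norm_sq_blockLin, norm_sq_blockLin, norm_zero]
    ring
  have o2 : ∀ x ∈ S₂, ∀ w ∈ S₃, ‖x + w‖ ^ 2 = ‖x‖ ^ 2 + ‖w‖ ^ 2 := by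
    rintro _ ⟨y, _, rfl⟩ _ ⟨z, _, rfl⟩
    rw [n2, n3, hT', norm_sq_blockLin, norm_zero]
    ring
  have i1 : subVol S₁ = (subVol (hermPart m τa)).map T₁ :=
    (map_isometry_subVol _ T₁ fun x _ =>
      (sq_eq_sq₀ (norm_nonneg _) (norm_nonneg _)).1 (n1 x)).symm
  have i3 : subVol S₃ = (subVol (hermPart m τc)).map T₃ :=
    (map_isometry_subVol _ T₃ fun x _ =>
      (sq_eq_sq₀ (norm_nonneg _) (norm_nonneg _)).1 (n3 x)).symm
  have i2 : subVol S₂ = ENNReal.ofReal (√2 ^ finrank ℝ (intertwiners m τa τc)) •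
      (subVol (intertwiners m τa τc)).map T₂ := by
    rw [map_similarity_subVol _ T₂ (c := √2) (by positivity) fun x _ =>
      (sq_eq_sq₀ (norm_nonneg _) (by positivity)).1 (by
        rw [n2, mul_pow, Real.sq_sqrt zero_le_two]), smul_smul,
      ← ENNReal.ofReal_mul (by positivity), mul_inv_cancel₀ (by positivity), ENNReal.ofReal_one,
      one_smul]
  have m3 : Measurable fun p : Matrix (a ⊕ c) (a ⊕ c) ℂ × Matrix (a ⊕ c) (a ⊕ c) ℂ =>
      ∫⁻ z, f (p.1 + (p.2 + z)) ∂subVol S₃ := by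
    refine Measurable.lintegral_prod_right' (f := fun q : (Matrix (a ⊕ c) (a ⊕ c) ℂ ×
      Matrix (a ⊕ c) (a ⊕ c) ℂ) × Matrix (a ⊕ c) (a ⊕ c) ℂ => f (q.1.1 + (q.1.2 + q.2))) ?_
    fun_prop
  rw [hS, lintegral_subVol_sup _ _ o1 hf]
  have step : ∀ x, ∫⁻ y, f (x + y) ∂subVol (S₂ ⊔ S₃) =
      ∫⁻ y, ∫⁻ z, f (x + (y + z)) ∂subVol S₃ ∂subVol S₂ := fun x =>
    lintegral_subVol_sup _ _ o2 (by fun_prop)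
  simp_rw [step]
  rw [i1, lintegral_map (Measurable.lintegral_prod_right' m3) mT₁, i2]
  simp_rw [lintegral_smul_measure, smul_eq_mul]
  rw [lintegral_const_mul']
  swap
  · exact ENNReal.ofReal_ne_top
  congr 1
  refine lintegral_congr fun x => ?_
  have m4 : Measurable fun y => ∫⁻ z, f (T₁ x + (y + z)) ∂subVol S₃ :=
    m3.comp measurable_prodMk_left
  rw [lintegral_map m4 mT₂]
  refine lintegral_congr fun y => ?_
  rw [i3, lintegral_map (by fun_prop) mT₃]
  refine lintegral_congr fun z => ?_
  rw [hT]
  rfl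

/-- The factorization of the Gamma function by Schur complements. -/
theorem gammaInt_fromBlocks (ha : IsRealStructure m τa) (hc : IsRealStructure m τc)
    (hm : m = 0 ∨ m = 1 ∨ m = -1) (e : ℝ) :
    gammaInt m (fromBlocks τa 0 0 τc) e =
      ENNReal.ofReal (√2 ^ finrank ℝ (intertwiners m τa τc)) *
      (ENNReal.ofReal (Real.pi ^ ((finrank ℝ (intertwiners m τa τc) : ℝ) / 2)) *
        (gammaInt m τa (e + Fintype.card c / scale m) * gammaInt m τc e)) := by
  rw [gammaInt, lintegral_hermPart_fromBlocks ha hc (by fun_prop)]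
  congr 1
  have h1 : ∀ᵐ x ∂subVol (hermPart m τa),
      ∫⁻ y, ∫⁻ z, gammaDensity e (fromBlocks x y yᴴ z) ∂subVol (hermPart m τc)
        ∂subVol (intertwiners m τa τc) =
      gammaDensity (e + Fintype.card c / scale m) x *
      (ENNReal.ofReal (Real.pi ^ ((finrank ℝ (intertwiners m τa τc) : ℝ) / 2)) *
        gammaInt m τc e) := by
    filter_upwards [ae_mem_subVol (hermPart m τa)] with x hx
    simp_rw [gammaDensity_fromBlocks]
    by_cases hxp : x.PosDef
    swap
    · simp [gammaDensity_of_not_posDef _ hxp]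
    have hxd : x.det ≠ 0 := posSet_det_ne_zero (m := m) (τa := τa) ⟨hx, hxp⟩
    have h2 : ∀ᵐ y ∂subVol (intertwiners m τa τc),
        ∫⁻ z, gammaDensity e x * (ENNReal.ofReal (Real.exp (-(yᴴ * x⁻¹ * y).trace.re)) *
          gammaDensity e (z - yᴴ * x⁻¹ * y)) ∂subVol (hermPart m τc) =
        (gammaDensity e x * gammaInt m τc e) *
          ENNReal.ofReal (Real.exp (-(yᴴ * x⁻¹ * y).trace.re)) := by
      filter_upwards [ae_mem_subVol (intertwiners m τa τc)] with y hy
      -- The subtracted term lies in the domain of integration of `z`, so translation invariance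
      -- removes it.
      have hw : yᴴ * x⁻¹ * y ∈ hermPart m τc := by
        refine ⟨intertwiners_mul (intertwiners_mul (intertwiners_star ha hc hy)
          (intertwiners_inv hx.1 hxd)) hy, ?_⟩
        rw [conjTranspose_mul, conjTranspose_mul, conjTranspose_conjTranspose,
          conjTranspose_nonsing_inv, hx.2, Matrix.mul_assoc]
      have h3 := map_add_subVol (hermPart m τc) (neg_mem hw)
      rw [lintegral_const_mul _ (by fun_prop), lintegral_const_mul _ (by fun_prop)]
      have h4 : ∫⁻ z, gammaDensity e (z - yᴴ * x⁻¹ * y) ∂subVol (hermPart m τc) =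
          gammaInt m τc e := by
        rw [gammaInt]
        conv_rhs => rw [← h3]
        rw [lintegral_map (by fun_prop) (by fun_prop)]
        refine lintegral_congr fun z => ?_
        rw [neg_add_eq_sub]
      rw [h4]
      ring
    rw [lintegral_congr_ae h2, lintegral_const_mul _ (by fun_prop),
      lintegral_gaussian_conj ha hc hm ⟨hx, hxp⟩]
    have h5 : gammaDensity (e + Fintype.card c / scale m) x =
        gammaDensity e x * detDensity (Fintype.card c / scale m) x := by
      rw [gammaDensity_of_posDef _ hxp, gammaDensity_of_posDef _ hxp,
          detDensity_add _ _ hxd, mul_assoc]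
    rw [h5]
    ring
  rw [lintegral_congr_ae h1, lintegral_mul_const _ (by fun_prop), ← gammaInt]
  ring

end Gamma

end

end BosonSector

namespace BosonSector

noncomputable section

set_option linter.unusedSectionVars false

open scoped Matrix.Norms.Frobenius
open Module

/-! ### The constant of proportionality -/

section GramConstant

variable {a b c : Type*} [Fintype a] [Fintype b] [Fintype c] [DecidableEq a] [DecidableEq b]
  [DecidableEq c] {m : ℤ} {τa : Matrix a a ℂ} {τb : Matrix b b ℂ} {τc : Matrix c c ℂ}

/-- Conjugation by a unitary matrix. -/
def conjIsometry {u : Matrix a b ℂ} (h1 : u * uᴴ = 1) (h2 : uᴴ * u = 1) :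
    Matrix b b ℂ ≃ᵢ Matrix a a ℂ where
  toFun X := u * X * uᴴ
  invFun Y := uᴴ * Y * u
  left_inv X := by
    show uᴴ * (u * X * uᴴ) * u = X
    calc uᴴ * (u * X * uᴴ) * u = (uᴴ * u) * X * (uᴴ * u) := by simp only [Matrix.mul_assoc]
      _ = X := by rw [h2, Matrix.one_mul, Matrix.mul_one]
  right_inv Y := by
    show u * (uᴴ * Y * u) * uᴴ = Y
    calc u * (uᴴ * Y * u) * uᴴ = (u * uᴴ) * Y * (u * uᴴ) := by simp only [Matrix.mul_assoc]
      _ = Y := by rw [h1, Matrix.one_mul, Matrix.mul_one]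
  isometry_toFun := Isometry.of_dist_eq fun X Y => by
    rw [dist_eq_norm, dist_eq_norm, ← Matrix.sub_mul, ← Matrix.mul_sub,
      ← sq_eq_sq₀ (norm_nonneg _) (norm_nonneg _), norm_sq_eq_trace, norm_sq_eq_trace]
    set Z := X - Y
    congr 1
    calc (u * Z * uᴴ * (u * Z * uᴴ)ᴴ).trace = (u * (Z * (uᴴ * u) * Zᴴ * uᴴ)).trace := by
          simp only [conjTranspose_mul, conjTranspose_conjTranspose, Matrix.mul_assoc]
      _ = (Z * (uᴴ * u) * Zᴴ * (uᴴ * u)).trace := by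
          rw [trace_mul_comm]; simp only [Matrix.mul_assoc]
      _ = (Z * Zᴴ).trace := by rw [h2, Matrix.mul_one, Matrix.mul_one]

/-- A unitary intertwiner conjugates one group isometrically onto the other, so the volume depends
only on `m` and on the size. -/
lemma unitaryVol_congr (ha : IsRealStructure m τa) (hb : IsRealStructure m τb)
    (hm : m = 0 ∨ m = 1 ∨ m = -1) (hcard : Fintype.card a = Fintype.card b) :
    unitaryVol m τa = unitaryVol m τb := by
  obtain ⟨u, hu, h1, h2⟩ := exists_unitary ha hb hm hcard
  have hd : finrank ℝ (skewPart m τa) = finrank ℝ (skewPart m τb) := by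
    have e1 := finrank_skewPart ha hm
    have e2 := finrank_skewPart hb hm
    rw [hcard, ← e2] at e1
    exact_mod_cast mul_left_cancel₀ (scale_pos m).ne' e1
  have hu' := intertwiners_star ha hb hu
  rw [unitaryVol, unitaryVol, hd, ← ((conjIsometry h1 h2).measurePreserving_euclideanHausdorffMeasure
    _).measure_preimage isClosed_unitarySet.measurableSet.nullMeasurableSet]
  congr 1
  ext X
  constructor
  · rintro ⟨h3, h4⟩
    have h5 := (conjIsometry h1 h2).symm_apply_apply X
    have h6 : uᴴ * (u * X * uᴴ) * u = X := h5
    have h3' : u * X * uᴴ ∈ intertwiners m τa τa := h3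
    have h4' : (u * X * uᴴ) * (u * X * uᴴ)ᴴ = 1 := h4
    refine ⟨?_, ?_⟩
    · rw [← h6]
      exact intertwiners_mul (intertwiners_mul hu' h3') hu
    · rw [← h6]
      set Y := u * X * uᴴ
      calc uᴴ * Y * u * (uᴴ * Y * u)ᴴ = uᴴ * (Y * (u * uᴴ) * Yᴴ) * u := by
            simp only [conjTranspose_mul, conjTranspose_conjTranspose, Matrix.mul_assoc]
        _ = 1 := by rw [h1, Matrix.mul_one, h4', Matrix.mul_one, h2]
  · rintro ⟨h3, h4⟩
    refine ⟨intertwiners_mul (intertwiners_mul hu h3) hu', ?_⟩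
    show u * X * uᴴ * (u * X * uᴴ)ᴴ = 1
    calc u * X * uᴴ * (u * X * uᴴ)ᴴ = u * (X * (uᴴ * u) * Xᴴ) * uᴴ := by
          simp only [conjTranspose_mul, conjTranspose_conjTranspose, Matrix.mul_assoc]
      _ = 1 := by rw [h2, Matrix.mul_one, h4, Matrix.mul_one, h1]

/-- The integral of `exp(-Tr x)` against the Gram measure is the Gaussian integral of `exp(-‖X‖²)`.
-/
lemma mul_gammaInt_of_gramVol_eq {k : ENNReal} {e : ℝ}
    (hk : gramVol m τa τb = k • (posVol m τa).withDensity (detDensity e)) :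
    k * gammaInt m τa e =
      ENNReal.ofReal (Real.pi ^ ((finrank ℝ (intertwiners m τa τb) : ℝ) / 2)) := by
  have h : Measurable fun x : Matrix a a ℂ => ENNReal.ofReal (Real.exp (-x.trace.re)) :=
    (Real.measurable_exp.comp measurable_trace_re.neg).ennreal_ofReal
  rw [← lintegral_exp_gramVol, hk, lintegral_smul_measure, smul_eq_mul, gammaInt_eq,
    lintegral_withDensity_eq_lintegral_mul _ (measurable_detDensity e) h]
  congr 1
  refine lintegral_congr fun x => ?_
  rw [Pi.mul_apply, mul_comm]

lemma unitaryVol_mul_gammaInt (hb : IsRealStructure m τb) (hm : m = 0 ∨ m = 1 ∨ m = -1) :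
    unitaryVol m τb ≠ 0 ∧ unitaryVol m τb * gammaInt m τb (-m / scale m) =
      2 ^ finrank ℝ (hermPart m τb) *
        ENNReal.ofReal (Real.pi ^ ((finrank ℝ (intertwiners m τb τb) : ℝ) / 2)) := by
  -- The square case is the one with empty complement, which gives the exponent `-m / scale m`.
  have h0 : IsRealStructure m (0 : Matrix (Fin 0) (Fin 0) ℂ) :=
    ⟨Subsingleton.elim _ _, Subsingleton.elim _ _, fun _ => Subsingleton.elim _ _⟩
  obtain ⟨k, hk0, hkt, hk⟩ := exists_gramVol_eq hb hb h0 hm (by simp)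
  rw [Fintype.card_fin, Nat.cast_zero, zero_sub] at hk
  have h1 := unitaryVol_eq hb hk0 hk
  have h2 := mul_gammaInt_of_gramVol_eq hk
  refine ⟨?_, ?_⟩
  · rw [h1]
    exact mul_ne_zero hk0 (by positivity)
  · rw [h1, ← h2]
    ring

/-- The distribution of `X Xᴴ` for a Lebesgue distributed intertwiner `X`. -/
theorem gramVol_eq (ha : IsRealStructure m τa) (hb : IsRealStructure m τb)
    (hc : IsRealStructure m τc) (hm : m = 0 ∨ m = 1 ∨ m = -1)
    (hcard : Fintype.card a + Fintype.card c = Fintype.card b) :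
    ∃ k : ENNReal, k ≠ 0 ∧ k ≠ ⊤ ∧
      gramVol m τa τb =
        k • (posVol m τa).withDensity (detDensity ((Fintype.card c - m) / scale m)) ∧
      unitaryVol m τb = k * unitaryVol m τc * 2 ^ finrank ℝ (hermPart m τa) *
        ENNReal.ofReal (√2 ^ finrank ℝ (intertwiners m τa τc)) := by
  obtain ⟨k, hk0, hkt, hk⟩ := exists_gramVol_eq ha hb hc hm hcard
  refine ⟨k, hk0, hkt, hk, ?_⟩
  have hd := ha.fromBlocks hc
  have g1 := mul_gammaInt_of_gramVol_eq hk
  obtain ⟨-, g2⟩ := unitaryVol_mul_gammaInt hd hm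
  obtain ⟨-, g3⟩ := unitaryVol_mul_gammaInt hc hm
  have g4 := gammaInt_fromBlocks ha hc hm (-m / scale m)
  rw [← add_div, neg_add_eq_sub] at g4
  rw [← unitaryVol_congr hd hb hm (by simpa using hcard)]
  have hs := (scale_pos m).ne'
  have hcR : (Fintype.card a : ℝ) + Fintype.card c = Fintype.card b := by exact_mod_cast hcard
  have hcS : (Fintype.card (a ⊕ c) : ℝ) = Fintype.card a + Fintype.card c := by simp
  have r1 : finrank ℝ (hermPart m (fromBlocks τa 0 0 τc)) = finrank ℝ (hermPart m τa) +
      finrank ℝ (hermPart m τc) + finrank ℝ (intertwiners m τa τc) := by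
    have e1 := finrank_hermPart hd hm
    have e2 := finrank_hermPart ha hm
    have e3 := finrank_hermPart hc hm
    have e4 := finrank_intertwiners ha hc hm
    rw [hcS] at e1
    have : scale m * (finrank ℝ (hermPart m (fromBlocks τa 0 0 τc)) : ℝ) =
        scale m * ((finrank ℝ (hermPart m τa) : ℝ) +
      finrank ℝ (hermPart m τc) + finrank ℝ (intertwiners m τa τc)) := by
      rw [mul_add, mul_add, e1, e2, e3, e4]
      ring
    exact_mod_cast mul_left_cancel₀ hs this
  have r2 : (finrank ℝ (intertwiners m (fromBlocks τa 0 0 τc) (fromBlocks τa 0 0 τc)) : ℝ) / 2 =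
      (finrank ℝ (intertwiners m τa τc) : ℝ) / 2 + (finrank ℝ (intertwiners m τa τb) : ℝ) / 2 +
      (finrank ℝ (intertwiners m τc τc) : ℝ) / 2 := by
    have e1 := finrank_intertwiners hd hd hm
    have e2 := finrank_intertwiners ha hc hm
    have e3 := finrank_intertwiners ha hb hm
    have e4 := finrank_intertwiners hc hc hm
    rw [hcS] at e1
    rw [← hcR] at e3
    apply mul_left_cancel₀ hs
    rw [mul_add, mul_add]
    simp only [← mul_div_assoc]
    rw [e1, e2, e3, e4]
    ring
  rw [r2, Real.rpow_add Real.pi_pos, Real.rpow_add Real.pi_pos, ENNReal.ofReal_mul (by positivity),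
    ENNReal.ofReal_mul (by positivity), r1, g4] at g2
  have hsq : ENNReal.ofReal (√2 ^ finrank ℝ (intertwiners m τa τc)) *
      ENNReal.ofReal (√2 ^ finrank ℝ (intertwiners m τa τc)) =
      2 ^ finrank ℝ (intertwiners m τa τc) := by
    rw [← ENNReal.ofReal_mul (by positivity), ← mul_pow, Real.mul_self_sqrt zero_le_two,
      ENNReal.ofReal_pow zero_le_two, ENNReal.ofReal_ofNat]
  have pt : ∀ x : ℝ, ENNReal.ofReal (Real.pi ^ x) ≠ 0 := fun x => by
    rw [Ne, ENNReal.ofReal_eq_zero, not_le]; positivity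
  have hq0 : ENNReal.ofReal (√2 ^ finrank ℝ (intertwiners m τa τc)) ≠ 0 := by
    rw [Ne, ENNReal.ofReal_eq_zero, not_le]; positivity
  have hqt : ENNReal.ofReal (√2 ^ finrank ℝ (intertwiners m τa τc)) ≠ ⊤ := ENNReal.ofReal_ne_top
  rw [pow_add, pow_add, ← hsq] at g2
  generalize ENNReal.ofReal (√2 ^ finrank ℝ (intertwiners m τa τc)) = Q at *
  have p1 := pt ((finrank ℝ (intertwiners m τa τc) : ℝ) / 2)
  have p2 := pt ((finrank ℝ (intertwiners m τa τb) : ℝ) / 2)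
  have p3 := pt ((finrank ℝ (intertwiners m τc τc) : ℝ) / 2)
  have t1 : ENNReal.ofReal (Real.pi ^ ((finrank ℝ (intertwiners m τa τc) : ℝ) / 2)) ≠ ⊤ :=
    ENNReal.ofReal_ne_top
  have t2 : ENNReal.ofReal (Real.pi ^ ((finrank ℝ (intertwiners m τa τb) : ℝ) / 2)) ≠ ⊤ :=
    ENNReal.ofReal_ne_top
  have t3 : ENNReal.ofReal (Real.pi ^ ((finrank ℝ (intertwiners m τc τc) : ℝ) / 2)) ≠ ⊤ :=
    ENNReal.ofReal_ne_top
  generalize ENNReal.ofReal (Real.pi ^ ((finrank ℝ (intertwiners m τa τc) : ℝ) / 2)) = A1 at *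
  generalize ENNReal.ofReal (Real.pi ^ ((finrank ℝ (intertwiners m τa τb) : ℝ) / 2)) = A2 at *
  generalize ENNReal.ofReal (Real.pi ^ ((finrank ℝ (intertwiners m τc τc) : ℝ) / 2)) = A3 at *
  generalize unitaryVol m (fromBlocks τa 0 0 τc) = V at *
  generalize unitaryVol m τc = U at *
  generalize gammaInt m τa ((Fintype.card c - m) / scale m) = Γa at *
  generalize gammaInt m τc (-m / scale m) = Γc at *
  have h20 : (2 : ENNReal) ^ finrank ℝ (hermPart m τc) ≠ 0 := by positivity
  have h2t : (2 : ENNReal) ^ finrank ℝ (hermPart m τc) ≠ ⊤ := ENNReal.pow_ne_top ENNReal.ofNat_ne_top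
  generalize (2 : ENNReal) ^ finrank ℝ (hermPart m τc) = H at *
  generalize (2 : ENNReal) ^ finrank ℝ (hermPart m τa) = J at *
  -- The Gamma values are eliminated: `g1` supplies `k Γa`, `g3` supplies `U Γc`, and `g2`, for the
  -- whole space, contains `V Γa Γc` after the Schur factorization.
  have key : (Q * A1 * A2 * A3 * H) * V = (Q * A1 * A2 * A3 * H) * (k * U * J * Q) := by
    calc (Q * A1 * A2 * A3 * H) * V = Q * A1 * (k * Γa) * (U * Γc) * V := by rw [g1, g3]; ring
      _ = (V * (Q * (A1 * (Γa * Γc)))) * (k * U) := by ring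
      _ = _ := by rw [g2]; ring
  refine (ENNReal.mul_right_inj ?_ ?_).1 key
  · exact mul_ne_zero (mul_ne_zero (mul_ne_zero (mul_ne_zero hq0 p1) p2) p3) h20
  · exact ENNReal.mul_ne_top (ENNReal.mul_ne_top (ENNReal.mul_ne_top (ENNReal.mul_ne_top hqt t1) t2)
      t3) h2t

end GramConstant

end

end BosonSector

namespace BosonSector

noncomputable section

set_option linter.unusedSectionVars false

open scoped Matrix.Norms.Frobenius
open Module

/-! ### Comparison with the measures of the statement -/

section Transfer

variable {a b c : Type*} [Fintype a] [Fintype b] [Fintype c] [DecidableEq a] [DecidableEq b]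
  [DecidableEq c] {m : ℤ} {τa : Matrix a a ℂ} {τb : Matrix b b ℂ} {τc : Matrix c c ℂ}

lemma det_re_eq_norm {x : Matrix a a ℂ} (hx : x.PosDef) : x.det.re = ‖x.det‖ := by
  have h := hx.det_pos
  rw [Complex.pos_iff] at h
  rw [← Complex.abs_re_eq_norm.2 h.2.symm, abs_of_pos h.1]

lemma ofReal_detPow {x : Matrix a a ℂ} (hx : x.PosDef) (e : ℝ) :
    ENNReal.ofReal (detPow e x) = detDensity e x := by
  rw [detPow, detDensity, det_re_eq_norm hx]

lemma measurable_detPow (e : ℝ) : Measurable (detPow (κ := a) e) := by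
  unfold detPow
  have : Measurable fun x : Matrix a a ℂ => x.det.re :=
    (Complex.continuous_re.comp continuous_det').measurable
  exact this.pow_const e

lemma posVol_eq_restrict : posVol m τa =
    (μHE[finrank ℝ (hermPart m τa)] : Measure (Matrix a a ℂ)).restrict (posSet m τa) := by
  rw [posVol, subVol, Measure.restrict_restrict measurableSet_posSet,
    Set.inter_eq_left.2 fun x hx => hx.1]

lemma ae_posVol : ∀ᵐ x ∂posVol m τa, x ∈ posSet m τa := ae_restrict_mem measurableSet_posSet

/-- The exponents agree because `scale m · d = N (N + m)` for matrices of size `N`; the rescaled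
metric contributes only the constant. -/
lemma invMeasure_eq (ha : IsRealStructure m τa) (hm : m = 0 ∨ m = 1 ∨ m = -1) (s : ℕ) {d : ℕ}
    {W : Submodule ℂ (Matrix a a ℂ)} (hW : ∀ x, xᴴ = x → (x ∈ W ↔ x ∈ hermPart m τa))
    (hd : d = finrank ℝ (hermPart m τa)) :
    invMeasure s d W = ENNReal.ofReal ((s : ℝ) ^ (-(d : ℝ) / 2)) • invVol m τa := by
  have h1 : posDomain W = posSet m τa := by
    ext x
    exact ⟨fun h => ⟨(hW x h.2.1).1 h.1, h.2⟩, fun h => ⟨(hW x h.2.1).2 h.1, h.2⟩⟩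
  rw [invMeasure, h1, traceVolume_eq, Measure.restrict_smul, withDensity_smul_measure, invVol,
    hd, ← posVol_eq_restrict]
  congr 1
  refine withDensity_congr_ae ?_
  filter_upwards [ae_posVol (m := m) (τa := τa)] with x hx
  rw [ofReal_detPow hx.2]
  rcases isEmpty_or_nonempty a with h | h
  · simp [detDensity]
  · congr 2
    have h2 := finrank_hermPart ha hm
    have hs := (scale_pos m).ne'
    have hN : (Fintype.card a : ℝ) ≠ 0 := by exact_mod_cast Fintype.card_ne_zero
    rw [div_eq_div_iff hN hs, mul_comm, h2]
    ring

lemma withDensity_invVol (e : ℝ) : (invVol m τa).withDensity (detDensity e) =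
    (posVol m τa).withDensity (detDensity (e - (Fintype.card a + m) / scale m)) := by
  rw [invVol, ← withDensity_mul _ (by fun_prop) (by fun_prop)]
  refine withDensity_congr_ae ?_
  filter_upwards [ae_posVol (m := m) (τa := τa)] with x hx
  rw [Pi.mul_apply, ← detDensity_add _ _ (posSet_det_ne_zero hx)]
  congr 1
  ring

/-- The distribution of `X Xᴴ` in terms of the invariant measure. -/
theorem gramVol_eq_invMeasure (ha : IsRealStructure m τa) (hb : IsRealStructure m τb)
    (hc : IsRealStructure m τc) (hm : m = 0 ∨ m = 1 ∨ m = -1)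
    (hcard : Fintype.card a + Fintype.card c = Fintype.card b) {s : ℕ} (hs : 0 < s) {d : ℕ}
    {W : Submodule ℂ (Matrix a a ℂ)} (hW : ∀ x, xᴴ = x → (x ∈ W ↔ x ∈ hermPart m τa))
    (hd : d = finrank ℝ (hermPart m τa)) :
    gramVol m τa τb = ENNReal.ofReal ((s : ℝ) ^ ((d : ℝ) / 2) * 2 ^ (-(d : ℝ)) *
        2 ^ (-(finrank ℝ (intertwiners m τa τc) : ℝ) / 2) *
        ((unitaryVol m τb).toReal / (unitaryVol m τc).toReal)) •
      (invMeasure s d W).withDensity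
        (fun x => ENNReal.ofReal (detPow (Fintype.card b / scale m) x)) := by
  obtain ⟨k, hk0, hkt, hk, hv⟩ := gramVol_eq ha hb hc hm hcard
  have hc0 := (unitaryVol_mul_gammaInt hc hm).1
  have hct := (unitaryVol_lt_top hc).ne
  have hcR : (unitaryVol m τc).toReal ≠ 0 := ENNReal.toReal_ne_zero.2 ⟨hc0, hct⟩
  have hsR : (0 : ℝ) < s := by exact_mod_cast hs
  have hkR : k = ENNReal.ofReal k.toReal := (ENNReal.ofReal_toReal hkt).symm
  have hvR : (unitaryVol m τb).toReal = k.toReal * (unitaryVol m τc).toReal * 2 ^ (d : ℝ) *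
      2 ^ ((finrank ℝ (intertwiners m τa τc) : ℝ) / 2) := by
    rw [hv, ENNReal.toReal_mul, ENNReal.toReal_mul, ENNReal.toReal_mul,
      ENNReal.toReal_ofReal (by positivity), ← hd, ENNReal.toReal_pow, ENNReal.toReal_ofNat,
      Real.rpow_natCast, Real.sqrt_eq_rpow, ← Real.rpow_mul_natCast zero_le_two]
    congr 2
    ring
  have hdens : (invMeasure s d W).withDensity
        (fun x => ENNReal.ofReal (detPow (Fintype.card b / scale m) x)) =
      ENNReal.ofReal ((s : ℝ) ^ (-(d : ℝ) / 2)) •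
        (posVol m τa).withDensity (detDensity ((Fintype.card c - m) / scale m)) := by
    rw [invMeasure_eq ha hm s hW hd, withDensity_smul_measure]
    congr 1
    have : (Fintype.card c - m) / scale m =
        Fintype.card b / scale m - (Fintype.card a + m) / scale m := by
      rw [← hcard, Nat.cast_add]
      ring
    rw [this, ← withDensity_invVol]
    refine withDensity_congr_ae ?_
    filter_upwards [(withDensity_absolutelyContinuous _ _).ae_le
      (ae_posVol (m := m) (τa := τa))] with x hx
    rw [ofReal_detPow hx.2]
  rw [hdens, hk, smul_smul, ← ENNReal.ofReal_mul (by positivity), hvR]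
  congr 1
  rw [hkR]
  simp only [ENNReal.toReal_ofReal ENNReal.toReal_nonneg]
  congr 1
  have e1 : (s : ℝ) ^ ((d : ℝ) / 2) * (s : ℝ) ^ (-(d : ℝ) / 2) = 1 := by
    rw [← Real.rpow_add hsR, ← Real.rpow_zero (s : ℝ)]
    congr 1; ring
  have e2 : (2 : ℝ) ^ (-(d : ℝ)) * 2 ^ (d : ℝ) = 1 := by
    rw [← Real.rpow_add two_pos, neg_add_cancel, Real.rpow_zero]
  have e3 : (2 : ℝ) ^ (-(finrank ℝ (intertwiners m τa τc) : ℝ) / 2) *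
      2 ^ ((finrank ℝ (intertwiners m τa τc) : ℝ) / 2) = 1 := by
    rw [← Real.rpow_add two_pos, ← Real.rpow_zero (2 : ℝ)]
    congr 1; ring
  rw [mul_assoc k.toReal, mul_assoc k.toReal, mul_div_assoc]
  have e4 : (unitaryVol m τc).toReal * 2 ^ (d : ℝ) *
      2 ^ ((finrank ℝ (intertwiners m τa τc) : ℝ) / 2) / (unitaryVol m τc).toReal =
      2 ^ (d : ℝ) * 2 ^ ((finrank ℝ (intertwiners m τa τc) : ℝ) / 2) := by
    field_simp
  rw [e4]
  generalize (s : ℝ) ^ ((d : ℝ) / 2) = A at *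
  generalize (s : ℝ) ^ (-(d : ℝ) / 2) = A' at *
  generalize (2 : ℝ) ^ (d : ℝ) = B at *
  generalize (2 : ℝ) ^ (-(d : ℝ)) = B' at *
  generalize (2 : ℝ) ^ (-(finrank ℝ (intertwiners m τa τc) : ℝ) / 2) = C' at *
  generalize (2 : ℝ) ^ ((finrank ℝ (intertwiners m τa τc) : ℝ) / 2) = C at *
  linear_combination (-k.toReal) * (e1 * (B' * B) * (C' * C) + e2 * (C' * C) + e3)

end Transfer

/-! ### Change of variables -/

section Integral

/-- The change of variables formula for a measure whose image has a density. -/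
lemma integral_of_map_eq {α β : Type*} [MeasurableSpace α] [MeasurableSpace β] {ν : Measure α}
    {μ : Measure β} {Q : α → β} (hQ : Measurable Q) {w : β → ℝ} (hw : Measurable w)
    (hw0 : ∀ᵐ x ∂μ, 0 ≤ w x) {C : ℝ} (hC : 0 < C)
    (h : ν.map Q = ENNReal.ofReal C • μ.withDensity fun x => ENNReal.ofReal (w x))
    {F : β → ℂ} (hF : AEStronglyMeasurable F μ) (hi : Integrable (F ∘ Q) ν) :
    Integrable (fun x => F x * (w x : ℂ)) μ ∧
      ∫ x, F (Q x) ∂ν = C * ∫ x, F x * (w x : ℂ) ∂μ := by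
  have hFd : AEStronglyMeasurable F (μ.withDensity fun x => ENNReal.ofReal (w x)) :=
    hF.mono_ac (withDensity_absolutelyContinuous _ _)
  have hFm : AEStronglyMeasurable F (ν.map Q) := by
    rw [h]
    exact hFd.smul_measure _
  have h1 : Integrable F (ν.map Q) := (integrable_map_measure hFm hQ.aemeasurable).2 hi
  have hC0 : ENNReal.ofReal C ≠ 0 := by simpa using hC
  rw [h, integrable_smul_measure hC0 ENNReal.ofReal_ne_top] at h1
  have hwm : Measurable fun x => ENNReal.ofReal (w x) := hw.ennreal_ofReal
  have hwt : ∀ᵐ x ∂μ, ENNReal.ofReal (w x) < ⊤ :=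
    Filter.Eventually.of_forall fun x => ENNReal.ofReal_lt_top
  have heq : (fun x => (ENNReal.ofReal (w x)).toReal • F x) =ᵐ[μ] fun x => F x * (w x : ℂ) := by
    filter_upwards [hw0] with x hx
    rw [ENNReal.toReal_ofReal hx, Complex.real_smul, mul_comm]
  constructor
  · exact ((integrable_withDensity_iff_integrable_smul' hwm hwt).1 h1).congr heq
  · rw [← integral_map hQ.aemeasurable hFm, h, integral_smul_measure,
      integral_withDensity_eq_integral_toReal_smul hwm hwt, integral_congr_ae heq,
      ENNReal.toReal_ofReal hC.le, Complex.real_smul]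

end Integral

end

end BosonSector

namespace BosonSector

noncomputable section

set_option linter.unusedSectionVars false

open scoped Matrix.Norms.Frobenius
open Module

/-! ### The integration formula for a general real structure -/

section Formula

variable {p n : ℕ}

lemma finrank_top_matrix :
    finrank ℝ (⊤ : Submodule ℝ (Matrix (Fin p) (Fin n) ℂ)) = 2 * p * n := by
  rw [finrank_top, finrank_real_of_complex, finrank_matrix]
  simp [mul_assoc]

lemma dvol_eq : dvol p n = subVol (⊤ : Submodule ℝ (Matrix (Fin p) (Fin n) ℂ)) := by
  rw [dvol, traceVolume_eq, subVol, finrank_top_matrix]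
  simp

lemma integrable_gaussian_dvol : Integrable (fun L => Real.exp (-‖L‖ ^ 2)) (dvol p n) ∧
    ∫ L, Real.exp (-‖L‖ ^ 2) ∂dvol p n = Real.pi ^ (p * n) := by
  have h := lintegral_gaussian_subVol (⊤ : Submodule ℝ (Matrix (Fin p) (Fin n) ℂ))
  have hm : AEStronglyMeasurable (fun L : Matrix (Fin p) (Fin n) ℂ => Real.exp (-‖L‖ ^ 2))
      (dvol p n) := by
    refine Continuous.aestronglyMeasurable ?_
    fun_prop
  have h0 : 0 ≤ᵐ[dvol p n] fun L : Matrix (Fin p) (Fin n) ℂ => Real.exp (-‖L‖ ^ 2) :=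
    Filter.Eventually.of_forall fun L => (Real.exp_pos _).le
  rw [← dvol_eq, finrank_top_matrix] at h
  have e : (((2 * p * n : ℕ) : ℝ) / 2) = ((p * n : ℕ) : ℝ) := by push_cast; ring
  rw [e, Real.rpow_natCast] at h
  constructor
  · refine ⟨hm, (hasFiniteIntegral_iff_ofReal h0).2 ?_⟩
    rw [h]
    exact ENNReal.ofReal_lt_top
  · rw [integral_eq_lintegral_of_nonneg_ae h0 hm, h, ENNReal.toReal_ofReal (by positivity)]

/-- `dvol` is translation invariant and gives the unit ball positive finite measure, so it is a Haar
measure on the coordinate space where Schwartz functions are known to be integrable. -/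
lemma IsSchwartz.integrable {φ : Matrix (Fin p) (Fin n) ℂ → ℂ} (h : IsSchwartz φ) :
    Integrable φ (dvol p n) := by
  obtain ⟨ψ, hψ⟩ := h
  let ν : Measure (Fin p → Fin n → ℂ) := dvol p n
  have hadd : ∀ g : Matrix (Fin p) (Fin n) ℂ, (dvol p n).map (fun y => g + y) = dvol p n :=
    fun g => by rw [dvol_eq, map_add_subVol _ Submodule.mem_top]
  have hinv : ν.IsAddLeftInvariant := ⟨hadd⟩
  have hcpt : IsCompact (Metric.closedBall (0 : Matrix (Fin p) (Fin n) ℂ) 1) :=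
    isCompact_closedBall 0 1
  have h0 : dvol p n (Metric.closedBall 0 1) ≠ 0 := by
    rw [dvol_eq]
    have := subVol_pos (⊤ : Submodule ℝ (Matrix (Fin p) (Fin n) ℂ)) (U := Metric.ball 0 1)
      Metric.isOpen_ball ⟨0, Metric.mem_ball_self one_pos, Submodule.mem_top⟩
    exact (this.trans_le (measure_mono Metric.ball_subset_closedBall)).ne'
  have ht : dvol p n (Metric.closedBall 0 1) ≠ ⊤ := by
    rw [dvol_eq]
    exact (subVol_lt_top _ Metric.isBounded_closedBall).ne
  have hint : (interior (Metric.closedBall (0 : Matrix (Fin p) (Fin n) ℂ) 1)).Nonempty :=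
    ⟨0, Metric.ball_subset_interior_closedBall (Metric.mem_ball_self one_pos)⟩
  have hH : ν.IsAddHaarMeasure :=
    Measure.isAddHaarMeasure_of_isCompact_nonempty_interior ν _ hcpt hint h0 ht
  have hi : Integrable (fun L : Fin p → Fin n → ℂ => ψ L) ν := ψ.integrable
  have heq : φ = fun L => ψ (fun i j => L i j) := funext fun L => (hψ L).symm
  rw [heq]
  exact hi

variable {a b c : Type*} [Fintype a] [Fintype b] [Fintype c] [DecidableEq a] [DecidableEq b]
  [DecidableEq c] {m : ℤ} {τa : Matrix a a ℂ} {τb : Matrix b b ℂ} {τc : Matrix c c ℂ}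

lemma ae_invMeasure (ha : IsRealStructure m τa) (hm : m = 0 ∨ m = 1 ∨ m = -1) (s : ℕ) {d : ℕ}
    {W : Submodule ℂ (Matrix a a ℂ)} (hW : ∀ x, xᴴ = x → (x ∈ W ↔ x ∈ hermPart m τa))
    (hd : d = finrank ℝ (hermPart m τa)) : ∀ᵐ x ∂invMeasure s d W, x ∈ posSet m τa := by
  rw [invMeasure_eq ha hm s hW hd]
  exact Measure.ae_smul_measure (isInvariant_invVol ha hm).null _

lemma map_conj_invMeasure (ha : IsRealStructure m τa) (hm : m = 0 ∨ m = 1 ∨ m = -1) (s : ℕ) {d : ℕ}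
    {W : Submodule ℂ (Matrix a a ℂ)} (hW : ∀ x, xᴴ = x → (x ∈ W ↔ x ∈ hermPart m τa))
    (hd : d = finrank ℝ (hermPart m τa)) {g : Matrix a a ℂ} (hg : g ∈ intertwiners m τa τa)
    (hg0 : g.det ≠ 0) :
    (invMeasure s d W).map (fun x => g * x * gᴴ) = invMeasure s d W := by
  rw [invMeasure_eq ha hm s hW hd, Measure.map_smul, (isInvariant_invVol ha hm).inv g hg hg0]

/-- The integration formula and the normalization integral, for any parametrization `T` of the
intertwiners by matrices which multiplies the norm square by `s`. -/
theorem integral_formula (ha : IsRealStructure m τa) (hb : IsRealStructure m τb)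
    (hc : IsRealStructure m τc) (hm : m = 0 ∨ m = 1 ∨ m = -1)
    (hcard : Fintype.card a + Fintype.card c = Fintype.card b) {s : ℕ} (hs : 0 < s) {d : ℕ}
    {W : Submodule ℂ (Matrix a a ℂ)} (hW : ∀ x, xᴴ = x → (x ∈ W ↔ x ∈ hermPart m τa))
    (hd : d = finrank ℝ (hermPart m τa))
    (T : Matrix (Fin p) (Fin n) ℂ →ₗ[ℝ] Matrix a b ℂ)
    (hT : ∀ L, ‖T L‖ ^ 2 = s * ‖L‖ ^ 2) (hr : (⊤ : Submodule ℝ _).map T = intertwiners m τa τb)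
    {C : ℝ} (hC : C = ((s : ℝ) ^ (p * n))⁻¹ * ((s : ℝ) ^ ((d : ℝ) / 2) * 2 ^ (-(d : ℝ)) *
        2 ^ (-(finrank ℝ (intertwiners m τa τc) : ℝ) / 2) *
        ((unitaryVol m τb).toReal / (unitaryVol m τc).toReal)))
    {e : ℝ} (he : e = Fintype.card b / scale m) :
    (∀ (φ : Matrix (Fin p) (Fin n) ℂ → ℂ) (F : Matrix a a ℂ → ℂ), IsSchwartz φ →
      AEStronglyMeasurable F (invMeasure s d W) → (∀ L, F (T L * (T L)ᴴ) = φ L) →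
      Integrable φ (dvol p n) ∧ Integrable (fun x => F x * (detPow e x : ℂ)) (invMeasure s d W) ∧
      ∫ L, φ L ∂dvol p n = C * ∫ x, F x * (detPow e x : ℂ) ∂invMeasure s d W) ∧
    ∫ x, Real.exp (-(x.trace.re / s)) * detPow e x ∂invMeasure s d W = Real.pi ^ (p * n) / C := by
  have hsR : (0 : ℝ) < s := by exact_mod_cast hs
  have hTm : Measurable T := (LinearMap.continuous_of_finiteDimensional T).measurable
  have hQ : Measurable fun L => T L * (T L)ᴴ := by fun_prop
  have hC0 : 0 < C := by
    have h1 := ENNReal.toReal_pos (unitaryVol_mul_gammaInt hb hm).1 (unitaryVol_lt_top hb).ne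
    have h2 := ENNReal.toReal_pos (unitaryVol_mul_gammaInt hc hm).1 (unitaryVol_lt_top hc).ne
    rw [hC]
    positivity
  have hw0 : ∀ᵐ x ∂invMeasure s d W, 0 ≤ detPow e x := by
    filter_upwards [ae_invMeasure ha hm s hW hd] with x hx
    rw [detPow, det_re_eq_norm hx.2]
    positivity
  have hmap : (dvol p n).map (fun L => T L * (T L)ᴴ) = ENNReal.ofReal C •
      (invMeasure s d W).withDensity fun x => ENNReal.ofReal (detPow e x) := by
    -- `T` scales lengths by `√s` on a space of real dimension `2pn`.
    have h1 : (dvol p n).map T = ENNReal.ofReal (((s : ℝ) ^ (p * n))⁻¹) •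
        subVol (intertwiners m τa τb) := by
      rw [dvol_eq, map_similarity_subVol _ T (c := √s) (by positivity) fun L _ =>
        (sq_eq_sq₀ (norm_nonneg _) (by positivity)).1 (by
          rw [hT, mul_pow, Real.sq_sqrt hsR.le]), hr, finrank_top_matrix, mul_assoc, pow_mul,
        Real.sq_sqrt hsR.le]
    have hg : Measurable fun X : Matrix a b ℂ => X * Xᴴ := by fun_prop
    rw [show (fun L => T L * (T L)ᴴ) = (fun X => X * Xᴴ) ∘ T from rfl, ← Measure.map_map hg hTm, h1,
      Measure.map_smul, ← gramVol, gramVol_eq_invMeasure ha hb hc hm hcard hs hW hd, smul_smul,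
      ← ENNReal.ofReal_mul (by positivity), ← hC, he]
  constructor
  · intro φ F hφ hF hFφ
    have hi := hφ.integrable
    have hφ' : φ = F ∘ fun L => T L * (T L)ᴴ := funext fun L => (hFφ L).symm
    obtain ⟨h1, h2⟩ := integral_of_map_eq hQ (measurable_detPow e) hw0 hC0 hmap hF (hφ' ▸ hi)
    refine ⟨hi, h1, ?_⟩
    rw [← h2]
    exact integral_congr_ae (Filter.Eventually.of_forall fun L => (hFφ L).symm)
  · have hexp : Measurable fun x : Matrix a a ℂ => Real.exp (-(x.trace.re / s)) :=
      Real.measurable_exp.comp (measurable_trace_re.div_const _).neg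
    -- The normalization integral is the formula for this Gaussian, whose integral over `L` is
    -- `π^{pn}`.
    have hQt : ∀ L, Real.exp (-((T L * (T L)ᴴ).trace.re / s)) = Real.exp (-‖L‖ ^ 2) := fun L => by
      rw [← norm_sq_eq_trace, hT, mul_div_cancel_left₀ _ hsR.ne']
    obtain ⟨g1, g2⟩ := integrable_gaussian_dvol (p := p) (n := n)
    have h := (integral_of_map_eq (F := fun x => ((Real.exp (-(x.trace.re / s)) : ℝ) : ℂ)) hQ
      (measurable_detPow e) hw0 hC0 hmap
      (Complex.measurable_ofReal.comp hexp).aestronglyMeasurable (by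
        have := g1.ofReal (𝕜 := ℂ)
        refine this.congr (Filter.Eventually.of_forall fun L => ?_)
        show _ = ((Real.exp (-((T L * (T L)ᴴ).trace.re / s)) : ℝ) : ℂ)
        rw [hQt]
        rfl)).2
    simp_rw [hQt, ← Complex.ofReal_mul] at h
    rw [integral_complex_ofReal, integral_complex_ofReal, g2, ← Complex.ofReal_mul,
      Complex.ofReal_inj] at h
    rw [h, mul_div_cancel_left₀ _ hC0.ne']

end Formula

end

end BosonSector

namespace BosonSector

noncomputable section

set_option linter.unusedSectionVars false

open Module

/-! ### The case of `GL_n` -/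

section UnitaryCase

lemma isRealStructure_zero_one {a : Type*} [Fintype a] [DecidableEq a] :
    IsRealStructure 0 (1 : Matrix a a ℂ) :=
  ⟨by simp, by simp, fun h => absurd rfl h⟩

lemma mem_hermPart_zero {a : Type*} [Fintype a] [DecidableEq a] {τ x : Matrix a a ℂ}
    (hx : xᴴ = x) : x ∈ hermPart 0 τ := ⟨fun h => absurd rfl h, hx⟩

lemma finrank_hermPart_zero (p : ℕ) :
    p ^ 2 = finrank ℝ (hermPart 0 (1 : Matrix (Fin p) (Fin p) ℂ)) := by
  have h := finrank_hermPart (isRealStructure_zero_one (a := Fin p)) (Or.inl rfl)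
  rw [scale_zero, one_mul, Fintype.card_fin, Int.cast_zero, add_zero] at h
  have : ((p ^ 2 : ℕ) : ℝ) = finrank ℝ (hermPart 0 (1 : Matrix (Fin p) (Fin p) ℂ)) := by
    rw [h]; push_cast; ring
  exact_mod_cast this

lemma volU_eq (n : ℕ) : volU n = (unitaryVol 0 (1 : Matrix (Fin n) (Fin n) ℂ)).toReal := by
  have hd : finrank ℝ (skewPart 0 (1 : Matrix (Fin n) (Fin n) ℂ)) = n ^ 2 := by
    have h := finrank_skewPart (isRealStructure_zero_one (a := Fin n)) (Or.inl rfl)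
    rw [scale_zero, one_mul, Fintype.card_fin, Int.cast_zero, sub_zero] at h
    have : (finrank ℝ (skewPart 0 (1 : Matrix (Fin n) (Fin n) ℂ)) : ℝ) = ((n ^ 2 : ℕ) : ℝ) := by
      rw [h]; push_cast; ring
    exact_mod_cast this
  have hs : (unitaryGroup (Fin n) ℂ : Set (Matrix (Fin n) (Fin n) ℂ)) =
      unitarySet 0 (1 : Matrix (Fin n) (Fin n) ℂ) := by
    ext k
    rw [SetLike.mem_coe, mem_unitaryGroup_iff]
    exact ⟨fun h => ⟨fun h0 => absurd rfl h0, h⟩, fun h => h.2⟩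
  rw [volU, traceVolume_eq, hs, unitaryVol, hd, measureReal_def]
  simp

open scoped Matrix.Norms.Frobenius in
theorem formula_unitary {p n : ℕ} (h : p ≤ n) :
    (∀ (φ : Matrix (Fin p) (Fin n) ℂ → ℂ) (F : Matrix (Fin p) (Fin p) ℂ → ℂ), IsSchwartz φ →
      AEStronglyMeasurable F (muU p) → (∀ L, F (L * Lᴴ) = φ L) →
      Integrable φ (dvol p n) ∧ Integrable (fun x => F x * (detPow n x : ℂ)) (muU p) ∧
      ∫ L, φ L ∂dvol p n = (((2 : ℝ) ^ (-((p : ℤ) * n)) * (volU n / volU (n - p)) : ℝ) : ℂ) *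
        ∫ x, F x * (detPow n x : ℂ) ∂muU p) ∧
    ∫ x, Real.exp (-x.trace.re) * detPow n x ∂muU p =
      Real.pi ^ (p * n) / ((2 : ℝ) ^ (-((p : ℤ) * n)) * (volU n / volU (n - p))) := by
  have key := integral_formula (p := p) (n := n)
    (isRealStructure_zero_one (a := Fin p)) (isRealStructure_zero_one (a := Fin n))
    (isRealStructure_zero_one (a := Fin (n - p))) (Or.inl rfl)
    (by simp only [Fintype.card_fin]; omega) one_pos (W := ⊤)
    (fun x hx => ⟨fun _ => mem_hermPart_zero hx, fun _ => trivial⟩) (finrank_hermPart_zero p)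
    LinearMap.id (fun L => by simp) (by rw [Submodule.map_id, intertwiners_zero])
    -- The power of 2 comes from `p²` Hermitian dimensions and half of the `2p(n - p)` dimensions of
    -- the intertwiners with the complement: `p² + p(n - p) = pn`.
    (C := (2 : ℝ) ^ (-((p : ℤ) * n)) * (volU n / volU (n - p))) (by
      have hq := finrank_intertwiners (isRealStructure_zero_one (a := Fin p))
        (isRealStructure_zero_one (a := Fin (n - p))) (Or.inl rfl)
      rw [scale_zero, one_mul, Fintype.card_fin, Fintype.card_fin, Nat.cast_sub h] at hq
      rw [volU_eq, volU_eq, hq, Nat.cast_one, one_pow, Real.one_rpow, inv_one, one_mul, one_mul,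
        ← Real.rpow_add two_pos, ← Real.rpow_intCast]
      congr 2
      push_cast
      ring) (e := n) (by simp [scale_zero])
  simp only [LinearMap.id_apply, Nat.cast_one, div_one] at key
  exact key

end UnitaryCase

/-! ### The cases of `O_n` and `Sp_n` -/

section FormCase

variable {m : ℤ} {p n : ℕ}

lemma mul_self_of_sign (hm : m = 1 ∨ m = -1) : m * m = 1 := by
  rcases hm with rfl | rfl <;> rfl

lemma sign_ne_zero (hm : m = 1 ∨ m = -1) : m ≠ 0 := by
  rcases hm with rfl | rfl <;> decide

lemma isRealStructure_canonicalForm (hm : m = 1 ∨ m = -1) :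
    IsRealStructure m (canonicalForm m p) := by
  have h := mul_self_of_sign hm
  have h1 : (m • (1 : Matrix (Fin p) (Fin p) ℂ))ᴴ = m • 1 := by simp
  have h2 : (m : Matrix (Fin p) (Fin p) ℂ) * m = 1 := by rw [← Int.cast_mul, h, Int.cast_one]
  refine ⟨?_, ?_, fun _ => ?_⟩
  · rw [canonicalForm, fromBlocks_conjTranspose, fromBlocks_multiply, h1]
    simp [h2]
  · rw [canonicalForm, fromBlocks_conjTranspose, fromBlocks_multiply, h1]
    simp [h2]
  · rw [canonicalForm, fromBlocks_transpose, fromBlocks_smul]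
    simp [h2]

lemma canonicalForm_mul_self (m : ℤ) :
    canonicalForm m p * canonicalForm m p = m • 1 := by
  rw [canonicalForm, fromBlocks_multiply, ← fromBlocks_one, fromBlocks_smul]
  simp

/-- For Hermitian `x` the transpose is the complex conjugate, so self-adjointness for `b` and
commutation with the real structure differ only by the side on which the conjugate stands; the sides
are exchanged using that the square of the Gram matrix is `m`. -/
lemma mem_symSpace_iff (hm : m = 1 ∨ m = -1) (x : Matrix (Fin p ⊕ Fin p) (Fin p ⊕ Fin p) ℂ)
    (hx : xᴴ = x) : x ∈ symSpace m p ↔ x ∈ hermPart m (canonicalForm m p) := by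
  have hmm := mul_self_of_sign hm
  have hJ := canonicalForm_mul_self (p := p) m
  have key : ∀ A B : Matrix (Fin p ⊕ Fin p) (Fin p ⊕ Fin p) ℂ,
      A * canonicalForm m p = canonicalForm m p * B →
      B * canonicalForm m p = canonicalForm m p * A := by
    intro A B h
    have h1 : canonicalForm m p * (A * canonicalForm m p) * canonicalForm m p =
        canonicalForm m p * (canonicalForm m p * B) * canonicalForm m p := by rw [h]
    have h2 : m • (canonicalForm m p * A) = m • (B * canonicalForm m p) := by
      calc m • (canonicalForm m p * A)
          = canonicalForm m p * A * (canonicalForm m p * canonicalForm m p) := by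
            rw [hJ, Matrix.mul_smul, Matrix.mul_one]
        _ = canonicalForm m p * canonicalForm m p * (B * canonicalForm m p) := by
          simpa only [Matrix.mul_assoc] using h1
        _ = _ := by rw [hJ, Matrix.smul_mul, Matrix.one_mul]
    have h3 := congrArg (fun M => m • M) h2
    simp only [smul_smul, hmm, one_smul] at h3
    exact h3.symm
  constructor
  · intro h
    refine ⟨fun _ => ?_, hx⟩
    rw [hx]
    exact key _ _ h
  · rintro ⟨h, -⟩
    have h1 := h (sign_ne_zero hm)
    rw [hx] at h1
    exact key _ _ h1

lemma IsForm.mul_star {β : Matrix (Fin n) (Fin n) ℂ} (hβ : IsForm m β) : β * βᴴ = 1 :=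
  mem_unitaryGroup_iff.1 hβ.1

lemma IsForm.conj_eq {β : Matrix (Fin n) (Fin n) ℂ} (hβ : IsForm m β) :
    βᴴᵀ = m • βᴴ := by
  have h := congrArg conjTranspose hβ.2
  rwa [conjTranspose_zsmul] at h

lemma IsForm.isRealStructure (hm : m = 1 ∨ m = -1) {β : Matrix (Fin n) (Fin n) ℂ}
    (hβ : IsForm m β) : IsRealStructure m βᴴᵀ := by
  have h1 := hβ.mul_star
  have h2 : βᴴ * β = 1 := mul_eq_one_comm.1 h1
  have h3 : βᴴᵀᴴ = m • β := by
    rw [hβ.conj_eq, conjTranspose_zsmul, conjTranspose_conjTranspose]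
  refine ⟨?_, ?_, fun _ => ?_⟩
  · rw [h3, hβ.conj_eq, Matrix.smul_mul, Matrix.mul_smul, smul_smul, mul_self_of_sign hm,
      one_smul, h2]
  · rw [h3, hβ.conj_eq, Matrix.smul_mul, Matrix.mul_smul, smul_smul, mul_self_of_sign hm,
      one_smul, h1]
  · rw [transpose_transpose, hβ.conj_eq, smul_smul, mul_self_of_sign hm, one_smul]

/-- The parametrization of the intertwiners from `ℂⁿ` to `U_p` by their first block row. -/
def formLin (p : ℕ) (β : Matrix (Fin n) (Fin n) ℂ) :
    Matrix (Fin p) (Fin n) ℂ →ₗ[ℝ] Matrix (Fin p ⊕ Fin p) (Fin n) ℂ where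
  toFun L := fromRows L (Lᴴᵀ * β)
  map_add' L M := by
    ext (i | i) j
    · simp
    · simp [Matrix.add_mul]
  map_smul' r L := by
    ext (i | i) j
    · simp
    · simp

/-- The four blocks of the Gram matrix of `(L, conj(L) β)` are those of `Q(L, Lᴴ)`, using only `β⁻¹
= βᴴ`. -/
lemma formLin_mul_star {β : Matrix (Fin n) (Fin n) ℂ} (hβ : IsForm m β)
    (L : Matrix (Fin p) (Fin n) ℂ) :
    formLin p β L * (formLin p β L)ᴴ = quadMap β (L, Lᴴ) := by
  have h1 : (Lᴴᵀ)ᴴ = Lᵀ := by ext; simp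
  have h2 : β⁻¹ = βᴴ := inv_eq_right_inv hβ.mul_star
  show fromRows L (Lᴴᵀ * β) * (fromRows L (Lᴴᵀ * β))ᴴ = _
  rw [conjTranspose_fromRows_eq_fromCols_conjTranspose, fromRows_mul_fromCols, quadMap,
    conjTranspose_mul, h1, h2]
  simp only [Matrix.mul_assoc]
  rw [← Matrix.mul_assoc β βᴴ, hβ.mul_star, Matrix.one_mul]

open scoped Matrix.Norms.Frobenius in
lemma norm_sq_formLin {β : Matrix (Fin n) (Fin n) ℂ} (hβ : IsForm m β)
    (L : Matrix (Fin p) (Fin n) ℂ) : ‖formLin p β L‖ ^ 2 = (2 : ℕ) * ‖L‖ ^ 2 := by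
  have h1 : (Lᴴᵀ * Lᵀ).trace = (L * Lᴴ).trace := by
    rw [← transpose_mul, trace_transpose]
  rw [norm_sq_eq_trace, formLin_mul_star hβ, quadMap, trace_fromBlocks', norm_sq_eq_trace, h1,
    Complex.add_re]
  push_cast
  ring

/-- The canonical structure swaps the two block rows up to conjugation and sign, so the intertwining
relation says that the second row is `conj(A) β` for the first row `A`, and `A` is arbitrary. -/
lemma map_formLin (hm : m = 1 ∨ m = -1) {β : Matrix (Fin n) (Fin n) ℂ} (hβ : IsForm m β) :
    (⊤ : Submodule ℝ _).map (formLin p β) = intertwiners m (canonicalForm m p) βᴴᵀ := by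
  have hb := hβ.mul_star
  have hb' : βᴴ * β = 1 := mul_eq_one_comm.1 hb
  have hc := hβ.conj_eq
  have hJ : ∀ A B : Matrix (Fin p) (Fin n) ℂ,
      canonicalForm m p * (fromRows A B)ᴴᵀ = fromRows Bᴴᵀ (m • Aᴴᵀ) := by
    intro A B
    have : (fromRows A B)ᴴᵀ = fromRows Aᴴᵀ Bᴴᵀ := by
      ext (i | i) j <;> simp
    rw [this, canonicalForm, fromBlocks_mul_fromRows]
    simp only [Matrix.zero_mul, Matrix.one_mul, Matrix.smul_mul, zero_add, add_zero]
  ext X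
  constructor
  · rintro ⟨L, -, rfl⟩ _
    show fromRows L (Lᴴᵀ * β) * βᴴᵀ = canonicalForm m p * (fromRows L (Lᴴᵀ * β))ᴴᵀ
    have h1 : (Lᴴᵀ * β)ᴴᵀ = L * βᴴᵀ := by
      rw [conjTranspose_mul, transpose_mul]
      congr 1
      ext; simp
    rw [hJ, fromRows_mul, h1]
    congr 1
    rw [hc, Matrix.mul_smul, Matrix.mul_assoc, hb, Matrix.mul_one]
  · intro hX
    have h := hX (sign_ne_zero hm)
    obtain ⟨A, B, rfl⟩ : ∃ A B, X = fromRows A B := ⟨_, _, (fromRows_toRows X).symm⟩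
    rw [hJ, fromRows_mul] at h
    have h1 : A * βᴴᵀ = Bᴴᵀ := (fromRows_inj h).1
    refine ⟨A, trivial, ?_⟩
    show fromRows A (Aᴴᵀ * β) = fromRows A B
    congr 1
    have h2 := congrArg (fun M : Matrix (Fin p) (Fin n) ℂ => Mᴴᵀ) h1
    simp only [conj_conj] at h2
    rw [← h2, conjTranspose_mul, transpose_mul]
    congr 1
    ext; simp

lemma mem_intertwiners_of_realGroup {g : GL (Fin p ⊕ Fin p) ℂ} (hg : g ∈ realGroup m p) :
    g.1 ∈ intertwiners m (canonicalForm m p) (canonicalForm m p) := fun _ => hg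

/-- For unitary `k`, conjugating `kᵀ β k = β` and multiplying by `k` gives `k conj(β) = conj(β)
conj(k)`: preserving the form and commuting with the anti-unitary operator are the same condition.
-/
lemma compactFormGroup_eq (hm : m = 1 ∨ m = -1) {β : Matrix (Fin n) (Fin n) ℂ} :
    compactFormGroup β = unitarySet m βᴴᵀ := by
  ext k
  have hconj : ∀ A B C : Matrix (Fin n) (Fin n) ℂ, (A * B * C)ᴴᵀ = Aᴴᵀ * Bᴴᵀ * Cᴴᵀ := by
    intro A B C
    simp only [conjTranspose_mul, transpose_mul, Matrix.mul_assoc]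
  have hk : kᵀᴴᵀ = kᴴ := by ext; simp
  constructor
  · rintro ⟨h1, h2⟩
    have h3 : k * kᴴ = 1 := mem_unitaryGroup_iff.1 h1
    refine ⟨fun _ => ?_, h3⟩
    have h4 := congrArg (fun M : Matrix (Fin n) (Fin n) ℂ => Mᴴᵀ) h2
    simp only [hconj, hk] at h4
    conv_lhs => rw [← h4]
    rw [← Matrix.mul_assoc, ← Matrix.mul_assoc, h3, Matrix.one_mul]
  · rintro ⟨h1, h3⟩
    refine ⟨mem_unitaryGroup_iff.2 h3, ?_⟩
    have h4 : (kᵀ * β * k)ᴴᵀ = βᴴᵀ := by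
      rw [hconj, hk, Matrix.mul_assoc, ← h1 (sign_ne_zero hm), ← Matrix.mul_assoc,
        mul_eq_one_comm.1 h3, Matrix.one_mul]
    rw [← conj_conj (kᵀ * β * k), h4, conj_conj]

lemma finrank_hermPart_canonicalForm (hm : m = 1 ∨ m = -1) :
    (finrank ℝ (hermPart m (canonicalForm m p)) : ℤ) = p * (2 * p + m) := by
  have h := finrank_hermPart (isRealStructure_canonicalForm (p := p) hm) (Or.inr hm)
  rw [scale_of_ne hm, Fintype.card_sum, Fintype.card_fin] at h
  have h2 : (finrank ℝ (hermPart m (canonicalForm m p)) : ℝ) = p * (2 * p + m) := by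
    push_cast at h
    linarith
  exact_mod_cast h2

lemma finrank_skewPart_form (hm : m = 1 ∨ m = -1) {β : Matrix (Fin n) (Fin n) ℂ}
    (hβ : IsForm m β) : 2 * (finrank ℝ (skewPart m βᴴᵀ) : ℤ) = n * (n - m) := by
  have h := finrank_skewPart (hβ.isRealStructure hm) (Or.inr hm)
  rw [scale_of_ne hm, Fintype.card_fin] at h
  exact_mod_cast h

/-- Halving the metric multiplies volumes by `2^{-1/2}` per dimension, and the group has dimension
`n (n - m) / 2`. -/
lemma volK_eq (hm : m = 1 ∨ m = -1) {β : Matrix (Fin n) (Fin n) ℂ} (hβ : IsForm m β) :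
    volK m β = (2 : ℝ) ^ (-((n : ℝ) * (n - m) / 4)) * (unitaryVol m βᴴᵀ).toReal := by
  have h := finrank_skewPart_form hm hβ
  have hd : ((n : ℤ) * (n - m) / 2).toNat = finrank ℝ (skewPart m βᴴᵀ) := by omega
  have h' : 2 * (finrank ℝ (skewPart m βᴴᵀ) : ℝ) = n * (n - m) := by exact_mod_cast h
  rw [volK, traceVolume_eq, hd, measureReal_def, Measure.smul_apply, smul_eq_mul,
    ENNReal.toReal_mul, ENNReal.toReal_ofReal (by positivity), compactFormGroup_eq hm, ← unitaryVol,
    ← h']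
  congr 2
  ring

open scoped Matrix.Norms.Frobenius in
theorem formula_form (hm : m = 1 ∨ m = -1) (h : 2 * p ≤ n) {β : Matrix (Fin n) (Fin n) ℂ}
    {β' : Matrix (Fin (n - 2 * p)) (Fin (n - 2 * p)) ℂ} (hβ : IsForm m β) (hβ' : IsForm m β') :
    (∀ (φ : Matrix (Fin p) (Fin n) ℂ → ℂ) (F : Matrix (Fin p ⊕ Fin p) (Fin p ⊕ Fin p) ℂ → ℂ),
      IsSchwartz φ → AEStronglyMeasurable F (muK m p) → (∀ L, F (quadMap β (L, Lᴴ)) = φ L) →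
      Integrable φ (dvol p n) ∧
      Integrable (fun x => F x * (detPow ((n : ℝ) / 2) x : ℂ)) (muK m p) ∧
      ∫ L, φ L ∂dvol p n = (((2 : ℝ) ^ (-((p : ℤ) * (n + m))) * (volK m β / volK m β') : ℝ) : ℂ) *
        ∫ x, F x * (detPow ((n : ℝ) / 2) x : ℂ) ∂muK m p) ∧
    ∫ x, Real.exp (-(x.trace.re / 2)) * detPow ((n : ℝ) / 2) x ∂muK m p =
      Real.pi ^ (p * n) / ((2 : ℝ) ^ (-((p : ℤ) * (n + m))) * (volK m β / volK m β')) := by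
  have hd := finrank_hermPart_canonicalForm (p := p) hm
  have hd' : (finrank ℝ (hermPart m (canonicalForm m p)) : ℝ) = p * (2 * p + m) := by
    exact_mod_cast hd
  have hdn : ((p : ℤ) * (2 * p + m)).toNat = finrank ℝ (hermPart m (canonicalForm m p)) := by
    rw [← hd, Int.toNat_natCast]
  have key := integral_formula (p := p) (n := n)
    (isRealStructure_canonicalForm (p := p) hm) (hβ.isRealStructure hm) (hβ'.isRealStructure hm)
    (Or.inr hm) (by simp only [Fintype.card_fin, Fintype.card_sum]; omega) two_pos
    (mem_symSpace_iff hm) hdn (formLin p β) (norm_sq_formLin hβ) (map_formLin hm hβ)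
    (C := (2 : ℝ) ^ (-((p : ℤ) * (n + m))) * (volK m β / volK m β')) (by
      have hq := finrank_intertwiners (isRealStructure_canonicalForm (p := p) hm)
        (hβ'.isRealStructure hm) (Or.inr hm)
      rw [scale_of_ne hm, Fintype.card_fin, Fintype.card_sum, Fintype.card_fin, Nat.cast_sub h] at hq
      have hq' : (finrank ℝ (intertwiners m (canonicalForm m p) β'ᴴᵀ) : ℝ) =
          2 * p * (n - 2 * p) := by
        push_cast at hq
        linarith
      rw [volK_eq hm hβ, volK_eq hm hβ', hq', hdn, hd', Nat.cast_sub h]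
      -- The metric factors of the two groups combine to the exponent `-p (2n - 2p - m) / 2`.
      -- Together with `-p(n + m)` this matches `-pn - d/2 - p(n - 2p)` for `d = p(2p + m)`.
      have e1 : ∀ A B : ℝ, (2 : ℝ) ^ (-((n : ℝ) * (n - m) / 4)) * A /
          ((2 : ℝ) ^ (-((((n : ℝ) - ((2 * p : ℕ) : ℝ))) * (((n : ℝ) - ((2 * p : ℕ) : ℝ)) - m) / 4)) *
            B) = (2 : ℝ) ^ (-((p : ℝ) * (2 * n - 2 * p - m) / 2)) * (A / B) := by
        intro A B
        rw [mul_div_mul_comm, ← Real.rpow_sub two_pos]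
        congr 2
        push_cast
        ring
      rw [e1, ← mul_assoc, ← mul_assoc]
      congr 1
      rw [Nat.cast_ofNat, ← Real.rpow_natCast, ← Real.rpow_neg zero_le_two,
        ← Real.rpow_add two_pos, ← Real.rpow_add two_pos, ← Real.rpow_intCast,
        ← Real.rpow_add two_pos, ← Real.rpow_add two_pos]
      congr 1
      push_cast
      ring) (e := (n : ℝ) / 2) (by rw [scale_of_ne hm, Fintype.card_fin])
  simp only [formLin_mul_star hβ, Nat.cast_ofNat] at key
  exact key

end FormCase

lemma measurableSet_symSpace (m : ℤ) (p : ℕ) :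
    MeasurableSet (symSpace m p : Set (Matrix (Fin p ⊕ Fin p) (Fin p ⊕ Fin p) ℂ)) := by
  have : IsClosed {M : Matrix (Fin p ⊕ Fin p) (Fin p ⊕ Fin p) ℂ |
      Mᵀ * canonicalForm m p = canonicalForm m p * M} :=
    isClosed_eq (continuous_id.matrix_transpose.matrix_mul continuous_const)
      (continuous_const.matrix_mul continuous_id)
  exact this.measurableSet

/-- `F` is controlled only on `W`; this suffices because the measure is carried by the positive
elements of the closed subspace `W`. -/
lemma aestronglyMeasurable_muK {m : ℤ} {p : ℕ}
    {F : Matrix (Fin p ⊕ Fin p) (Fin p ⊕ Fin p) ℂ → ℂ} (hF : ContinuousOn F (symSpace m p)) :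
    AEStronglyMeasurable F (muK m p) := by
  have h1 : AEStronglyMeasurable F
      ((traceVolume 2 ((p : ℤ) * (2 * p + m)).toNat).restrict (symSpace m p)) :=
    hF.aestronglyMeasurable (measurableSet_symSpace m p)
  refine (h1.mono_measure (Measure.restrict_mono (fun x hx => hx.1) le_rfl)).mono_ac
    (withDensity_absolutelyContinuous _ _)

end

end BosonSector

/-! ### Assembly of the three cases -/

theorem mainTheorem4 :
    -- the case `G_n = GL_n`
    (∀ p n : ℕ, p ≤ n →
      -- the measure on `D_p` is invariant under `G_p = GL_p(ℂ)`
      (∀ g : GL (Fin p) ℂ,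
        (BosonSector.muU p).map (fun x => g.1 * x * g.1ᴴ) = BosonSector.muU p) ∧
      -- the integration formula
      (∀ (f : Matrix (Fin p) (Fin n) ℂ × Matrix (Fin n) (Fin p) ℂ → ℂ)
        (F : Matrix (Fin p) (Fin p) ℂ → ℂ),
        Differentiable ℂ f →
        (∀ h : GL (Fin n) ℂ, ∀ L L', f (L * h.1, h⁻¹.1 * L') = f (L, L')) →
        BosonSector.IsSchwartz (BosonSector.realRestriction f) →
        Differentiable ℂ F →
        (∀ L L', F (L * L') = f (L, L')) →
        Integrable (BosonSector.realRestriction f) (BosonSector.dvol p n) ∧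
        Integrable (fun x => F x * (BosonSector.detPow n x : ℂ)) (BosonSector.muU p) ∧
        ∫ L, BosonSector.realRestriction f L ∂(BosonSector.dvol p n) =
          (((2 : ℝ) ^ (-((p : ℤ) * n)) *
            (BosonSector.volU n / BosonSector.volU (n - p)) : ℝ) : ℂ) *
          ∫ x, F x * (BosonSector.detPow n x : ℂ) ∂(BosonSector.muU p)) ∧
      -- the normalization integral
      ∫ x, Real.exp (-x.trace.re) * BosonSector.detPow n x ∂(BosonSector.muU p) =
        (2 * Real.pi) ^ (p * n) * (BosonSector.volU (n - p) / BosonSector.volU n)) ∧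
    -- the cases `G_n = O_n` (`m = 1`) and `G_n = Sp_n` (`m = -1`)
    (∀ m : ℤ, m = 1 ∨ m = -1 → ∀ p n : ℕ, 2 * p ≤ n →
      ∀ (β : Matrix (Fin n) (Fin n) ℂ) (β' : Matrix (Fin (n - 2 * p)) (Fin (n - 2 * p)) ℂ),
      BosonSector.IsForm m β → BosonSector.IsForm m β' →
      -- the measure on `D_p` is invariant under `G_p`
      (∀ g ∈ BosonSector.realGroup m p,
        (BosonSector.muK m p).map (fun x => g.1 * x * g.1ᴴ) = BosonSector.muK m p) ∧
      -- the integration formula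
      (∀ (f : Matrix (Fin p) (Fin n) ℂ × Matrix (Fin n) (Fin p) ℂ → ℂ)
        (F : Matrix (Fin p ⊕ Fin p) (Fin p ⊕ Fin p) ℂ → ℂ),
        Differentiable ℂ f →
        (∀ h ∈ BosonSector.formGroup β, ∀ L L', f (L * h.1, h⁻¹.1 * L') = f (L, L')) →
        BosonSector.IsSchwartz (BosonSector.realRestriction f) →
        DifferentiableOn ℂ F (BosonSector.symSpace m p) →
        (∀ L L', F (BosonSector.quadMap β (L, L')) = f (L, L')) →
        Integrable (BosonSector.realRestriction f) (BosonSector.dvol p n) ∧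
        Integrable (fun x => F x * (BosonSector.detPow ((n : ℝ) / 2) x : ℂ))
          (BosonSector.muK m p) ∧
        ∫ L, BosonSector.realRestriction f L ∂(BosonSector.dvol p n) =
          (((2 : ℝ) ^ (-((p : ℤ) * (n + m))) *
            (BosonSector.volK m β / BosonSector.volK m β') : ℝ) : ℂ) *
          ∫ x, F x * (BosonSector.detPow ((n : ℝ) / 2) x : ℂ) ∂(BosonSector.muK m p)) ∧
      -- the normalization integral
      ∫ x, Real.exp (-(x.trace.re / 2)) * BosonSector.detPow ((n : ℝ) / 2) x
          ∂(BosonSector.muK m p) =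
        (2 * Real.pi) ^ (p * n) * (2 : ℝ) ^ ((p : ℤ) * m) *
          (BosonSector.volK m β' / BosonSector.volK m β)) := by
  constructor
  · intro p n h
    obtain ⟨h2, h3⟩ := BosonSector.formula_unitary h
    refine ⟨fun g => ?_, fun f F _ _ hs hF hQ => ?_, ?_⟩
    · exact BosonSector.map_conj_invMeasure BosonSector.isRealStructure_zero_one (Or.inl rfl) 1 (W := ⊤)
        (fun x hx => ⟨fun _ => BosonSector.mem_hermPart_zero hx, fun _ => trivial⟩)
        (BosonSector.finrank_hermPart_zero p) (fun h => absurd rfl h)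
        ((isUnit_iff_isUnit_det _).1 g.isUnit).ne_zero
    · exact h2 _ F hs hF.continuous.aestronglyMeasurable fun L => hQ L Lᴴ
    · rw [h3, mul_pow, _root_.zpow_neg, ← div_div, div_inv_eq_mul, div_eq_mul_inv, inv_div]
      norm_cast
      ring
  · intro m hm p n h β β' hβ hβ'
    obtain ⟨h2, h3⟩ := BosonSector.formula_form hm h hβ hβ'
    refine ⟨fun g hg => ?_, fun f F _ _ hs hF hQ => ?_, ?_⟩
    · exact BosonSector.map_conj_invMeasure (BosonSector.isRealStructure_canonicalForm hm)
        (Or.inr hm) 2 (BosonSector.mem_symSpace_iff hm)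
        (by rw [← BosonSector.finrank_hermPart_canonicalForm hm, Int.toNat_natCast])
        (BosonSector.mem_intertwiners_of_realGroup hg)
        ((isUnit_iff_isUnit_det _).1 g.isUnit).ne_zero
    · exact h2 _ F hs (BosonSector.aestronglyMeasurable_muK hF.continuousOn) fun L => hQ L Lᴴ
    -- Dividing `π^{pn}` by `2^{-p(n + m)}` yields `(2π)^{pn} 2^{pm}`, and the ratio of volumes is
    -- inverted.
    · rw [h3, mul_pow, _root_.zpow_neg, ← div_div, div_inv_eq_mul, div_eq_mul_inv _ (_ / _), inv_div,
        mul_add, zpow_add₀ two_ne_zero]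
      norm_cast
      ring
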